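/- A set $S$ of vertices of a finite simple graph $G$ is geodetic if every vertex of $G$ lies on a shortest path between some two (not necessarily distinct) vertices of $S$; MGS is the problem of computing, for a given graph $G$ (with at least one vertex), a geodetic set of $G$ of minimum cardinality. Let $n$ be the number of vertices of $G$ and $\omega$ its clique number. Running time is counted on a random access machine that receives $n$ and the adjacency matrix of $G$, and whose elementary steps are register and array accesses, additions, truncated subtractions and tests. (1) There is an algorithm that solves MGS on every chordal graph (a graph with no induced cycle of order greater than $3$) in time $2^{2^{O(\omega)}}n^{O(1)}$. (2) There is an algorithm that solves MGS on every interval graph (a graph whose vertices can be represented by closed intervals of the real line so that distinct vertices are adjacent exactly when their intervals intersect) in time $2^{O(\omega)}n^{O(1)}$. (3) A $k$-tree is a graph obtained from a complete graph on $k+1$ vertices by repeatedly adding a vertex adjacent to exactly $k$ earlier vertices, which are pairwise adjacent. There is an algorithm that solves MGS on every $k$-tree, for every $k\ge 0$, in time $2^{2^{O(k+1)}}n^{O(1)}$; in particular, for each fixed $k$, MGS is solvable in polynomial time on $k$-trees. -/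

import Mathlib

/-! ### Geodetic sets and the graph classes -/

namespace SimpleGraph

variable {V : Type*}

/-- `I(u, v)`: the vertices that lie on some shortest path between `u` and `v`. It is empty when
`u` and `v` are in different components, and `I(u, u) = {u}`. -/
def geodesicInterval (G : SimpleGraph V) (u v : V) : Set V :=
  {w | ∃ p : G.Walk u v, p.length = G.dist u v ∧ w ∈ p.support}

/-- `S` is a geodetic set: every vertex lies in `I(u, v)` for some `u, v ∈ S`. -/
def IsGeodeticSet (G : SimpleGraph V) (S : Finset V) : Prop :=
  ∀ w : V, ∃ u ∈ S, ∃ v ∈ S, w ∈ G.geodesicInterval u v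

/-- `S` is a geodetic set of minimum cardinality. -/
def IsMinimumGeodeticSet (G : SimpleGraph V) (S : Finset V) : Prop :=
  G.IsGeodeticSet S ∧ ∀ S' : Finset V, G.IsGeodeticSet S' → S.card ≤ S'.card

/-- Chordal graphs: no induced cycle of order greater than three. -/
def IsChordalGraph (G : SimpleGraph V) : Prop :=
  ∀ m : ℕ, 3 < m → IsEmpty (cycleGraph m ↪g G)

/-- Interval graphs: distinct vertices are adjacent exactly when their intervals
`[l u, r u]` and `[l v, r v]` of the real line intersect. -/
def IsIntervalGraph (G : SimpleGraph V) : Prop :=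
  ∃ l r : V → ℝ, (∀ v, l v ≤ r v) ∧
    ∀ u v, u ≠ v → (G.Adj u v ↔ (Set.Icc (l u) (r u) ∩ Set.Icc (l v) (r v)).Nonempty)

/-- `k`-trees of order `n`: the vertices can be listed as `σ 0, …, σ (n - 1)` so that the first
`k + 1` of them form a complete graph and each later one is adjacent to exactly `k` of the
vertices listed before it, and these `k` vertices are pairwise adjacent. -/
def IsKTree {n : ℕ} (G : SimpleGraph (Fin n)) (k : ℕ) : Prop :=
  k + 1 ≤ n ∧ ∃ σ : Equiv.Perm (Fin n),
    (∀ i j : Fin n, i.val < k + 1 → j.val < k + 1 → i ≠ j → G.Adj (σ i) (σ j)) ∧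
    ∀ i : Fin n, k + 1 ≤ i.val → ∃ N : Finset (Fin n), G.IsNClique k N ∧
      ∀ j : Fin n, σ j ∈ N ↔ (j < i ∧ G.Adj (σ i) (σ j))

end SimpleGraph

/-! ### Random access machines

A random access machine whose program is a structured (while-)program. A program has finitely many
registers `var x` and finitely many one-dimensional arrays `arr k`, all holding natural numbers.
Array cells are reached by computed addresses. The arithmetic consists of addition and truncated
subtraction only, each at unit cost, so that a number can grow by at most a constant number of bits
per step: up to polynomial factors, time on this machine is time on a Turing machine. -/

namespace RAM

/-- Memory contents. -/
structure State where
  /-- the registers -/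
  var : ℕ → ℕ
  /-- `arr k a` is the cell of the array number `k` at address `a` -/
  arr : ℕ → ℕ → ℕ

/-- Arithmetic expressions. -/
inductive Expr where
  | const (m : ℕ)
  | var (x : ℕ)
  | load (k : ℕ) (addr : Expr)
  | add (e₁ e₂ : Expr)
  | sub (e₁ e₂ : Expr)

/-- The value of an expression (`sub` is truncated subtraction). -/
def Expr.eval (s : State) : Expr → ℕ
  | .const m => m
  | .var x => s.var x
  | .load k addr => s.arr k (addr.eval s)
  | .add e₁ e₂ => e₁.eval s + e₂.eval s
  | .sub e₁ e₂ => e₁.eval s - e₂.eval s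

/-- The number of elementary steps for evaluating an expression: one for each constant, register
access, array access and arithmetic operation. -/
def Expr.cost : Expr → ℕ
  | .const _ => 1
  | .var _ => 1
  | .load _ addr => addr.cost + 1
  | .add e₁ e₂ => e₁.cost + e₂.cost + 1
  | .sub e₁ e₂ => e₁.cost + e₂.cost + 1

/-- Programs. A test succeeds when its expression is nonzero; `loop e p` repeats `p` while `e` is
nonzero. -/
inductive Prog where
  | skip
  | assign (x : ℕ) (e : Expr)
  | store (k : ℕ) (addr e : Expr)
  | seq (p q : Prog)
  | ite (e : Expr) (p q : Prog)
  | loop (e : Expr) (p : Prog)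

/-- Put the value `m` into register `x`. -/
def State.setVar (s : State) (x m : ℕ) : State :=
  { s with var := Function.update s.var x m }

/-- Put the value `m` into the cell of array `k` at address `a`. -/
def State.setArr (s : State) (k a m : ℕ) : State :=
  { s with arr := Function.update s.arr k (Function.update (s.arr k) a m) }

/-- `Exec p s s' t`: the program `p`, started in state `s`, halts in state `s'` after exactly `t`
elementary steps. -/
inductive Exec : Prog → State → State → ℕ → Prop where
  | skip (s : State) : Exec .skip s s 1
  | assign (s : State) (x : ℕ) (e : Expr) :
      Exec (.assign x e) s (s.setVar x (e.eval s)) (e.cost + 1)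
  | store (s : State) (k : ℕ) (addr e : Expr) :
      Exec (.store k addr e) s (s.setArr k (addr.eval s) (e.eval s)) (addr.cost + e.cost + 1)
  | seq {p q : Prog} {s s₁ s₂ : State} {t₁ t₂ : ℕ} :
      Exec p s s₁ t₁ → Exec q s₁ s₂ t₂ → Exec (.seq p q) s s₂ (t₁ + t₂)
  | ite_true {e : Expr} {p q : Prog} {s s' : State} {t : ℕ} :
      e.eval s ≠ 0 → Exec p s s' t → Exec (.ite e p q) s s' (e.cost + 1 + t)
  | ite_false {e : Expr} {p q : Prog} {s s' : State} {t : ℕ} :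
      e.eval s = 0 → Exec q s s' t → Exec (.ite e p q) s s' (e.cost + 1 + t)
  | loop_true {e : Expr} {p : Prog} {s s₁ s₂ : State} {t₁ t₂ : ℕ} :
      e.eval s ≠ 0 → Exec p s s₁ t₁ → Exec (.loop e p) s₁ s₂ t₂ →
      Exec (.loop e p) s s₂ (e.cost + 1 + t₁ + t₂)
  | loop_false {e : Expr} {p : Prog} {s : State} :
      e.eval s = 0 → Exec (.loop e p) s s (e.cost + 1)

/-- The machine is deterministic: final state and running time are determined by the program and
the initial state. -/
theorem Exec.det {p : Prog} {s s₁ s₂ : State} {t₁ t₂ : ℕ}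
    (h₁ : Exec p s s₁ t₁) (h₂ : Exec p s s₂ t₂) : s₁ = s₂ ∧ t₁ = t₂ := by
  induction h₁ generalizing s₂ t₂ with
  | skip | assign | store => cases h₂; exact ⟨rfl, rfl⟩
  | seq _ _ ih₁ ih₂ =>
    cases h₂ with
    | seq a b =>
      obtain ⟨rfl, rfl⟩ := ih₁ a
      obtain ⟨rfl, rfl⟩ := ih₂ b
      exact ⟨rfl, rfl⟩
  | ite_true h _ ih =>
    cases h₂ with
    | ite_true _ a => obtain ⟨rfl, rfl⟩ := ih a; exact ⟨rfl, rfl⟩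
    | ite_false h' _ => exact absurd h' h
  | ite_false h _ ih =>
    cases h₂ with
    | ite_true h' _ => exact absurd h h'
    | ite_false _ a => obtain ⟨rfl, rfl⟩ := ih a; exact ⟨rfl, rfl⟩
  | loop_true h _ _ ih₁ ih₂ =>
    cases h₂ with
    | loop_true _ a b =>
      obtain ⟨rfl, rfl⟩ := ih₁ a
      obtain ⟨rfl, rfl⟩ := ih₂ b
      exact ⟨rfl, rfl⟩
    | loop_false h' => exact absurd h' h
  | loop_false h =>
    cases h₂ with
    | loop_true h' _ _ => exact absurd h h'
    | loop_false _ => exact ⟨rfl, rfl⟩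

open Classical in
/-- The initial state on input `G`: register `0` holds the order `n`, array `0` holds the adjacency
matrix (row by row, the entry of `i, j` at address `i * n + j`), everything else is zero. -/
noncomputable def graphInput {n : ℕ} (G : SimpleGraph (Fin n)) : State where
  var x := if x = 0 then n else 0
  arr k a := if k = 0 ∧ ∃ i j : Fin n, a = i.val * n + j.val ∧ G.Adj i j then 1 else 0

open Classical in
/-- On input `G`, the program `p` halts after at most `T` steps with a minimum geodetic set of `G`
as its output: the first `n` cells of array `1` hold the indicator vector of that set. -/
def ComputesMGS (p : Prog) {n : ℕ} (G : SimpleGraph (Fin n)) (T : ℕ) : Prop :=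
  ∃ (s : State) (t : ℕ), Exec p (graphInput G) s t ∧ t ≤ T ∧
    ∃ S : Finset (Fin n), G.IsMinimumGeodeticSet S ∧
      ∀ i : Fin n, s.arr 1 i.val = if i ∈ S then 1 else 0

end RAM

/-! Let `Q` be a set of vertices whose outer boundary is a clique. Boundary vertices are at distance
at most one, so a geodesic between two vertices outside `Q` never enters `Q`, and a geodesic between
two vertices of `Q` meets the outside in boundary vertices only. For a geodesic with one end on each
side, the distances from an end `u` to the clique take at most two consecutive values; up to a shift
they are determined by the set of closest clique vertices, the `profile` of `u`
(`IsClique.mem_geodesicInterval_of_profile_eq`).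

Suppose that every clique has at most τ vertices and is seen in at most τ profiles. Then the outside
acts on `Q` through one of at most 2^τ sets of classes (the guess), and a partial solution inside
`Q` acts on the outside through its set of profiles and the set of boundary vertices that it covers.
An exchange argument (`isGeodeticSet_union_of_simulates`) shows that for each guess a partial
solution may be dropped if one of the same type and no larger size is present. With the cardinality
there are at most 2^τ · 2^τ · 2^τ · (n + 1) types, which bounds the family kept for a block
(`card_le_of_undominated`).

In all three graph classes every nonempty vertex set has a vertex that is simplicial in it.
Therefore the vertex set can be assembled from single vertices by merging blocks bounded by cliques
(`IsBlockLabeling.exists_mergeable`), within 2n rounds. The unions of candidates for two parts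
represent the merged block (`Represents.mul`). Once a single block is left, a smallest geodetic set
in the stored families is optimal.

The same program serves all classes: it needs neither τ nor a decomposition, since it finds
mergeable pairs by exhaustive search. Its loops and sums run up to four registers (an inner sum
possibly up to an outer summation variable), so its time is polynomial in a bound for these
registers, which is 2^{O(τ)} n^{O(1)}. Finally τ = 2^ω works for chordal graphs, τ = 2^(k+1) for
`k`-trees, and τ = 3ω + 2 for interval graphs, where profiles are essentially initial segments of
the clique (`IsIntervalRep.ncard_range_profile_le`). -/

namespace RAM

/-! ### Terms with bounded sums and their evaluation on the machine -/

open Function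

/-- Terms: expressions extended by bounded sums. `sum x y t` is the sum of the values of `t` as
`x` ranges over the numbers below the value of the register `y`. A term is true when its value is
nonzero. -/
inductive Tm where
  | const (m : ℕ)
  | var (x : ℕ)
  | load (k : ℕ) (t : Tm)
  | add (a b : Tm)
  | sub (a b : Tm)
  | sum (x y : ℕ) (t : Tm)

namespace Tm

/-- The value of a term. -/
def eval (A : ℕ → ℕ → ℕ) : Tm → (ℕ → ℕ) → ℕ
  | const m, _ => m
  | var x, v => v x
  | load k t, v => A k (t.eval A v)
  | add a b, v => a.eval A v + b.eval A v
  | sub a b, v => a.eval A v - b.eval A v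
  | sum x y t, v => ∑ i ∈ Finset.range (v y), t.eval A (update v x i)

/-- All registers that occur are below `r`. -/
def fits (r : ℕ) : Tm → Bool
  | const _ => true
  | var x => decide (x < r)
  | load _ t => t.fits r
  | add a b => a.fits r && b.fits r
  | sub a b => a.fits r && b.fits r
  | sum x y t => decide (x < r) && decide (y < r) && t.fits r

/-- The registers that bound a sum and are not themselves summation variables. -/
def limits : Tm → List ℕ
  | const _ => []
  | var _ => []
  | load _ t => t.limits
  | add a b => a.limits ++ b.limits
  | sub a b => a.limits ++ b.limits
  | sum x y t => y :: t.limits.filter (fun z => decide (z ≠ x))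

/-- The program that evaluates a term and puts the value into register `r`, using no register
below `r` other than the summation variables, which are restored. -/
def comp : Tm → ℕ → Prog
  | const m, r => .assign r (.const m)
  | var x, r => .assign r (.var x)
  | load k t, r => .seq (t.comp r) (.assign r (.load k (.var r)))
  | add a b, r => .seq (a.comp r) (.seq (b.comp (r + 1)) (.assign r (.add (.var r) (.var (r + 1)))))
  | sub a b, r => .seq (a.comp r) (.seq (b.comp (r + 1)) (.assign r (.sub (.var r) (.var (r + 1)))))
  | sum x y t, r =>
    .seq (.assign r (.const 0)) <| .seq (.assign (r + 1) (.var x)) <|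
    .seq (.assign (r + 2) (.var y)) <| .seq (.assign x (.const 0)) <|
    .seq (.loop (.sub (.var (r + 2)) (.var x)) <|
      .seq (t.comp (r + 3)) <| .seq (.assign r (.add (.var r) (.var (r + 3)))) <|
      .assign x (.add (.var x) (.const 1))) <|
    .assign x (.var (r + 1))

/-- A bound for the time to evaluate a term when all sums have at most `B` summands. -/
def timeBound (B : ℕ) : Tm → ℕ
  | const _ => 2
  | var _ => 2
  | load _ t => t.timeBound B + 3
  | add a b => a.timeBound B + b.timeBound B + 4
  | sub a b => a.timeBound B + b.timeBound B + 4
  | sum _ _ t => 14 + B * (t.timeBound B + 12)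

theorem fits_mono {r r' : ℕ} (hr : r ≤ r') (t : Tm) (h : t.fits r) : t.fits r' := by
  induction t with
  | const m => rfl
  | var x => simp only [fits, decide_eq_true_eq] at *; omega
  | load k t ih => exact ih h
  | add a b iha ihb | sub a b iha ihb =>
    simp only [fits, Bool.and_eq_true] at *; exact ⟨iha h.1, ihb h.2⟩
  | sum x y t ih =>
    simp only [fits, Bool.and_eq_true, decide_eq_true_eq] at *
    exact ⟨⟨by omega, by omega⟩, ih h.2⟩

theorem limits_lt {r : ℕ} (t : Tm) (h : t.fits r) : ∀ y ∈ t.limits, y < r := by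
  induction t with
  | const m => simp [limits]
  | var x => simp [limits]
  | load k t ih => exact ih h
  | add a b iha ihb | sub a b iha ihb =>
    simp only [fits, Bool.and_eq_true] at *
    simp only [limits, List.mem_append]
    rintro y (hy | hy)
    exacts [iha h.1 y hy, ihb h.2 y hy]
  | sum x y t ih =>
    simp only [fits, Bool.and_eq_true, decide_eq_true_eq] at *
    simp only [limits, List.mem_cons, List.mem_filter]
    rintro z (hz | hz)
    · omega
    · exact ih h.2 z hz.1

theorem eval_congr (A : ℕ → ℕ → ℕ) (r : ℕ) (t : Tm) : ∀ {v v' : ℕ → ℕ}, t.fits r →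
    (∀ z < r, v z = v' z) → t.eval A v = t.eval A v' := by
  induction t with
  | const m => intros; rfl
  | var x => intro v v' h hv; exact hv _ (by simpa [fits] using h)
  | load k t ih => intro v v' h hv; simp only [eval]; rw [ih h hv]
  | add a b iha ihb =>
    intro v v' h hv
    simp only [fits, Bool.and_eq_true] at h
    simp only [eval]; rw [iha h.1 hv, ihb h.2 hv]
  | sub a b iha ihb =>
    intro v v' h hv
    simp only [fits, Bool.and_eq_true] at h
    simp only [eval]; rw [iha h.1 hv, ihb h.2 hv]
  | sum x y t ih =>
    intro v v' h hv
    simp only [fits, Bool.and_eq_true, decide_eq_true_eq] at h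
    simp only [eval]
    rw [hv y h.1.2]
    refine Finset.sum_congr rfl fun i _ => ih h.2 fun z hz => ?_
    by_cases hx : z = x
    · subst hx; simp
    · simp [update_of_ne hx, hv z hz]

/-- Each nested sum costs one factor `B`, so the degree depends on the term only. -/
theorem exists_polynomial_timeBound (t : Tm) :
    ∃ K d, ∀ B, t.timeBound B ≤ K * (B + 1) ^ d := by
  induction t with
  | const m => exact ⟨2, 0, by simp [timeBound]⟩
  | var x => exact ⟨2, 0, by simp [timeBound]⟩
  | load k t ih =>
    obtain ⟨K, d, h⟩ := ih
    refine ⟨K + 3, d, fun B => ?_⟩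
    have := Nat.one_le_pow d (B + 1) (by omega)
    have := h B
    simp only [timeBound]; nlinarith
  | add a b iha ihb | sub a b iha ihb =>
    obtain ⟨K, d, h⟩ := iha
    obtain ⟨K', d', h'⟩ := ihb
    refine ⟨K + K' + 4, d + d', fun B => ?_⟩
    have h1 := Nat.one_le_pow d (B + 1) (by omega)
    have h2 := Nat.one_le_pow d' (B + 1) (by omega)
    have h3 := h B
    have h4 := h' B
    simp only [timeBound, pow_add]
    generalize (B + 1) ^ d = x at *
    generalize (B + 1) ^ d' = y at *
    have h5 : x ≤ x * y := Nat.le_mul_of_pos_right _ h2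
    have h6 : y ≤ x * y := Nat.le_mul_of_pos_left _ h1
    nlinarith [Nat.mul_le_mul_left K h5, Nat.mul_le_mul_left K' h6]
  | sum x y t ih =>
    obtain ⟨K, d, h⟩ := ih
    refine ⟨K + 26, d + 1, fun B => ?_⟩
    have h1 := Nat.one_le_pow d (B + 1) (by omega)
    have h3 := h B
    simp only [timeBound, pow_succ]
    generalize (B + 1) ^ d = x at *
    nlinarith [Nat.mul_le_mul_left B h3, Nat.mul_le_mul_left B h1]

/-- Evaluation works like a stack: the code for `r` treats the registers from `r` on as scratch and
leaves the lower ones intact, so subterms can be evaluated one above the other. -/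
theorem exec_comp {B : ℕ} (t : Tm) : ∀ (r : ℕ) (s : State), t.fits r →
    (∀ y ∈ t.limits, s.var y ≤ B) → ∃ s' T, Exec (t.comp r) s s' T ∧ T ≤ t.timeBound B ∧
      s'.arr = s.arr ∧ (∀ z < r, s'.var z = s.var z) ∧ s'.var r = t.eval s.arr s.var := by
  induction t with
  | const m =>
    intro r s _ _
    exact ⟨_, _, .assign _ _ _, le_rfl, rfl, fun z hz => by simp [State.setVar, hz.ne],
      by simp [State.setVar, eval, Expr.eval]⟩
  | var x =>
    intro r s _ _
    exact ⟨_, _, .assign _ _ _, le_rfl, rfl, fun z hz => by simp [State.setVar, hz.ne],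
      by simp [State.setVar, eval, Expr.eval]⟩
  | load k t ih =>
    intro r s hb hl
    obtain ⟨s₁, T, h, hT, ha, hv, hr⟩ := ih r s hb hl
    refine ⟨_, _, .seq h (.assign _ _ _), ?_, ha, fun z hz => ?_, ?_⟩
    · simp only [timeBound, Expr.cost]; omega
    · simp [State.setVar, hz.ne, hv z hz]
    · simp [State.setVar, eval, Expr.eval, hr, ha]
  | add a b iha ihb | sub a b iha ihb =>
    intro r s hb hl
    simp only [fits, Bool.and_eq_true] at hb
    simp only [limits, List.mem_append] at hl
    obtain ⟨s₁, T₁, h₁, hT₁, ha₁, hv₁, hr₁⟩ := iha r s hb.1 fun y hy => hl y (.inl hy)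
    have hbr : b.fits (r + 1) := b.fits_mono (by omega) hb.2
    have hlb := b.limits_lt hb.2
    obtain ⟨s₂, T₂, h₂, hT₂, ha₂, hv₂, hr₂⟩ := ihb (r + 1) s₁ hbr
      fun y hy => by rw [hv₁ y (hlb y hy)]; exact hl y (.inr hy)
    refine ⟨_, _, .seq h₁ (.seq h₂ (.assign _ _ _)), ?_, by simp [State.setVar, ha₁, ha₂],
      fun z hz => ?_, ?_⟩
    · simp only [timeBound, Expr.cost]; omega
    · simp [State.setVar, hz.ne, hv₁ z hz, hv₂ z (by omega)]
    · simp [State.setVar, eval, Expr.eval, hr₁, ha₁, hr₂, hv₂ r (by omega),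
        eval_congr s.arr r b hb.2 hv₁]
  | sum x y t ih =>
    intro r s hb hl
    simp only [fits, Bool.and_eq_true, decide_eq_true_eq] at hb
    simp only [limits, List.mem_cons, List.mem_filter, decide_eq_true_eq] at hl
    obtain ⟨⟨hx, hy⟩, hb⟩ := hb
    have hbr : t.fits (r + 3) := t.fits_mono (by omega) hb
    have hlb := t.limits_lt hb
    have hyB : s.var y ≤ B := hl y (.inl rfl)
    -- Before round `i`, with `m` rounds to go, `x` holds `i` and `r` the partial sum; `r + 1` keeps
    -- the old value of `x` and `r + 2` the limit, which would be lost if `y = x`.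
    have loop : ∀ (m i : ℕ) (s₁ : State), m + i = s.var y → s₁.arr = s.arr →
        (∀ z < r, s₁.var z = update s.var x i z) → s₁.var (r + 1) = s.var x →
        s₁.var (r + 2) = s.var y →
        s₁.var r = ∑ j ∈ Finset.range i, t.eval s.arr (update s.var x j) →
        ∃ s' T, Exec (.loop (.sub (.var (r + 2)) (.var x)) <|
          .seq (t.comp (r + 3)) <| .seq (.assign r (.add (.var r) (.var (r + 3)))) <|
          .assign x (.add (.var x) (.const 1))) s₁ s' T ∧
          T ≤ m * (t.timeBound B + 12) + 4 ∧ s'.arr = s.arr ∧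
          (∀ z < r, s'.var z = update s.var x (s.var y) z) ∧ s'.var (r + 1) = s.var x ∧
          s'.var r = ∑ j ∈ Finset.range (s.var y), t.eval s.arr (update s.var x j) := by
      intro m
      induction m with
      | zero =>
        intro i s₁ hi ha hz h1 h2 hr
        obtain rfl : i = s.var y := by omega
        refine ⟨s₁, _, .loop_false ?_, ?_, ha, hz, h1, hr⟩
        · simp [Expr.eval, h2, hz x hx]
        · simp [Expr.cost]
      | succ m ihm =>
        intro i s₁ hi ha hz h1 h2 hr
        -- An inner sum may run up to the current summation variable, whose value stays below `s.var
        -- y ≤ B`. This is why `limits` omits bound variables.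
        obtain ⟨s₂, T₂, e₂, hT₂, ha₂, hv₂, hr₂⟩ := ih (r + 3) s₁ hbr fun z hzl => by
          by_cases hzx : z = x
          · subst hzx; rw [hz z hx]; simp; omega
          · rw [hz z (hlb z hzl), update_of_ne hzx]; exact hl z (.inr ⟨hzl, hzx⟩)
        have hbody := Exec.seq e₂ (.seq (.assign _ r (.add (.var r) (.var (r + 3))))
          (.assign _ x (.add (.var x) (.const 1))))
        obtain ⟨s₃, T₃, e₃, hT₃, ha₃, hz₃, h1₃, hr₃⟩ := ihm (i + 1)
          ((s₂.setVar r (s₂.var r + s₂.var (r + 3))).setVar x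
            ((s₂.setVar r (s₂.var r + s₂.var (r + 3))).var x + 1)) (by omega)
          (by simp [State.setVar, ha₂, ha]) (fun z hzr => by
            by_cases hzx : z = x
            · subst hzx
              simp [State.setVar, hx.ne, hv₂ z (by omega), hz z hx]
            · simp [State.setVar, hzx, hzr.ne, hv₂ z (by omega), hz z hzr])
          (by simp [State.setVar, (show r + 1 ≠ x by omega), hv₂, h1])
          (by simp [State.setVar, (show r + 2 ≠ x by omega), hv₂, h2])
          (by
            simp only [State.setVar, update_of_ne (show r ≠ x by omega),
              update_self, hv₂ r (by omega), hr, hr₂, ha]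
            rw [Finset.sum_range_succ]
            congr 1
            exact eval_congr s.arr r t hb hz)
        refine ⟨s₃, _, .loop_true ?_ hbody e₃, ?_, ha₃, hz₃, h1₃, hr₃⟩
        · simp only [Expr.eval, h2, hz x hx, update_self]; omega
        · simp only [Expr.cost]; rw [Nat.succ_mul]; omega
    obtain ⟨s₁, T₁, e₁, hT₁, ha₁, hz₁, h1₁, hr₁⟩ := loop (s.var y) 0
      (((((s.setVar r 0).setVar (r + 1) (s.var x)).setVar (r + 2) (s.var y))).setVar x 0) rfl
      rfl (fun z hz => by
        by_cases hzx : z = x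
        · subst hzx; simp [State.setVar]
        · simp [State.setVar, hzx, hz.ne, (show z ≠ r + 1 by omega), (show z ≠ r + 2 by omega)])
      (by simp [State.setVar, (show r + 1 ≠ x by omega)])
      (by simp [State.setVar, (show r + 2 ≠ x by omega)])
      (by simp [State.setVar, (show r ≠ x by omega)])
    refine ⟨_, _, .seq (.assign _ _ _) (.seq (.assign _ _ _) (.seq (.assign _ _ _)
      (.seq (.assign _ _ _) (.seq (s₁ := s₁) (t₁ := T₁) ?_ (.assign _ _ _))))), ?_, ?_, ?_, ?_⟩
    · convert e₁ using 1
      simp [Expr.eval, State.setVar, (show x ≠ r by omega), (show y ≠ r by omega),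
        (show y ≠ r + 1 by omega)]
    · simp only [Expr.cost, timeBound]
      have := Nat.mul_le_mul_right (t.timeBound B + 12) hyB
      omega
    · simp [State.setVar, ha₁]
    · intro z hz
      by_cases hzx : z = x
      · subst hzx; simp [State.setVar, Expr.eval, h1₁]
      · simp [State.setVar, hzx, hz₁ z hz]
    · simp [State.setVar, (show r ≠ x by omega), hr₁, eval]

end Tm

/-- Commands: programs with terms in place of expressions and counting loops in place of
while-loops. `forTo x y c` repeats `c` with `x` ranging over the numbers below the value that the
register `y` has at the start. The registers below `4` are the only ones that may bound a sum or
a loop. -/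
inductive Cmd where
  | skip
  | assign (x : ℕ) (t : Tm)
  | store (k : ℕ) (a t : Tm)
  | seq (c d : Cmd)
  | ite (t : Tm) (c d : Cmd)
  | forTo (x y : ℕ) (c : Cmd)

/-! ### Commands: semantics, compilation and cost -/

namespace Cmd

/-- The effect of a command. -/
def run : Cmd → State → State
  | skip, s => s
  | assign x t, s => s.setVar x (t.eval s.arr s.var)
  | store k a t, s => s.setArr k (a.eval s.arr s.var) (t.eval s.arr s.var)
  | seq c d, s => d.run (c.run s)
  | ite t c d, s => if t.eval s.arr s.var ≠ 0 then c.run s else d.run s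
  | forTo x y c, s => Nat.rec s (fun i s' => c.run (s'.setVar x i)) (s.var y)

/-- Registers below `4` never receive a value greater than `B`. -/
def Bounded (B : ℕ) : Cmd → State → Prop
  | skip, _ => True
  | assign x t, s => x < 4 → t.eval s.arr s.var ≤ B
  | store _ _ _, _ => True
  | seq c d, s => c.Bounded B s ∧ d.Bounded B (c.run s)
  | ite t c d, s => if t.eval s.arr s.var ≠ 0 then c.Bounded B s else d.Bounded B s
  | forTo x y c, s => ∀ i < s.var y,
      c.Bounded B (State.setVar (Nat.rec s (fun i s' => c.run (s'.setVar x i)) i) x i)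

/-- All sums and loops are bounded by registers below `4`, no loop variable is among these, and
all registers are below `r`. -/
def fits (r : ℕ) : Cmd → Bool
  | skip => true
  | assign x t => decide (x < r) && t.fits r && t.limits.all (fun y => decide (y < 4))
  | store _ a t => a.fits r && a.limits.all (fun y => decide (y < 4)) &&
      (t.fits r && t.limits.all (fun y => decide (y < 4)))
  | seq c d => c.fits r && d.fits r
  | ite t c d => t.fits r && t.limits.all (fun y => decide (y < 4)) && (c.fits r && d.fits r)
  | forTo x y c => decide (x < r) && decide (4 ≤ x) && decide (y < 4) && c.fits r

/-- The program of a command; it uses auxiliary registers from `r` on. -/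
def comp : Cmd → ℕ → Prog
  | skip, _ => .skip
  | assign x t, r => .seq (t.comp r) (.assign x (.var r))
  | store k a t, r => .seq (a.comp r) (.seq (t.comp (r + 1)) (.store k (.var r) (.var (r + 1))))
  | seq c d, r => .seq (c.comp r) (d.comp r)
  | ite t c d, r => .seq (t.comp r) (.ite (.var r) (c.comp r) (d.comp r))
  | forTo x y c, r =>
    .seq (.assign r (.const 0)) <| .seq (.assign (r + 1) (.var y)) <|
    .loop (.sub (.var (r + 1)) (.var r)) <| .seq (.assign x (.var r)) <|
    .seq (c.comp (r + 2)) (.assign r (.add (.var r) (.const 1)))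

/-- A bound for the running time when the registers below `4` hold values at most `B`. -/
def timeBound (B : ℕ) : Cmd → ℕ
  | skip => 1
  | assign _ t => t.timeBound B + 2
  | store _ a t => a.timeBound B + t.timeBound B + 3
  | seq c d => c.timeBound B + d.timeBound B
  | ite t c d => t.timeBound B + c.timeBound B + d.timeBound B + 2
  | forTo _ _ c => 8 + B * (c.timeBound B + 10)

theorem exists_polynomial_timeBound (c : Cmd) :
    ∃ K d, ∀ B, c.timeBound B ≤ K * (B + 1) ^ d := by
  have key : ∀ f g : ℕ → ℕ, ∀ m, (∃ K d, ∀ B, f B ≤ K * (B + 1) ^ d) →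
      (∃ K d, ∀ B, g B ≤ K * (B + 1) ^ d) → ∃ K d, ∀ B, f B + g B + m ≤ K * (B + 1) ^ d := by
    rintro f g m ⟨K, d, h⟩ ⟨K', d', h'⟩
    refine ⟨K + K' + m, d + d', fun B => ?_⟩
    have h1 := Nat.one_le_pow d (B + 1) (by omega)
    have h2 := Nat.one_le_pow d' (B + 1) (by omega)
    have h3 := h B
    have h4 := h' B
    rw [pow_add]
    generalize (B + 1) ^ d = x at *
    generalize (B + 1) ^ d' = y at *
    have h5 : x ≤ x * y := Nat.le_mul_of_pos_right _ h2
    have h6 : y ≤ x * y := Nat.le_mul_of_pos_left _ h1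
    nlinarith [Nat.mul_le_mul_left K h5, Nat.mul_le_mul_left K' h6,
      Nat.mul_le_mul_left m (h1.trans h5)]
  induction c with
  | skip => exact ⟨1, 0, by simp [timeBound]⟩
  | assign x t => exact key _ (fun _ => 0) 2 t.exists_polynomial_timeBound ⟨0, 0, by simp⟩
  | store k a t => exact key _ _ 3 a.exists_polynomial_timeBound t.exists_polynomial_timeBound
  | seq c d ihc ihd => exact key _ _ 0 ihc ihd
  | ite t c d ihc ihd => exact key _ _ 2 (key _ _ 0 t.exists_polynomial_timeBound ihc) ihd
  | forTo x y c ih =>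
    obtain ⟨K, d, h⟩ := ih
    refine ⟨K + 18, d + 1, fun B => ?_⟩
    have h1 := Nat.one_le_pow d (B + 1) (by omega)
    have h3 := h B
    simp only [timeBound, pow_succ]
    generalize (B + 1) ^ d = x at *
    nlinarith [Nat.mul_le_mul_left B h3, Nat.mul_le_mul_left B h1]

/-- Compiled code leaves debris in the scratch registers, so the machine state `s₁` can only be
compared with the abstract state `s` below `b`. The registers between `b` and `r` hold the counters
of enclosing loops and must survive. -/
theorem exec_comp {b B : ℕ} (hb : 4 ≤ b) (c : Cmd) : ∀ (r : ℕ) (s s₁ : State), b ≤ r →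
    c.fits b → s₁.arr = s.arr → (∀ z < b, s₁.var z = s.var z) → (∀ z < 4, s.var z ≤ B) →
    c.Bounded B s → ∃ s₁' T, Exec (c.comp r) s₁ s₁' T ∧ T ≤ c.timeBound B ∧
      s₁'.arr = (c.run s).arr ∧ (∀ z < b, s₁'.var z = (c.run s).var z) ∧
      (∀ z, b ≤ z → z < r → s₁'.var z = s₁.var z) ∧ ∀ z < 4, (c.run s).var z ≤ B := by
  induction c with
  | skip =>
    intro r s s₁ hr hf ha hv h4 hB
    exact ⟨s₁, 1, .skip _, le_rfl, ha, hv, fun _ _ _ => rfl, h4⟩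
  | assign x t =>
    intro r s s₁ hr hf ha hv h4 hB
    simp only [fits, Bool.and_eq_true, decide_eq_true_eq, List.all_eq_true] at hf
    obtain ⟨s₂, T, e, hT, ha₂, hv₂, hr₂⟩ := t.exec_comp (B := B) r s₁
      (t.fits_mono hr hf.1.2) fun y hy => by
        have := hf.2 y hy; rw [hv y (by omega)]; exact h4 y this
    rw [ha, t.eval_congr s.arr b hf.1.2 hv] at hr₂
    refine ⟨_, _, .seq e (.assign _ _ _), ?_, ?_, ?_, ?_, ?_⟩
    · simp only [timeBound, Expr.cost]; omega
    · simp [State.setVar, run, ha₂, ha]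
    · intro z hz
      by_cases hzx : z = x
      · subst hzx; simp [State.setVar, run, Expr.eval, hr₂]
      · simp [State.setVar, run, hzx, hv₂ z (by omega), hv z hz]
    · intro z hz hzr
      simp [State.setVar, (show z ≠ x by omega), hv₂ z hzr]
    · intro z hz
      by_cases hzx : z = x
      · subst hzx; simpa [State.setVar, run] using hB hz
      · simpa [State.setVar, run, hzx] using h4 z hz
  | store k a t =>
    intro r s s₁ hr hf ha hv h4 hB
    simp only [fits, Bool.and_eq_true, decide_eq_true_eq, List.all_eq_true] at hf
    obtain ⟨s₂, T, e, hT, ha₂, hv₂, hr₂⟩ := a.exec_comp (B := B) r s₁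
      (a.fits_mono hr hf.1.1) fun y hy => by
        have := hf.1.2 y hy; rw [hv y (by omega)]; exact h4 y this
    rw [ha, a.eval_congr s.arr b hf.1.1 hv] at hr₂
    obtain ⟨s₃, T', e', hT', ha₃, hv₃, hr₃⟩ := t.exec_comp (B := B) (r + 1) s₂
      (t.fits_mono (by omega) hf.2.1) fun y hy => by
        have := hf.2.2 y hy
        rw [hv₂ y (by omega), hv y (by omega)]; exact h4 y this
    rw [ha₂, ha, t.eval_congr s.arr b hf.2.1 (v' := s.var)
      fun z hz => (hv₂ z (by omega)).trans (hv z hz)] at hr₃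
    refine ⟨_, _, .seq e (.seq e' (.store _ _ _ _)), ?_, ?_, ?_, ?_, ?_⟩
    · simp only [timeBound, Expr.cost]; omega
    · simp [State.setArr, run, ha₂, ha, ha₃, Expr.eval, hr₃, hv₃ r (by omega), hr₂]
    · intro z hz
      simp [State.setArr, run, hv₃ z (by omega), hv₂ z (by omega), hv z hz]
    · intro z hz hzr
      simp [State.setArr, hv₃ z (by omega), hv₂ z hzr]
    · exact h4
  | seq c d ihc ihd =>
    intro r s s₁ hr hf ha hv h4 hB
    simp only [fits, Bool.and_eq_true] at hf
    obtain ⟨s₂, T, e, hT, ha₂, hv₂, hz₂, h4₂⟩ := ihc r s s₁ hr hf.1 ha hv h4 hB.1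
    obtain ⟨s₃, T', e', hT', ha₃, hv₃, hz₃, h4₃⟩ := ihd r _ s₂ hr hf.2 ha₂ hv₂ h4₂ hB.2
    exact ⟨s₃, _, .seq e e', by simp only [timeBound]; omega, ha₃, hv₃,
      fun z hz hzr => (hz₃ z hz hzr).trans (hz₂ z hz hzr), h4₃⟩
  | ite t c d ihc ihd =>
    intro r s s₁ hr hf ha hv h4 hB
    simp only [fits, Bool.and_eq_true, decide_eq_true_eq, List.all_eq_true] at hf
    obtain ⟨s₂, T, e, hT, ha₂, hv₂, hr₂⟩ := t.exec_comp (B := B) r s₁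
      (t.fits_mono hr hf.1.1) fun y hy => by
        have := hf.1.2 y hy; rw [hv y (by omega)]; exact h4 y this
    rw [ha, t.eval_congr s.arr b hf.1.1 hv] at hr₂
    simp only [Bounded] at hB
    by_cases ht : t.eval s.arr s.var ≠ 0
    · rw [if_pos ht] at hB
      obtain ⟨s₃, T', e', hT', ha₃, hv₃, hz₃, h4₃⟩ := ihc r s s₂ hr hf.2.1 (ha₂.trans ha)
        (fun z hz => (hv₂ z (by omega)).trans (hv z hz)) h4 hB
      refine ⟨s₃, _, .seq e (.ite_true (by simpa [Expr.eval, hr₂] using ht) e'), ?_, ?_, ?_,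
        fun z hz hzr => (hz₃ z hz hzr).trans (hv₂ z hzr), ?_⟩
      · simp only [timeBound, Expr.cost]; omega
      all_goals simpa only [run, if_pos ht]
    · rw [if_neg ht] at hB
      obtain ⟨s₃, T', e', hT', ha₃, hv₃, hz₃, h4₃⟩ := ihd r s s₂ hr hf.2.2 (ha₂.trans ha)
        (fun z hz => (hv₂ z (by omega)).trans (hv z hz)) h4 hB
      refine ⟨s₃, _, .seq e (.ite_false (by simpa [Expr.eval, hr₂] using ht) e'), ?_, ?_, ?_,
        fun z hz hzr => (hz₃ z hz hzr).trans (hv₂ z hzr), ?_⟩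
      · simp only [timeBound, Expr.cost]; omega
      all_goals simpa only [run, if_neg ht]
  | forTo x y c ih =>
    intro r s s₁ hr hf ha hv h4 hB
    simp only [fits, Bool.and_eq_true, decide_eq_true_eq] at hf
    obtain ⟨⟨⟨hx, hx4⟩, hy⟩, hc⟩ := hf
    simp only [Bounded] at hB
    simp only [run]
    have hyB := h4 y hy
    generalize hN : s.var y = N at *
    -- The counter is `r` and the limit is copied to `r + 1`; the body uses scratch from `r + 2` on,
    -- so it may overwrite `x` and `y` without harm.
    have loop : ∀ (m i : ℕ) (s₂ : State), m + i = N →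
        s₂.arr = (Nat.rec s (fun i s' => c.run (s'.setVar x i)) i : State).arr →
        (∀ z < b, s₂.var z = (Nat.rec s (fun i s' => c.run (s'.setVar x i)) i : State).var z) →
        (∀ z, b ≤ z → z < r → s₂.var z = s₁.var z) →
        (∀ z < 4, (Nat.rec s (fun i s' => c.run (s'.setVar x i)) i : State).var z ≤ B) →
        s₂.var r = i → s₂.var (r + 1) = N →
        ∃ s₁' T, Exec (.loop (.sub (.var (r + 1)) (.var r)) <| .seq (.assign x (.var r)) <|
          .seq (c.comp (r + 2)) (.assign r (.add (.var r) (.const 1)))) s₂ s₁' T ∧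
          T ≤ m * (c.timeBound B + 10) + 4 ∧
          s₁'.arr = (Nat.rec s (fun i s' => c.run (s'.setVar x i)) N : State).arr ∧
          (∀ z < b, s₁'.var z =
            (Nat.rec s (fun i s' => c.run (s'.setVar x i)) N : State).var z) ∧
          (∀ z, b ≤ z → z < r → s₁'.var z = s₁.var z) ∧
          ∀ z < 4, (Nat.rec s (fun i s' => c.run (s'.setVar x i)) N : State).var z ≤ B := by
      intro m
      induction m with
      | zero =>
        intro i s₂ hi ha₂ hv₂ hz₂ h4₂ hr₂ hr₂'
        obtain rfl : i = N := by omega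
        exact ⟨s₂, _, .loop_false (by simp [Expr.eval, hr₂, hr₂']), by simp [Expr.cost],
          ha₂, hv₂, hz₂, h4₂⟩
      | succ m ihm =>
        intro i s₂ hi ha₂ hv₂ hz₂ h4₂ hr₂ hr₂'
        have hBi := hB i (by omega)
        obtain ⟨s₃, T, e, hT, ha₃, hv₃, hz₃, h4₃⟩ := ih (r + 2) _ (s₂.setVar x i) (by omega) hc
          (by simpa [State.setVar] using ha₂)
          (fun z hz => by
            by_cases hzx : z = x
            · subst hzx; simp [State.setVar]
            · simp [State.setVar, hzx, hv₂ z hz])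
          (fun z hz => by simpa [State.setVar, (show z ≠ x by omega)] using h4₂ z hz) hBi
        have hr₃ : s₃.var r = i := by
          rw [hz₃ r hr (by omega)]; simp [State.setVar, (show r ≠ x by omega), hr₂]
        obtain ⟨s₄, T', e', hT', h⟩ := ihm (i + 1) (s₃.setVar r (s₃.var r + 1)) (by omega)
          (by simpa [State.setVar] using ha₃)
          (fun z hz => by simpa [State.setVar, (show z ≠ r by omega)] using hv₃ z hz)
          (fun z hz hzr => by
            simp [State.setVar, hzr.ne, hz₃ z hz (by omega), (show z ≠ x by omega),
              hz₂ z hz hzr])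
          h4₃ (by simp [State.setVar, hr₃])
          (by simp [State.setVar, hz₃ (r + 1) (by omega) (by omega),
            (show r + 1 ≠ x by omega), hr₂'])
        refine ⟨s₄, _, .loop_true ?_ (.seq (.assign _ _ _)
          (.seq (s₁ := s₃) (t₁ := T) ?_ (.assign _ _ _))) e', ?_, h⟩
        · simp only [Expr.eval, hr₂, hr₂']; omega
        · simpa [Expr.eval, hr₂] using e
        · simp only [Expr.cost]; rw [Nat.succ_mul]; omega
    obtain ⟨s₂, T, e, hT, h⟩ := loop N 0 ((s₁.setVar r 0).setVar (r + 1) N) rfl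
      (by simpa [State.setVar] using ha)
      (fun z hz => by
        simpa [State.setVar, (show z ≠ r by omega), (show z ≠ r + 1 by omega)] using hv z hz)
      (fun z hz hzr => by simp [State.setVar, hzr.ne, (show z ≠ r + 1 by omega)])
      h4 (by simp [State.setVar]) (by simp [State.setVar])
    refine ⟨s₂, _, .seq (.assign _ _ _) (.seq (t₂ := T) (.assign _ _ _) ?_), ?_, h⟩
    · convert e using 1
      simp [Expr.eval, State.setVar, (show y ≠ r by omega), hv y (by omega)]
      rw [hN]
    · simp only [Expr.cost, timeBound]
      have := Nat.mul_le_mul_right (c.timeBound B + 10) hyB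
      omega

/-- The command runs within the bound `B`, and its final state satisfies `Q`. -/
def Wp (B : ℕ) (c : Cmd) (s : State) (Q : State → Prop) : Prop :=
  c.Bounded B s ∧ Q (c.run s)

/-! ### Verification rules for commands -/

variable {B : ℕ} {s : State} {Q : State → Prop}

theorem Wp.mono {c : Cmd} {P : State → Prop} (h : Wp B c s P) (hPQ : ∀ s', P s' → Q s') :
    Wp B c s Q := ⟨h.1, hPQ _ h.2⟩

theorem wp_skip (h : Q s) : Wp B skip s Q := ⟨trivial, h⟩

theorem wp_assign {x : ℕ} {t : Tm} (hB : x < 4 → t.eval s.arr s.var ≤ B)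
    (h : Q (s.setVar x (t.eval s.arr s.var))) : Wp B (assign x t) s Q := ⟨hB, h⟩

theorem wp_store {k : ℕ} {a t : Tm}
    (h : Q (s.setArr k (a.eval s.arr s.var) (t.eval s.arr s.var))) :
    Wp B (store k a t) s Q := ⟨trivial, h⟩

theorem wp_seq {c d : Cmd} (h : Wp B c s fun s' => Wp B d s' Q) : Wp B (seq c d) s Q :=
  ⟨⟨h.1, h.2.1⟩, h.2.2⟩

theorem wp_ite {t : Tm} {c d : Cmd} (h : t.eval s.arr s.var ≠ 0 → Wp B c s Q)
    (h' : t.eval s.arr s.var = 0 → Wp B d s Q) : Wp B (ite t c d) s Q := by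
  by_cases ht : t.eval s.arr s.var ≠ 0
  · simpa only [Wp, Bounded, run, if_pos ht] using h ht
  · simpa only [Wp, Bounded, run, if_neg ht] using h' (not_not.mp ht)

theorem wp_forTo {x y : ℕ} {c : Cmd} (I : ℕ → State → Prop) (h0 : I 0 s)
    (hstep : ∀ i < s.var y, ∀ s', I i s' → Wp B c (s'.setVar x i) (I (i + 1)))
    (h : ∀ s', I (s.var y) s' → Q s') : Wp B (forTo x y c) s Q := by
  have key : ∀ i ≤ s.var y, I i (Nat.rec s (fun i s' => c.run (s'.setVar x i)) i) := by
    intro i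
    induction i with
    | zero => exact fun _ => h0
    | succ i ih => exact fun hi => (hstep i hi _ (ih (by omega))).2
  exact ⟨fun i hi => (hstep i hi _ (key i hi.le)).1, h _ (key _ le_rfl)⟩

end Cmd

end RAM

/-! ### Geodesics across clique separators -/

namespace SimpleGraph

variable {V : Type*} {G : SimpleGraph V}

/-- As `G.dist` is `0` between different components, the distance equation alone does not suffice
and reachability is listed separately. -/
theorem mem_geodesicInterval_iff {u v w : V} : w ∈ G.geodesicInterval u v ↔
    G.Reachable u w ∧ G.Reachable w v ∧ G.dist u w + G.dist w v = G.dist u v := by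
  classical
  constructor
  · rintro ⟨p, hp, hw⟩
    have h1 : G.Reachable u w := ⟨p.takeUntil w hw⟩
    have h2 : G.Reachable w v := ⟨p.dropUntil w hw⟩
    refine ⟨h1, h2, ?_⟩
    have h3 := dist_le (p.takeUntil w hw)
    have h4 := dist_le (p.dropUntil w hw)
    have h5 := congrArg Walk.length (p.take_spec hw)
    rw [Walk.length_append] at h5
    obtain ⟨q, hq⟩ := h1.exists_walk_length_eq_dist
    obtain ⟨q', hq'⟩ := h2.exists_walk_length_eq_dist
    have := dist_le (q.append q')
    rw [Walk.length_append] at this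
    omega
  · rintro ⟨h1, h2, h⟩
    obtain ⟨q, hq⟩ := h1.exists_walk_length_eq_dist
    obtain ⟨q', hq'⟩ := h2.exists_walk_length_eq_dist
    exact ⟨q.append q', by rw [Walk.length_append]; omega, by simp⟩

theorem geodesicInterval_comm (u v : V) : G.geodesicInterval u v = G.geodesicInterval v u := by
  ext w
  simp only [mem_geodesicInterval_iff]
  rw [G.dist_comm (u := u) (v := w), G.dist_comm (u := w) (v := v), G.dist_comm (u := u) (v := v),
    reachable_comm (u := u), reachable_comm (u := w), add_comm]
  tauto

theorem Reachable.dist_triangle {u v w : V} (h : G.Reachable u v) (h' : G.Reachable v w) :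
    G.dist u w ≤ G.dist u v + G.dist v w := by
  obtain ⟨q, hq⟩ := h.exists_walk_length_eq_dist
  obtain ⟨q', hq'⟩ := h'.exists_walk_length_eq_dist
  have := dist_le (q.append q')
  rw [Walk.length_append] at this
  omega

/-- The vertices outside `Q` that have a neighbour in `Q`. -/
def outerBoundary (G : SimpleGraph V) (Q : Set V) : Set V := {x | x ∉ Q ∧ ∃ y ∈ Q, G.Adj x y}

/-- The geodesic uses an edge that leaves `Q`; its outer end is the required vertex. -/
theorem exists_outerBoundary_mem_geodesicInterval {Q : Set V} {u w : V} (hu : u ∈ Q) (hw : w ∉ Q)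
    (h : G.Reachable u w) : ∃ x ∈ G.outerBoundary Q, x ∈ G.geodesicInterval u w := by
  obtain ⟨p, hp⟩ := h.exists_walk_length_eq_dist
  obtain ⟨d, hd, h1, h2⟩ := p.exists_boundary_dart Q hu hw
  exact ⟨d.snd, ⟨h2, d.fst, h1, d.adj.symm⟩, p, hp, p.dart_snd_mem_support_of_mem_darts hd⟩

theorem IsClique.dist_le_one {K : Set V} (hK : G.IsClique K) {x y : V} (hx : x ∈ K) (hy : y ∈ K) :
    G.Reachable x y ∧ G.dist x y ≤ 1 := by
  by_cases h : x = y
  · subst h; simp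
  · have := hK hx hy h
    exact ⟨this.reachable, (dist_eq_one_iff_adj.mpr this).le⟩

/-- A geodesic that leaves and reenters a side of a clique separator stays within the clique. -/
theorem eq_or_eq_of_mem_geodesicInterval {K : Set V} (hK : G.IsClique K) {u v w x y : V}
    (hx : x ∈ K) (hy : y ∈ K) (hw : w ∈ G.geodesicInterval u v)
    (hux : x ∈ G.geodesicInterval u w) (hyv : y ∈ G.geodesicInterval w v) : w = x ∨ w = y := by
  rw [mem_geodesicInterval_iff] at hw hux hyv
  obtain ⟨hr, hd⟩ := hK.dist_le_one hx hy
  have h1 := hux.1.dist_triangle hr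
  have h2 := (hux.1.trans hr).dist_triangle hyv.2.1
  -- Otherwise the detour from `x` over `w` to `y` has two positive pieces, while the direct way
  -- from `x` to `y` has length at most one.
  by_contra! hne
  have h3 := hux.2.1.pos_dist_of_ne hne.1.symm
  have h4 := hyv.1.pos_dist_of_ne hne.2
  omega

/-- The geodesic would cross the boundary both before and after `w`; then `w` is one of the two
crossing vertices, but these lie outside `Q`. -/
theorem notMem_geodesicInterval_of_outside {Q : Set V} (hK : G.IsClique (G.outerBoundary Q))
    {u v w : V} (hu : u ∉ Q) (hv : v ∉ Q) (hw : w ∈ Q) : w ∉ G.geodesicInterval u v := by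
  intro h
  have h' := mem_geodesicInterval_iff.mp h
  obtain ⟨x, hx, hxu⟩ := exists_outerBoundary_mem_geodesicInterval hw hu h'.1.symm
  obtain ⟨y, hy, hyv⟩ := exists_outerBoundary_mem_geodesicInterval hw hv h'.2.1
  rw [geodesicInterval_comm] at hxu
  obtain rfl | rfl := eq_or_eq_of_mem_geodesicInterval hK hx hy h hxu hyv
  exacts [hx.1 hw, hy.1 hw]

/-- The same two crossings, now seen from inside: `w` must be one of them. Hence only subsets of the
clique can be covered outside by pairs from `Q`. -/
theorem mem_outerBoundary_of_mem_geodesicInterval {Q : Set V}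
    (hK : G.IsClique (G.outerBoundary Q)) {u v w : V} (hu : u ∈ Q) (hv : v ∈ Q) (hw : w ∉ Q)
    (h : w ∈ G.geodesicInterval u v) : w ∈ G.outerBoundary Q := by
  have h' := mem_geodesicInterval_iff.mp h
  obtain ⟨x, hx, hxu⟩ := exists_outerBoundary_mem_geodesicInterval hu hw h'.1
  obtain ⟨y, hy, hyv⟩ := exists_outerBoundary_mem_geodesicInterval hv hw h'.2.1.symm
  rw [geodesicInterval_comm] at hyv
  obtain rfl | rfl := eq_or_eq_of_mem_geodesicInterval hK hx hy h hxu hyv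
  exacts [hx, hy]

/-- The vertices of `K` that are closest to `u`. -/
def profile (G : SimpleGraph V) (K : Set V) (u : V) : Set V :=
  {x ∈ K | G.Reachable u x ∧ ∀ y ∈ K, G.dist u x ≤ G.dist u y}

theorem profile_subset (K : Set V) (u : V) : G.profile K u ⊆ K := fun _ h => h.1

theorem IsClique.profile_nonempty {K : Set V} (hK : G.IsClique K) {u x : V} (hx : x ∈ K)
    (h : G.Reachable u x) : (G.profile K u).Nonempty := by
  have hne : ((fun x => G.dist u x) '' K).Nonempty := ⟨_, x, hx, rfl⟩
  obtain ⟨y, hy, hyd⟩ := Nat.sInf_mem hne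
  refine ⟨y, hy, h.trans (hK.dist_le_one hx hy).1, fun z hz => ?_⟩
  change (fun x => G.dist u x) y ≤ _
  rw [hyd]
  exact Nat.sInf_le ⟨z, hz, rfl⟩

/-- Vertices with the same profile have the same distances to `K` up to a shift. -/
theorem IsClique.dist_add_of_profile_eq {K : Set V} (hK : G.IsClique K) {u u' : V}
    (h : G.profile K u = G.profile K u') : (∀ x ∈ K, G.Reachable u x → G.Reachable u' x) ∧
      ∃ m m', ∀ x ∈ K, G.Reachable u x → G.dist u x + m' = G.dist u' x + m := by
  by_cases hne : (G.profile K u).Nonempty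
  · obtain ⟨x₀, hx₀⟩ := hne
    have hx₀' := h ▸ hx₀
    refine ⟨fun x hx _ => hx₀'.2.1.trans (hK.dist_le_one hx₀.1 hx).1,
      G.dist u x₀, G.dist u' x₀, fun x hx _ => ?_⟩
    obtain ⟨hr, hd⟩ := hK.dist_le_one hx₀.1 hx
    -- In a clique every distance from `v` is the minimum or one more, and the profile tells which.
    have key : ∀ v, x₀ ∈ G.profile K v →
        G.dist v x = G.dist v x₀ ∧ x ∈ G.profile K v ∨
        G.dist v x = G.dist v x₀ + 1 ∧ x ∉ G.profile K v := by
      intro v hv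
      have h1 := hv.2.1.dist_triangle hr
      have h2 := hv.2.2 x hx
      rcases h2.eq_or_lt with h2 | h2
      · exact .inl ⟨h2.symm, hx, hv.2.1.trans hr, fun y hy => h2 ▸ hv.2.2 y hy⟩
      · exact .inr ⟨by omega, fun hxv => by have := hxv.2.2 x₀ hx₀.1; omega⟩
    have h1 := key u hx₀
    have h2 := key u' hx₀'
    rw [← h] at h2
    rcases h1 with h1 | h1 <;> rcases h2 with h2 | h2
    · omega
    · exact absurd h1.2 h2.2
    · exact absurd h2.2 h1.2
    · omega
  · exact ⟨fun x hx hr => absurd (hK.profile_nonempty hx hr) hne, 0, 0,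
      fun x hx hr => absurd (hK.profile_nonempty hx hr) hne⟩

/-- Vertices with the same profile with respect to a clique lie on the ends of the same geodesics
across the clique. -/
theorem IsClique.mem_geodesicInterval_of_profile_eq {K W : Set V} (hK : G.IsClique K) {u u' : V}
    (h : G.profile K u = G.profile K u')
    (hu : ∀ w ∈ W, G.Reachable u w → ∃ x ∈ K, x ∈ G.geodesicInterval u w)
    (hu' : ∀ w ∈ W, G.Reachable u' w → ∃ x ∈ K, x ∈ G.geodesicInterval u' w)
    {w v : V} (hw : w ∈ W) (hv : v ∈ W) :
    w ∈ G.geodesicInterval u v → w ∈ G.geodesicInterval u' v := by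
  obtain ⟨hr, m, m', hm⟩ := hK.dist_add_of_profile_eq h
  obtain ⟨hr', -⟩ := hK.dist_add_of_profile_eq h.symm
  -- A clique vertex on a geodesic from `u` to `w` bounds the distance from `u'` to `w`, and vice
  -- versa; so the constant shift extends from `K` to `W`, and it cancels in the geodesic equation.
  have key : ∀ w ∈ W, G.Reachable u w →
      G.Reachable u' w ∧ G.dist u w + m' = G.dist u' w + m := by
    intro w hw huw
    obtain ⟨x, hx, hxw⟩ := hu w hw huw
    rw [mem_geodesicInterval_iff] at hxw
    have hru' := hr x hx hxw.1
    have hr1 := hru'.trans hxw.2.1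
    obtain ⟨y, hy, hyw⟩ := hu' w hw hr1
    rw [mem_geodesicInterval_iff] at hyw
    have hru := hr' y hy hyw.1
    have h1 := hru.dist_triangle hyw.2.1
    have h2 := hru'.dist_triangle hxw.2.1
    have h3 := hm x hx hxw.1
    have h4 := hm y hy hru
    exact ⟨hr1, by omega⟩
  intro h
  rw [mem_geodesicInterval_iff] at h ⊢
  obtain ⟨h1, h1'⟩ := key w hw h.1
  obtain ⟨h2, h2'⟩ := key v hv (h.1.trans h.2.1)
  exact ⟨h1, h.2.1, by omega⟩

/-- `u` and `u'` are interchangeable as ends of geodesics from `Q` to vertices outside. -/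
def InnerEquiv (G : SimpleGraph V) (Q : Set V) (u u' : V) : Prop :=
  ∀ w ∉ Q, ∀ v ∉ Q, (w ∈ G.geodesicInterval u v ↔ w ∈ G.geodesicInterval u' v)

theorem innerEquiv_of_profile_eq {Q : Set V} (hK : G.IsClique (G.outerBoundary Q)) {u u' : V}
    (hu : u ∈ Q) (hu' : u' ∈ Q)
    (h : G.profile (G.outerBoundary Q) u = G.profile (G.outerBoundary Q) u') :
    G.InnerEquiv Q u u' := by
  have key : ∀ u ∈ Q, ∀ w ∈ Qᶜ, G.Reachable u w →
      ∃ x ∈ G.outerBoundary Q, x ∈ G.geodesicInterval u w :=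
    fun u hu w hw hr => exists_outerBoundary_mem_geodesicInterval hu hw hr
  exact fun w hw v hv =>
    ⟨hK.mem_geodesicInterval_of_profile_eq (W := Qᶜ) h (key u hu) (key u' hu') hw hv,
    hK.mem_geodesicInterval_of_profile_eq (W := Qᶜ) h.symm (key u' hu') (key u hu) hw hv⟩

/-- `v` and `v'` are interchangeable as ends of geodesics from the outside to vertices of `Q`. -/
def OuterEquiv (G : SimpleGraph V) (Q : Set V) (v v' : V) : Prop := G.InnerEquiv Qᶜ v v'

theorem outerEquiv_of_profile_eq {Q : Set V} (hK : G.IsClique (G.outerBoundary Q)) {v v' : V}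
    (hv : v ∉ Q) (hv' : v' ∉ Q)
    (h : G.profile (G.outerBoundary Q) v = G.profile (G.outerBoundary Q) v') :
    G.OuterEquiv Q v v' := by
  have key : ∀ v ∉ Q, ∀ w ∈ Q, G.Reachable v w →
      ∃ x ∈ G.outerBoundary Q, x ∈ G.geodesicInterval v w := by
    intro v hv w hw hr
    -- The boundary lies outside `Q`, so the crossing is sought from the end in `Q`.
    rw [geodesicInterval_comm]
    exact exists_outerBoundary_mem_geodesicInterval hw hv hr.symm
  intro w hw u hu
  rw [Set.notMem_compl_iff] at hw hu
  exact ⟨hK.mem_geodesicInterval_of_profile_eq h (key v hv) (key v' hv') hw hu,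
    hK.mem_geodesicInterval_of_profile_eq h.symm (key v' hv') (key v hv) hw hu⟩

theorem InnerEquiv.refl (Q : Set V) (u : V) : G.InnerEquiv Q u u := fun _ _ _ _ => Iff.rfl

theorem InnerEquiv.symm {Q : Set V} {u v : V} (h : G.InnerEquiv Q u v) : G.InnerEquiv Q v u :=
  fun w hw x hx => (h w hw x hx).symm

/-! ### Exchanging partial solutions -/

/-- `w` lies on a geodesic between two vertices of `S`. -/
def Covers (G : SimpleGraph V) (S : Finset V) (w : V) : Prop :=
  ∃ u ∈ S, ∃ v ∈ S, w ∈ G.geodesicInterval u v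

/-- Every vertex of `S` is equivalent to a vertex of `S'`. -/
def Simulates (r : V → V → Prop) (S S' : Finset V) : Prop := ∀ u ∈ S, ∃ u' ∈ S', r u u'

theorem Covers.mono {S S' : Finset V} {w : V} (h : G.Covers S w) (hS : S ⊆ S') : G.Covers S' w :=
  let ⟨u, hu, v, hv, hw⟩ := h; ⟨u, hS hu, v, hS hv, hw⟩

variable [DecidableEq V]

theorem covers_union_iff {S X : Finset V} {w : V} : G.Covers (S ∪ X) w ↔ G.Covers S w ∨
    G.Covers X w ∨ ∃ u ∈ S, ∃ v ∈ X, w ∈ G.geodesicInterval u v := by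
  constructor
  · rintro ⟨u, hu, v, hv, h⟩
    rcases Finset.mem_union.mp hu with hu | hu <;> rcases Finset.mem_union.mp hv with hv | hv
    · exact .inl ⟨u, hu, v, hv, h⟩
    · exact .inr (.inr ⟨u, hu, v, hv, h⟩)
    · rw [geodesicInterval_comm] at h
      exact .inr (.inr ⟨v, hv, u, hu, h⟩)
    · exact .inr (.inl ⟨u, hu, v, hv, h⟩)
  · rintro (h | h | ⟨u, hu, v, hv, h⟩)
    · exact h.mono Finset.subset_union_left
    · exact h.mono Finset.subset_union_right
    · exact ⟨u, Finset.mem_union_left _ hu, v, Finset.mem_union_right _ hv, h⟩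

/-- Replacing the outer part of a solution by equivalent vertices keeps the inside covered. -/
theorem covers_union_of_simulates_outer {Q : Set V} (hK : G.IsClique (G.outerBoundary Q))
    {S X T : Finset V} (hS : ∀ v ∈ S, v ∈ Q) (hX : ∀ v ∈ X, v ∉ Q)
    (hXT : Simulates (G.OuterEquiv Q) X T) {w : V} (hw : w ∈ Q) (h : G.Covers (S ∪ X) w) :
    G.Covers (S ∪ T) w := by
  rw [covers_union_iff] at h ⊢
  rcases h with h | ⟨u, hu, v, hv, h⟩ | ⟨u, hu, v, hv, h⟩
  · exact .inl h
  · exact absurd h (notMem_geodesicInterval_of_outside hK (hX u hu) (hX v hv) hw)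
  · obtain ⟨t, ht, hvt⟩ := hXT v hv
    rw [geodesicInterval_comm] at h
    have := (hvt w (Set.notMem_compl_iff.mpr hw) u (Set.notMem_compl_iff.mpr (hS u hu))).mp h
    rw [geodesicInterval_comm] at this
    exact .inr (.inr ⟨u, hu, t, ht, this⟩)

/-- Replacing the inner part of a solution by equivalent vertices keeps the outside covered. -/
theorem covers_union_of_simulates_inner {Q : Set V} {S S' X : Finset V} (hX : ∀ v ∈ X, v ∉ Q)
    (hSS' : Simulates (G.InnerEquiv Q) S S') (hC : ∀ w ∉ Q, G.Covers S w → G.Covers S' w)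
    {w : V} (hw : w ∉ Q) (h : G.Covers (S ∪ X) w) : G.Covers (S' ∪ X) w := by
  rw [covers_union_iff] at h ⊢
  rcases h with h | h | ⟨u, hu, v, hv, h⟩
  · exact .inl (hC w hw h)
  · exact .inr (.inl h)
  · obtain ⟨u', hu', hr⟩ := hSS' u hu
    exact .inr (.inr ⟨u', hu', v, hv, (hr w hw v (hX v hv)).mp h⟩)

/-- The exchange argument. The inside is covered by `S' ∪ T`, and `X` contains equivalents of all of
`T`; the outside was covered by `S ∪ X`, and `S'` does whatever `S` did there. The condition `hC`
handles pairs inside `Q`; pairs outside need no counterpart, since they cover nothing in `Q`. -/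
theorem isGeodeticSet_union_of_simulates {Q : Set V} (hK : G.IsClique (G.outerBoundary Q))
    {S S' X T : Finset V} (hS' : ∀ v ∈ S', v ∈ Q) (hX : ∀ v ∈ X, v ∉ Q) (hT : ∀ v ∈ T, v ∉ Q)
    (hTX : Simulates (G.OuterEquiv Q) T X) (hSS' : Simulates (G.InnerEquiv Q) S S')
    (hC : ∀ w ∉ Q, G.Covers S w → G.Covers S' w) (hcov : ∀ w ∈ Q, G.Covers (S' ∪ T) w)
    (h : G.IsGeodeticSet (S ∪ X)) : G.IsGeodeticSet (S' ∪ X) := by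
  intro w
  by_cases hw : w ∈ Q
  · exact covers_union_of_simulates_outer hK hS' hT hTX hw (hcov w hw)
  · exact covers_union_of_simulates_inner hX hSS' hC hw (h w)

/-- A family of sets that contains an optimal completion of every outer part of a solution. -/
def Represents (G : SimpleGraph V) (F : Set (Finset V)) (Q : Set V) : Prop :=
  ∀ S X : Finset V, (∀ v ∈ S, v ∈ Q) → (∀ v ∈ X, v ∉ Q) → G.IsGeodeticSet (S ∪ X) →
    ∃ S' ∈ F, S'.card ≤ S.card ∧ G.IsGeodeticSet (S' ∪ X)

/-- Two exchanges in turn: the part in `Q` is replaced while the part in `Q'` counts as outside,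
then the part in `Q'` while the new part in `Q` counts as outside. Disjointness makes the
cardinalities add up. -/
theorem Represents.mul {F F' : Set (Finset V)} {Q Q' : Set V} (h : G.Represents F Q)
    (h' : G.Represents F' Q') (hF : ∀ S ∈ F, ∀ v ∈ S, v ∈ Q) (hd : Disjoint Q Q') :
    G.Represents {S | ∃ A ∈ F, ∃ B ∈ F', S = A ∪ B} (Q ∪ Q') := by
  classical
  intro S X hS hX hG
  have hsplit : S = S.filter (· ∈ Q) ∪ S.filter (· ∈ Q') := by
    rw [← Finset.filter_or]; exact (Finset.filter_true_of_mem hS).symm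
  obtain ⟨A, hA, hAc, hAG⟩ := h (S.filter (· ∈ Q)) (S.filter (· ∈ Q') ∪ X) (by simp)
    (fun v hv => by
      rcases Finset.mem_union.mp hv with hv | hv
      · exact fun h => Set.disjoint_left.mp hd h (Finset.mem_filter.mp hv).2
      · exact fun h => hX v hv (.inl h)) (by rwa [← Finset.union_assoc, ← hsplit])
  rw [← Finset.union_assoc, Finset.union_comm A, Finset.union_assoc] at hAG
  obtain ⟨B, hB, hBc, hBG⟩ := h' (S.filter (· ∈ Q')) (A ∪ X) (by simp)
    (fun v hv => by
      rcases Finset.mem_union.mp hv with hv | hv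
      · exact fun h => Set.disjoint_left.mp hd (hF A hA v hv) h
      · exact fun h => hX v hv (.inr h)) hAG
  refine ⟨A ∪ B, ⟨A, hA, B, hB, rfl⟩, ?_, ?_⟩
  · have : S.card = (S.filter (· ∈ Q)).card + (S.filter (· ∈ Q')).card := by
      conv_lhs => rw [hsplit]
      apply Finset.card_union_of_disjoint
      rw [Finset.disjoint_left]
      exact fun v h1 h2 => Set.disjoint_left.mp hd (Finset.mem_filter.mp h1).2
        (Finset.mem_filter.mp h2).2
    have := Finset.card_union_le A B
    omega
  · rwa [← Finset.union_assoc, Finset.union_comm B] at hBG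

/-- For the case where a single vertex is merged with itself to become a block. -/
theorem Represents.mul_self {F : Set (Finset V)} {Q : Set V} (h : G.Represents F Q) :
    G.Represents {S | ∃ A ∈ F, ∃ B ∈ F, S = A ∪ B} Q := by
  intro S X hS hX hG
  obtain ⟨A, hA, h'⟩ := h S X hS hX hG
  exact ⟨A, ⟨A, hA, A, hA, by simp⟩, h'⟩

end SimpleGraph

namespace SimpleGraph

variable {V : Type*} {G : SimpleGraph V}

/-- Every nonempty set of vertices contains a vertex whose neighbours in the set are pairwise
adjacent. -/
def HasSimplicialVertices (G : SimpleGraph V) : Prop :=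
  ∀ U : Set V, U.Nonempty → ∃ v ∈ U, G.IsClique {x ∈ U | G.Adj v x}

/-! ### Merging blocks of vertices -/

/-- The set of vertices that have the label of `u` or the label of `v`. -/
def mergedBlock (lab : V → ℕ) (u v : V) : Set V := {x | lab x = lab u ∨ lab x = lab v}

/-- The blocks of `u` and `v` can be merged: the boundary of their union is a clique of vertices
with labels below `n`. -/
def Mergeable (G : SimpleGraph V) (n : ℕ) (lab : V → ℕ) (u v : V) : Prop :=
  (lab u ≠ lab v ∨ lab u < n) ∧ G.IsClique (G.outerBoundary (mergedBlock lab u v)) ∧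
    ∀ x ∈ G.outerBoundary (mergedBlock lab u v), lab x < n

/-- Labels below `n` mark single vertices; a block with another label is bounded by a clique of
single vertices. -/
structure IsBlockLabeling (G : SimpleGraph V) (n : ℕ) (lab : V → ℕ) : Prop where
  eq_of_lt : ∀ x y, lab x < n → lab y = lab x → y = x
  isClique : ∀ x, n ≤ lab x → G.IsClique (G.outerBoundary {z | lab z = lab x})
  lt : ∀ x, n ≤ lab x → ∀ y ∈ G.outerBoundary {z | lab z = lab x}, lab y < n

/-- Let `v` be simplicial among the single vertices; its closed neighbourhood there is a clique. If
two blocks are adjacent to `v`, both boundaries lie in that clique and the blocks can be merged. If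
only one is, it can absorb `v`. If none is, `v` alone becomes a block. -/
theorem IsBlockLabeling.exists_mergeable {n : ℕ} {lab : V → ℕ} (h : G.IsBlockLabeling n lab)
    (hG : G.HasSimplicialVertices) (hne : ¬ ∀ x y, lab x = lab y ∧ n ≤ lab x) :
    ∃ u v, G.Mergeable n lab u v := by
  by_cases hU : {x | lab x < n}.Nonempty
  · obtain ⟨v, hv, hvc⟩ := hG _ hU
    have hv : lab v < n := hv
    -- A block adjacent to `v` has `v` on its boundary; that boundary is a clique of single
    -- vertices, so it lies in the closed neighbourhood of `v`.
    have hproc : ∀ x z, n ≤ lab x → G.Adj v x → lab z = lab x → ∀ y, lab y ≠ lab x → G.Adj y z →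
        lab y < n ∧ (y = v ∨ G.Adj v y) := by
      intro x z hx hvx hz y hy hyz
      have h1 : y ∈ G.outerBoundary {z | lab z = lab x} := ⟨hy, z, hz, hyz⟩
      have h2 : v ∈ G.outerBoundary {z | lab z = lab x} :=
        ⟨fun h : lab v = lab x => by omega, x, rfl, hvx⟩
      refine ⟨h.lt x hx y h1, ?_⟩
      by_cases hyv : y = v
      · exact .inl hyv
      · exact .inr (h.isClique x hx h2 h1 (Ne.symm hyv))
    by_cases hx : ∃ x, n ≤ lab x ∧ G.Adj v x
    · obtain ⟨x, hx, hvx⟩ := hx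
      by_cases hx' : ∃ x', n ≤ lab x' ∧ G.Adj v x' ∧ lab x ≠ lab x'
      · obtain ⟨x', hx', hvx', hxx'⟩ := hx'
        have key : ∀ y ∈ G.outerBoundary (mergedBlock lab x x'),
            lab y < n ∧ (y = v ∨ G.Adj v y) := by
          rintro y ⟨hy, z, hz | hz, hyz⟩
          · exact hproc x z hx hvx hz y (fun h => hy (.inl h)) hyz
          · exact hproc x' z hx' hvx' hz y (fun h => hy (.inr h)) hyz
        refine ⟨x, x', .inl hxx', ?_, fun y hy => (key y hy).1⟩
        intro y hy z hz hyz
        obtain ⟨hyn, rfl | hvy⟩ := key y hy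
        · obtain ⟨hzn, rfl | hvz⟩ := key z hz
          · exact absurd rfl hyz
          · exact hvz
        · obtain ⟨hzn, rfl | hvz⟩ := key z hz
          · exact hvy.symm
          · exact hvc ⟨hyn, hvy⟩ ⟨hzn, hvz⟩ hyz
      · push Not at hx'
        have key : ∀ y ∈ G.outerBoundary (mergedBlock lab v x), lab y < n ∧ G.Adj v y := by
          rintro y ⟨hy, z, hz | hz, hyz⟩
          · have := h.eq_of_lt v z hv hz
            subst this
            refine ⟨?_, hyz.symm⟩
            by_contra! hyn
            exact hy (.inr (hx' y hyn hyz.symm).symm)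
          · obtain ⟨h1, h2⟩ := hproc x z hx hvx hz y (fun h => hy (.inr h)) hyz
            exact ⟨h1, h2.resolve_left fun h => hy (.inl (h ▸ rfl))⟩
        exact ⟨v, x, .inl (by omega), fun y hy z hz => hvc (key y hy) (key z hz),
          fun y hy => (key y hy).1⟩
    · push Not at hx
      have key : ∀ y ∈ G.outerBoundary (mergedBlock lab v v), lab y < n ∧ G.Adj v y := by
        rintro y ⟨hy, z, hz, hyz⟩
        have := h.eq_of_lt v z hv (or_self_iff.mp hz)
        subst this
        refine ⟨?_, hyz.symm⟩
        by_contra! hyn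
        exact hx y hyn hyz.symm
      exact ⟨v, v, .inr hv, fun y hy z hz => hvc (key y hy) (key z hz),
        fun y hy => (key y hy).1⟩
  -- Without single vertices all boundaries are empty, and any two blocks can be merged.
  · rw [Set.not_nonempty_iff_eq_empty, Set.eq_empty_iff_forall_notMem] at hU
    simp only [Set.mem_ofPred_eq, not_lt] at hU
    obtain ⟨x, y, hxy⟩ : ∃ x y, lab x ≠ lab y := by
      by_contra! hc
      exact hne fun x y => ⟨hc x y, hU x⟩
    have key : ∀ z, z ∉ G.outerBoundary (mergedBlock lab x y) := by
      rintro z ⟨hz, w, hw | hw, hzw⟩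
      · exact (hU z).not_gt (h.lt x (hU x) z ⟨fun h => hz (.inl h), w, hw, hzw⟩)
      · exact (hU z).not_gt (h.lt y (hU y) z ⟨fun h => hz (.inr h), w, hw, hzw⟩)
    exact ⟨x, y, .inl hxy, fun z hz => absurd hz (key z), fun z hz => absurd hz (key z)⟩

open Classical in
/-- Give the label `m` to the merged block of `u` and `v`. -/
noncomputable def relabel (lab : V → ℕ) (u v : V) (m : ℕ) : V → ℕ :=
  fun x => if x ∈ mergedBlock lab u v then m else lab x

theorem relabel_eq_iff {lab : V → ℕ} {u v : V} {m : ℕ} (hm : ∀ x, lab x ≠ m) (x : V) :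
    relabel lab u v m x = m ↔ x ∈ mergedBlock lab u v := by
  unfold relabel
  split_ifs with h <;> simp [h, hm]

theorem relabel_of_notMem {lab : V → ℕ} {u v : V} {m : ℕ} {x : V}
    (h : x ∉ mergedBlock lab u v) : relabel lab u v m x = lab x := if_neg h

theorem IsBlockLabeling.relabel {n m : ℕ} {lab : V → ℕ} (h : G.IsBlockLabeling n lab) {u v : V}
    (huv : G.Mergeable n lab u v) (hm : ∀ x, lab x ≠ m) (hnm : n ≤ m) :
    G.IsBlockLabeling n (relabel lab u v m) := by
  obtain ⟨-, hc, hl⟩ := huv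
  have hQ : {z | SimpleGraph.relabel lab u v m z = m} = mergedBlock lab u v :=
    Set.ext fun z => relabel_eq_iff hm z
  have hold : ∀ x ∉ mergedBlock lab u v,
      {z | SimpleGraph.relabel lab u v m z = lab x} = {z | lab z = lab x} := by
    intro x hx
    ext z
    by_cases hz : z ∈ mergedBlock lab u v
    · have h1 := (relabel_eq_iff hm z).mpr hz
      simp only [Set.mem_ofPred_eq, h1]
      constructor
      · exact fun h => absurd h.symm (hm x)
      · intro h
        exact absurd (by unfold mergedBlock at *; simpa [h] using hz) hx
    · simp [relabel_of_notMem hz]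
  refine ⟨?_, ?_, ?_⟩
  · intro x y hx hy
    by_cases hxQ : x ∈ mergedBlock lab u v
    · rw [(relabel_eq_iff hm x).mpr hxQ] at hx; omega
    · rw [relabel_of_notMem hxQ] at hx hy
      have : y ∈ {z | SimpleGraph.relabel lab u v m z = lab x} := hy
      rw [hold x hxQ] at this
      exact h.eq_of_lt x y hx this
  · intro x hx
    by_cases hxQ : x ∈ mergedBlock lab u v
    · rwa [(relabel_eq_iff hm x).mpr hxQ, hQ]
    · rw [relabel_of_notMem hxQ] at hx ⊢
      rw [hold x hxQ]
      exact h.isClique x hx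
  · intro x hx y hy
    by_cases hxQ : x ∈ mergedBlock lab u v
    · rw [(relabel_eq_iff hm x).mpr hxQ, hQ] at hy
      rw [relabel_of_notMem hy.1]
      exact hl y hy
    · rw [relabel_of_notMem hxQ] at hx hy
      rw [hold x hxQ] at hy
      -- Otherwise the neighbour of `y` in the block of `x` would lie on the boundary of the merged
      -- block, which consists of single vertices.
      have hyQ : y ∉ mergedBlock lab u v := by
        intro hyQ
        obtain ⟨z, hz, hyz⟩ := hy.2
        have hz : lab z = lab x := hz
        have : z ∉ mergedBlock lab u v := by
          intro hzQ
          exact hxQ (by unfold mergedBlock at *; simpa [hz] using hzQ)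
        have := hl z ⟨this, y, hyQ, hyz.symm⟩
        omega
      rw [relabel_of_notMem hyQ]
      exact h.lt x hx y hy

variable [Fintype V]

/-- The number of single vertices plus the number of blocks. -/
def blockMeasure (n : ℕ) (lab : V → ℕ) : ℕ :=
  (Finset.univ.filter fun x => lab x < n).card + (Finset.univ.image lab).card

/-- Two different labels are replaced by one; if the labels agree, the number of labels does not
grow but a single vertex ceases to be one. -/
theorem Mergeable.blockMeasure_lt {n m : ℕ} {lab : V → ℕ} {u v : V}
    (huv : G.Mergeable n lab u v) (hm : ∀ x, lab x ≠ m) (hnm : n ≤ m) :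
    blockMeasure n (relabel lab u v m) < blockMeasure n lab := by
  classical
  unfold blockMeasure
  have hsub : (Finset.univ.filter fun x => relabel lab u v m x < n) ⊆
      Finset.univ.filter fun x => lab x < n := by
    intro x hx
    simp only [Finset.mem_filter, Finset.mem_univ, true_and] at hx ⊢
    by_cases hxQ : x ∈ mergedBlock lab u v
    · rw [(relabel_eq_iff hm x).mpr hxQ] at hx; omega
    · rwa [relabel_of_notMem hxQ] at hx
  have himg : Finset.univ.image (relabel lab u v m) ⊆
      insert m (((Finset.univ.image lab).erase (lab u)).erase (lab v)) := by
    intro l hl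
    obtain ⟨x, -, rfl⟩ := Finset.mem_image.mp hl
    by_cases hxQ : x ∈ mergedBlock lab u v
    · simp [(relabel_eq_iff hm x).mpr hxQ]
    · rw [relabel_of_notMem hxQ]
      refine Finset.mem_insert_of_mem (Finset.mem_erase.mpr ⟨fun h => hxQ (.inr h),
        Finset.mem_erase.mpr ⟨fun h => hxQ (.inl h), by simp⟩⟩)
  have h1 := Finset.card_le_card hsub
  have h2 := (Finset.card_le_card himg).trans (Finset.card_insert_le _ _)
  have hu : lab u ∈ Finset.univ.image lab := by simp
  have hv : lab v ∈ Finset.univ.image lab := by simp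
  have h3 := Finset.card_erase_of_mem hu
  have h3' := Finset.card_pos.mpr ⟨_, hu⟩
  by_cases huv' : lab u = lab v
  · have hlt : lab u < n := huv.1.resolve_left (not_not.mpr huv')
    have h4 : (Finset.univ.filter fun x => relabel lab u v m x < n).card <
        (Finset.univ.filter fun x => lab x < n).card := by
      refine Finset.card_lt_card ⟨hsub, fun h => ?_⟩
      have := h (show u ∈ _ by simpa using hlt)
      simp only [Finset.mem_filter, Finset.mem_univ, true_and] at this
      rw [(relabel_eq_iff hm u).mpr (.inl rfl)] at this
      omega
    have h5 := Finset.card_le_card (Finset.erase_subset (lab v) ((Finset.univ.image lab).erase (lab u)))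
    omega
  · have hv' : lab v ∈ (Finset.univ.image lab).erase (lab u) :=
      Finset.mem_erase.mpr ⟨Ne.symm huv', hv⟩
    have h4 := Finset.card_erase_of_mem hv'
    have h4' := Finset.card_pos.mpr ⟨_, hv'⟩
    omega

theorem blockMeasure_pos [Nonempty V] (n : ℕ) (lab : V → ℕ) : 0 < blockMeasure n lab := by
  have : 0 < (Finset.univ.image lab).card :=
    Finset.card_pos.mpr (Finset.univ_nonempty.image _)
  unfold blockMeasure
  omega

end SimpleGraph

namespace SimpleGraph

variable {V : Type*} {G : SimpleGraph V}

/-! ### Simplicial vertices of chordal graphs -/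

/-- The graph `G` without the edges that leave `S`. -/
def within (G : SimpleGraph V) (S : Set V) : SimpleGraph V where
  Adj u v := G.Adj u v ∧ u ∈ S ∧ v ∈ S
  symm := ⟨fun _ _ h => ⟨h.1.symm, h.2.2, h.2.1⟩⟩
  loopless := ⟨fun _ h => h.1.ne rfl⟩

theorem within_mono {S T : Set V} (h : S ⊆ T) : G.within S ≤ G.within T :=
  fun _ _ hab => ⟨hab.1, h hab.2.1, h hab.2.2⟩

/-- If `a` and `b` were not adjacent, a shortest path between them in `S` would be induced of length
at least two, and `x`, which sees only its ends, would close it to an induced cycle of order at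
least four. -/
theorem IsChordalGraph.adj_of_reachable_within (hG : G.IsChordalGraph) {S : Set V} {a b x : V}
    (ha : a ∈ S) (hab : a ≠ b) (hxS : x ∉ S) (hxa : G.Adj x a) (hxb : G.Adj x b)
    (hx : ∀ s ∈ S, G.Adj x s → s = a ∨ s = b) (hr : (G.within S).Reachable a b) :
    G.Adj a b := by
  by_contra hnab
  obtain ⟨p, hp⟩ := hr.exists_walk_length_eq_dist
  set l := p.length with hl
  have hS : ∀ i, p.getVert i ∈ S := by
    intro i
    rcases Nat.eq_zero_or_pos i with rfl | hi
    · simpa using ha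
    · by_cases hil : i ≤ p.length
      · have := p.adj_getVert_succ (i := i - 1) (by omega)
        rw [Nat.sub_add_cancel hi] at this
        exact this.2.2
      · rw [p.getVert_of_length_le (by omega), ← p.getVert_length]
        rcases Nat.eq_zero_or_pos p.length with h0 | h0
        · rw [h0]; simpa using ha
        · have := p.adj_getVert_succ (i := p.length - 1) (by omega)
          rw [Nat.sub_add_cancel h0] at this
          exact this.2.2
  -- Subpaths of a shortest path are shortest, which rules out chords and repetitions.
  have hfar : ∀ i j, i ≤ j → j ≤ l →
      j - i ≤ (G.within S).dist (p.getVert i) (p.getVert j) := by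
    intro i j hij hj
    have h1 := (p.take i).reachable.dist_triangle (w := b) (p.drop i).reachable
    have h2 := Reachable.dist_triangle (v := p.getVert j)
      ((p.drop i).reachable.trans (p.drop j).reachable.symm) (p.drop j).reachable
    have h3 := dist_le (p.take i)
    have h4 := dist_le (p.drop j)
    rw [Walk.take_length] at h3
    rw [Walk.drop_length] at h4
    omega
  have hne : ∀ i j, i < j → j ≤ l → p.getVert i ≠ p.getVert j := by
    intro i j hij hj h
    have := hfar i j hij.le hj
    rw [h, dist_self] at this
    omega
  have hadj : ∀ i j, i < j → j ≤ l → (G.Adj (p.getVert i) (p.getVert j) ↔ j = i + 1) := by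
    intro i j hij hj
    constructor
    · intro h
      have h1 := hfar i j hij.le hj
      have : (G.within S).Adj (p.getVert i) (p.getVert j) := ⟨h, hS i, hS j⟩
      rw [dist_eq_one_iff_adj.mpr this] at h1
      omega
    · rintro rfl
      exact (p.adj_getVert_succ (by omega)).1
  have hpl : p.getVert l = b := p.getVert_length
  have hl2 : 2 ≤ l := by
    by_contra! hlt
    interval_cases hl' : l
    · exact hab (by simpa using hpl)
    · exact hnab (by simpa [hpl] using (hadj 0 1 (by omega) (by omega)).mpr rfl)
  have hxadj : ∀ i ≤ l, (G.Adj (p.getVert i) x ↔ i = 0 ∨ i = l) := by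
    intro i hi
    constructor
    · intro h
      rcases hx _ (hS i) h.symm with h | h
      · left
        by_contra h0
        exact hne 0 i (by omega) hi (by simp [h])
      · right
        by_contra h0
        exact hne i l (by omega) le_rfl (by rw [h, hpl])
    · rintro (rfl | rfl)
      · simpa using hxa.symm
      · rw [hpl]; exact hxb.symm
  -- The cycle has order `l + 2`: the `l + 1` path vertices, then `x` at index `l + 1`.
  let f : ℕ → V := fun i => if i ≤ l then p.getVert i else x
  have hf : ∀ i j, i < j → j < l + 2 →
      f i ≠ f j ∧ (G.Adj (f i) (f j) ↔ j = i + 1 ∨ (i = 0 ∧ j = l + 1)) := by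
    intro i j hij hj
    by_cases hjl : j ≤ l
    · simp only [f, if_pos hjl, if_pos (hij.le.trans hjl)]
      refine ⟨hne i j hij hjl, (hadj i j hij hjl).trans ?_⟩
      omega
    · simp only [f, if_neg hjl, if_pos (show i ≤ l by omega)]
      refine ⟨fun h => hxS (h ▸ hS i), (hxadj i (by omega)).trans ?_⟩
      omega
  have hcyc : ∀ i j : Fin (l + 2), i < j →
      ((cycleGraph (l + 2)).Adj i j ↔ G.Adj (f i) (f j)) := by
    intro i j hij
    rw [(hf i j hij j.2).2, cycleGraph_adj']
    have hij' : i.val < j.val := hij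
    rw [Fin.sub_val_of_le hij.le, Fin.coe_sub_iff_lt.mpr hij]
    have := j.2
    omega
  refine (hG (l + 2) (by omega)).false
    ⟨⟨fun i => f i, fun i j hij => ?_⟩, fun {i j} => ?_⟩
  · by_contra hne
    rcases lt_or_gt_of_ne hne with h | h
    · exact (hf i j h j.2).1 hij
    · exact (hf j i h i.2).1 hij.symm
  · rcases lt_trichotomy i j with h | rfl | h
    · exact (hcyc i j h).symm
    · simp
    · rw [adj_comm (u := i)]
      exact (G.adj_comm _ _).trans (hcyc j i h).symm

/-- Dirac: a vertex of a chordal graph that is not adjacent to all others has a simplicial vertex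
beyond its neighbourhood. -/
theorem IsChordalGraph.exists_simplicial_not_adj [Finite V] (hG : G.IsChordalGraph) :
    ∀ (m : ℕ) (U : Set V) (x z : V), U.ncard ≤ m → x ∈ U → z ∈ U → z ≠ x → ¬ G.Adj x z →
      ∃ v ∈ U, v ≠ x ∧ ¬ G.Adj x v ∧ G.IsClique {y ∈ U | G.Adj v y} := by
  intro m
  induction m with
  | zero =>
    intro U x z hU hx
    have := (Set.ncard_pos U.toFinite).mpr ⟨x, hx⟩
    omega
  | succ m ih =>
    intro U x z hU hx hz hzx hxz
    -- `C` is the component of `z` among the non-neighbours of `x`, and `K` its attachment in the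
    -- neighbourhood of `x`. Neighbours in `U` of a vertex of `C` lie in `C ∪ K`, so a vertex of `C`
    -- simplicial there is simplicial in `U`. Since `x` is missing from `C ∪ K`, induction applies.
    let S := {y ∈ U | y ≠ x ∧ ¬ G.Adj x y}
    let C := {y | y ∈ S ∧ (G.within S).Reachable z y}
    let K := {y ∈ U | G.Adj x y ∧ ∃ c ∈ C, G.Adj y c}
    have hnbr : ∀ c ∈ C, ∀ y ∈ U, G.Adj c y → y ∈ C ∪ K := by
      rintro c hc y hy hcy
      by_cases hxy : G.Adj x y
      · exact .inr ⟨hy, hxy, c, hc, hcy.symm⟩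
      · have hyS : y ∈ S := ⟨hy, fun h => hc.1.2.2 (h ▸ hcy.symm), hxy⟩
        exact .inl ⟨hyS, hc.2.trans (Adj.reachable ⟨hcy, hc.1, hyS⟩)⟩
    -- Two vertices of `K` are connected through `C`, and they are the only neighbours of `x` in `S`
    -- enlarged by these two.
    have hK : G.IsClique K := by
      rintro a ⟨haU, hxa, c, hc, hac⟩ b ⟨hbU, hxb, d, hd, hbd⟩ hab
      have hsub : S ⊆ insert a (insert b S) := fun s hs => .inr (.inr hs)
      refine hG.adj_of_reachable_within (S := insert a (insert b S)) (.inl rfl) hab ?_ hxa hxb ?_ ?_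
      · rintro (h | h | h)
        · exact hxa.ne h
        · exact hxb.ne h
        · exact h.2.1 rfl
      · rintro s (h | h | h) hxs
        · exact .inl h
        · exact .inr h
        · exact absurd hxs h.2.2
      · have h1 : (G.within (insert a (insert b S))).Adj a c := ⟨hac, .inl rfl, hsub hc.1⟩
        have h2 : (G.within (insert a (insert b S))).Adj b d :=
          ⟨hbd, .inr (.inl rfl), hsub hd.1⟩
        have h3 := (hc.2.symm.trans hd.2).mono (within_mono (G := G) hsub)
        exact h1.reachable.trans (h3.trans h2.reachable.symm)
    have hCU : C ⊆ U := fun c hc => hc.1.1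
    have hWU : C ∪ K ⊆ U := Set.union_subset hCU fun y hy => hy.1
    have hxW : x ∉ C ∪ K := by
      rintro (h | h)
      · exact h.1.2.1 rfl
      · exact h.2.1.ne rfl
    have hWm : (C ∪ K).ncard ≤ m := by
      have := Set.ncard_lt_ncard (Set.ssubset_iff_subset_ne.mpr ⟨hWU, fun h => hxW (h ▸ hx)⟩)
      omega
    have hfin : ∀ v ∈ C, G.IsClique {y ∈ C ∪ K | G.Adj v y} →
        ∃ v ∈ U, v ≠ x ∧ ¬ G.Adj x v ∧ G.IsClique {y ∈ U | G.Adj v y} := by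
      intro v hv hvc
      refine ⟨v, hCU hv, hv.1.2.1, hv.1.2.2, fun a ha b hb => ?_⟩
      exact hvc ⟨hnbr v hv a ha.1 ha.2, ha.2⟩ ⟨hnbr v hv b hb.1 hb.2, hb.2⟩
    have hzC : z ∈ C := ⟨⟨hz, hzx, hxz⟩, Reachable.refl _⟩
    -- Starting the induction from `y ∈ K` gives a vertex not adjacent to `y`, hence in `C` because
    -- `K` is a clique. If all of `K` is adjacent to everything, a start in `C` cannot end in `K`
    -- either. Otherwise `C ∪ K` is complete and `z` itself serves.
    by_cases h1 : ∃ y ∈ K, ∃ w ∈ C ∪ K, w ≠ y ∧ ¬ G.Adj y w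
    · obtain ⟨y, hy, w, hw, hwy, hyw⟩ := h1
      obtain ⟨v, hv, hvy, hyv, hvc⟩ := ih (C ∪ K) y w hWm (.inr hy) hw hwy hyw
      rcases hv with hv | hv
      · exact hfin v hv hvc
      · exact absurd (hK hy hv hvy.symm) hyv
    · push Not at h1
      by_cases h2 : ∃ y ∈ C, ∃ w ∈ C ∪ K, w ≠ y ∧ ¬ G.Adj y w
      · obtain ⟨y, hy, w, hw, hwy, hyw⟩ := h2
        obtain ⟨v, hv, hvy, hyv, hvc⟩ := ih (C ∪ K) y w hWm (.inl hy) hw hwy hyw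
        rcases hv with hv | hv
        · exact hfin v hv hvc
        · exact absurd (h1 v hv y (.inl hy) hvy.symm).symm hyv
      · push Not at h2
        refine hfin z hzC fun a ha b hb hab => ?_
        rcases ha.1 with h | h
        · exact h2 a h b hb.1 hab.symm
        · exact h1 a h b hb.1 hab.symm

theorem IsChordalGraph.hasSimplicialVertices [Finite V] (hG : G.IsChordalGraph) :
    G.HasSimplicialVertices := by
  intro U ⟨u, hu⟩
  by_cases h : ∃ x ∈ U, ∃ z ∈ U, z ≠ x ∧ ¬ G.Adj x z
  · obtain ⟨x, hx, z, hz, hzx, hxz⟩ := h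
    obtain ⟨v, hv, -, -, hvc⟩ := hG.exists_simplicial_not_adj _ U x z le_rfl hx hz hzx hxz
    exact ⟨v, hv, hvc⟩
  · push Not at h
    exact ⟨u, hu, fun a ha b hb hab => h a ha.1 b hb.1 hab.symm⟩

/-! ### Interval graphs -/

/-- The intervals `[l v, r v]` represent `G`. -/
structure IsIntervalRep (G : SimpleGraph V) (l r : V → ℝ) : Prop where
  le : ∀ v, l v ≤ r v
  adj_iff : ∀ u v, u ≠ v → (G.Adj u v ↔ l u ≤ r v ∧ l v ≤ r u)

theorem IsIntervalGraph.exists_rep (hG : G.IsIntervalGraph) : ∃ l r, G.IsIntervalRep l r := by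
  obtain ⟨l, r, hle, h⟩ := hG
  refine ⟨l, r, hle, fun u v huv => ?_⟩
  rw [h u v huv, Set.Icc_inter_Icc, Set.nonempty_Icc, sup_le_iff, le_inf_iff, le_inf_iff]
  have := hle u
  have := hle v
  tauto

theorem IsIntervalRep.neg {l r : V → ℝ} (h : G.IsIntervalRep l r) :
    G.IsIntervalRep (fun v => -r v) (fun v => -l v) where
  le v := neg_le_neg (h.le v)
  adj_iff u v huv := by
    rw [h.adj_iff u v huv, neg_le_neg_iff, neg_le_neg_iff]
    exact and_comm

/-- For the interval with the leftmost right end, all neighbouring intervals contain that end. -/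
theorem IsIntervalRep.hasSimplicialVertices [Finite V] {l r : V → ℝ} (h : G.IsIntervalRep l r) :
    G.HasSimplicialVertices := by
  intro U hU
  obtain ⟨v, hv, hmin⟩ := Set.exists_min_image U r U.toFinite hU
  refine ⟨v, hv, fun x hx y hy hxy => ?_⟩
  have h1 := (h.adj_iff v x hx.2.ne).mp hx.2
  have h2 := (h.adj_iff v y hy.2.ne).mp hy.2
  exact (h.adj_iff x y hxy).mpr ⟨h1.2.trans (hmin y hy.1), h2.2.trans (hmin x hx.1)⟩

/-- Seen from the left of a clique, intervals that start earlier are at least as close. -/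
theorem IsIntervalRep.dist_le_of_walk {l r : V → ℝ} (h : G.IsIntervalRep l r) {p : ℝ} {x y : V}
    (hx : l x ≤ p ∧ p ≤ r x) (hy : p ≤ r y) (hxy : l x ≤ l y) {u : V} (q : G.Walk u y)
    (hu : r u < p) : G.Reachable u x ∧ G.dist u x ≤ q.length := by
  induction q with
  | nil => linarith
  | @cons u w y huw q ih =>
    rw [Walk.length_cons]
    by_cases h1 : l x ≤ r u
    · have hux : u ≠ x := by rintro rfl; linarith
      have : G.Adj u x := (h.adj_iff u x hux).mpr ⟨by linarith [h.le u], h1⟩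
      exact ⟨this.reachable, by rw [dist_eq_one_iff_adj.mpr this]; omega⟩
    · by_cases h2 : r w < p
      · obtain ⟨h3, h4⟩ := ih hy hxy h2
        have h5 := huw.reachable.dist_triangle h3
        rw [dist_eq_one_iff_adj.mpr huw] at h5
        exact ⟨huw.reachable.trans h3, by omega⟩
      · have h3 := (h.adj_iff u w huw.ne).mp huw
        by_cases hwx : w = x
        · subst hwx
          exact ⟨huw.reachable, by rw [dist_eq_one_iff_adj.mpr huw]; omega⟩
        · have h4 : G.Adj w x := (h.adj_iff w x hwx).mpr ⟨by linarith, by linarith⟩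
          have h5 := huw.reachable.dist_triangle h4.reachable
          rw [dist_eq_one_iff_adj.mpr huw, dist_eq_one_iff_adj.mpr h4] at h5
          -- If the walk ended in `w = y`, then `l y ≤ r u < l x`, against `l x ≤ l y`. So stepping
          -- from `w` to `x` is not longer than the rest of the walk.
          have h6 : q.length ≠ 0 := by
            intro h0
            obtain rfl := Walk.eq_of_length_eq_zero h0
            linarith
          exact ⟨huw.reachable.trans h4.reachable, by omega⟩

/-- Seen from the left the profile is closed under earlier left ends, so its member with the largest
left end determines it. -/
theorem IsIntervalRep.profile_eq_of_lt [Finite V] {l r : V → ℝ} (h : G.IsIntervalRep l r) {p : ℝ}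
    {K : Set V} (hp : ∀ x ∈ K, l x ≤ p ∧ p ≤ r x) {u : V} (hu : r u < p)
    (hne : (G.profile K u).Nonempty) :
    ∃ x ∈ K, G.profile K u = {y ∈ K | l y ≤ l x} := by
  obtain ⟨x, hx, hmax⟩ := Set.exists_max_image _ l (G.profile K u).toFinite hne
  refine ⟨x, hx.1, Set.ext fun y => ⟨fun hy => ⟨hy.1, hmax y hy⟩, fun hy => ?_⟩⟩
  obtain ⟨q, hq⟩ := hx.2.1.exists_walk_length_eq_dist
  obtain ⟨h1, h2⟩ := h.dist_le_of_walk (hp y hy.1) (hp x hx.1).2 hy.2 q hu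
  exact ⟨hy.1, h1, fun z hz => (h2.trans hq.le).trans (hx.2.2 z hz)⟩

/-- The intervals of a clique share a point, namely their largest left end. A vertex to the left of
it sees an initial segment by left ends, a vertex to the right a final segment by right ends; one
that contains the point is adjacent to the whole clique and sees `{u}` or `K`. The empty profile
comes from other components or from `K = ∅`. -/
theorem IsIntervalRep.ncard_range_profile_le [Finite V] {l r : V → ℝ} (h : G.IsIntervalRep l r)
    {K : Set V} (hK : G.IsClique K) : (Set.range (G.profile K)).ncard ≤ 3 * K.ncard + 2 := by
  have hsub : Set.range (G.profile K) ⊆ {∅, K} ∪ ((fun x => ({x} : Set V)) '' K ∪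
      ((fun x => {y ∈ K | l y ≤ l x}) '' K ∪ (fun x => {y ∈ K | r x ≤ r y}) '' K)) := by
    rintro _ ⟨u, rfl⟩
    by_cases hne : (G.profile K u).Nonempty
    · obtain ⟨x₁, hx₁, hmax⟩ := Set.exists_max_image K l K.toFinite
        (hne.mono (profile_subset K u))
      have hp : ∀ x ∈ K, l x ≤ l x₁ ∧ l x₁ ≤ r x := by
        intro x hx
        refine ⟨hmax x hx, ?_⟩
        by_cases hxx : x = x₁
        · subst hxx; exact h.le x
        · exact ((h.adj_iff x x₁ hxx).mp (hK hx hx₁ hxx)).2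
      rcases lt_or_ge (r u) (l x₁) with hu | hu
      · obtain ⟨x, hx, hxp⟩ := h.profile_eq_of_lt hp hu hne
        exact .inr (.inr (.inl ⟨x, hx, hxp.symm⟩))
      rcases lt_or_ge (l x₁) (l u) with hu' | hu'
      · obtain ⟨x, hx, hxp⟩ := h.neg.profile_eq_of_lt (p := -l x₁)
          (fun x hx => ⟨neg_le_neg (hp x hx).2, neg_le_neg (hp x hx).1⟩) (neg_lt_neg hu') hne
        refine .inr (.inr (.inr ⟨x, hx, ?_⟩))
        rw [hxp]
        simp only [neg_le_neg_iff]
      have hadj : ∀ x ∈ K, u ≠ x → G.Adj u x := fun x hx hux =>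
        (h.adj_iff u x hux).mpr ⟨hu'.trans (hp x hx).2, (hp x hx).1.trans hu⟩
      by_cases huK : u ∈ K
      · refine .inr (.inl ⟨u, huK, Set.ext fun y => ?_⟩)
        constructor
        · rintro rfl
          exact ⟨huK, Reachable.refl _, fun z hz => by simp⟩
        · intro hy
          by_contra hyu
          have h1 := hy.2.2 u huK
          rw [dist_self, dist_eq_one_iff_adj.mpr (hadj y hy.1 (fun h => hyu h.symm))] at h1
          omega
      · refine .inl (.inr (Set.ext fun y => ⟨fun hy => hy.1, fun hy => ?_⟩))
        have h1 : ∀ z ∈ K, G.dist u z = 1 := fun z hz =>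
          dist_eq_one_iff_adj.mpr (hadj z hz fun h => huK (h ▸ hz))
        exact ⟨hy, (hadj y hy fun h => huK (h ▸ hy)).reachable,
          fun z hz => by rw [h1 y hy, h1 z hz]⟩
    · exact .inl (.inl (Set.not_nonempty_iff_eq_empty.mp hne))
  have h1 := Set.ncard_le_ncard hsub (Set.toFinite _)
  have h2 := Set.ncard_union_le {∅, K} ((fun x => ({x} : Set V)) '' K ∪
      ((fun x => {y ∈ K | l y ≤ l x}) '' K ∪ (fun x => {y ∈ K | r x ≤ r y}) '' K))
  have h3 := Set.ncard_union_le ((fun x => ({x} : Set V)) '' K)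
      ((fun x => {y ∈ K | l y ≤ l x}) '' K ∪ (fun x => {y ∈ K | r x ≤ r y}) '' K)
  have h4 := Set.ncard_union_le ((fun x => {y ∈ K | l y ≤ l x}) '' K)
    ((fun x => {y ∈ K | r x ≤ r y}) '' K)
  have h5 := Set.ncard_image_le (f := fun x => ({x} : Set V)) K.toFinite
  have h6 := Set.ncard_image_le (f := fun x => {y ∈ K | l y ≤ l x}) K.toFinite
  have h7 := Set.ncard_image_le (f := fun x => {y ∈ K | r x ≤ r y}) K.toFinite
  have h8 := Set.ncard_insert_le (∅ : Set V) {K}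
  rw [Set.ncard_singleton] at h8
  omega

theorem ncard_range_profile_le [Finite V] (K : Set V) :
    (Set.range (G.profile K)).ncard ≤ 2 ^ K.ncard := by
  rw [← Set.ncard_powerset K K.toFinite]
  exact Set.ncard_le_ncard (by rintro _ ⟨u, rfl⟩; exact profile_subset K u) (Set.toFinite _)

theorem IsClique.ncard_le_cliqueNum [Finite V] {K : Set V} (hK : G.IsClique K) :
    K.ncard ≤ G.cliqueNum := by
  have := Fintype.ofFinite V
  classical
  rw [Set.ncard_eq_toFinset_card']
  exact IsClique.card_le_cliqueNum (tc := by simpa using hK)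

/-! ### `k`-trees -/

/-- The vertex of `U` listed last will do: its neighbours in `U` precede it. -/
theorem IsKTree.hasSimplicialVertices {n k : ℕ} {G : SimpleGraph (Fin n)} (hG : G.IsKTree k) :
    G.HasSimplicialVertices := by
  obtain ⟨-, σ, h1, h2⟩ := hG
  intro U hU
  obtain ⟨v, hv, hmax⟩ := Set.exists_max_image U σ.symm U.toFinite hU
  refine ⟨v, hv, fun x hx y hy hxy => ?_⟩
  have key : ∀ x ∈ {x ∈ U | G.Adj v x}, σ.symm x < σ.symm v := fun x hx =>
    lt_of_le_of_ne (hmax x hx.1) fun h => hx.2.ne (σ.symm.injective h).symm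
  by_cases hk : k + 1 ≤ (σ.symm v).val
  · obtain ⟨N, hN, hN'⟩ := h2 _ hk
    have key' : ∀ x ∈ {x ∈ U | G.Adj v x}, x ∈ N := by
      intro x hx
      have := (hN' (σ.symm x)).mpr ⟨key x hx, by simpa using hx.2⟩
      simpa using this
    exact hN.isClique (key' x hx) (key' y hy) hxy
  · have hx' : (σ.symm x).val < (σ.symm v).val := key x hx
    have hy' : (σ.symm y).val < (σ.symm v).val := key y hy
    simpa using h1 (σ.symm x) (σ.symm y) (by omega) (by omega)
      fun h => hxy (σ.symm.injective h)

/-- All other vertices of a clique precede its last one; either they are among its `k` earlier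
neighbours, or the clique lies in the initial `k + 1` vertices. -/
theorem IsKTree.ncard_le {n k : ℕ} {G : SimpleGraph (Fin n)} (hG : G.IsKTree k)
    {K : Set (Fin n)} (hK : G.IsClique K) : K.ncard ≤ k + 1 := by
  obtain ⟨-, σ, h1, h2⟩ := hG
  rcases K.eq_empty_or_nonempty with rfl | hne
  · simp
  obtain ⟨v, hv, hmax⟩ := Set.exists_max_image K σ.symm K.toFinite hne
  by_cases hk : k + 1 ≤ (σ.symm v).val
  · obtain ⟨N, hN, hN'⟩ := h2 _ hk
    have hsub : K ⊆ insert v (N : Set (Fin n)) := by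
      intro x hx
      by_cases hxv : x = v
      · exact .inl hxv
      · have := (hN' (σ.symm x)).mpr ⟨lt_of_le_of_ne (hmax x hx)
          fun h => hxv (σ.symm.injective h), by simpa using hK hv hx (Ne.symm hxv)⟩
        exact .inr (by simpa using this)
    have h3 := Set.ncard_le_ncard hsub (Set.toFinite _)
    have h4 := Set.ncard_insert_le v (N : Set (Fin n))
    rw [Set.ncard_coe_finset, hN.card_eq] at h4
    omega
  · have hinj : Set.InjOn (fun x => (σ.symm x).val) K :=
      fun x _ y _ h => σ.symm.injective (Fin.ext h)
    rw [← hinj.ncard_image]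
    have hsub : (fun x => (σ.symm x).val) '' K ⊆ (Finset.range (k + 1) : Set ℕ) := by
      rintro _ ⟨x, hx, rfl⟩
      have : (σ.symm x).val ≤ (σ.symm v).val := hmax x hx
      simp only [Finset.coe_range, Set.mem_Iio]
      omega
    have h3 := Set.ncard_le_ncard hsub (Set.toFinite _)
    rwa [Set.ncard_coe_finset, Finset.card_range] at h3

end SimpleGraph

namespace RAM

open Function

namespace Tm

/-! ### Formulas as terms -/

def not (t : Tm) : Tm := sub (const 1) t
def and (a b : Tm) : Tm := not (add (not a) (not b))
def or (a b : Tm) : Tm := add a b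
def imp (a b : Tm) : Tm := or (not a) b
def iff (a b : Tm) : Tm := and (imp a b) (imp b a)
def le (a b : Tm) : Tm := not (sub a b)
def lt (a b : Tm) : Tm := sub b a
def eq (a b : Tm) : Tm := and (le a b) (le b a)
def ex (x y : ℕ) (t : Tm) : Tm := sum x y t
def all (x y : ℕ) (t : Tm) : Tm := not (sum x y (not t))

/-- The least value of `x` below the register `y` such that `P x` is true, and the value of `y`
if there is none; `z` is an auxiliary variable. -/
def least (x z y : ℕ) (P : ℕ → Tm) : Tm :=
  sum x y (all z y (or (lt (var x) (var z)) (not (P z))))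

/-- The address of the entry `x, y` of a matrix with `n` columns. -/
def cell (x y : Tm) : Tm := add (sum 90 0 x) y

variable {A : ℕ → ℕ → ℕ} {v : ℕ → ℕ}

theorem eval_not (t : Tm) : (not t).eval A v = if t.eval A v = 0 then 1 else 0 := by
  simp only [not, eval]; split_ifs <;> omega

@[simp] theorem not_ne_zero {t : Tm} : (not t).eval A v ≠ 0 ↔ t.eval A v = 0 := by
  rw [eval_not]; split_ifs <;> simp_all

@[simp] theorem and_ne_zero {a b : Tm} :
    (and a b).eval A v ≠ 0 ↔ a.eval A v ≠ 0 ∧ b.eval A v ≠ 0 := by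
  simp only [and, not, eval]; omega

@[simp] theorem or_ne_zero {a b : Tm} :
    (or a b).eval A v ≠ 0 ↔ a.eval A v ≠ 0 ∨ b.eval A v ≠ 0 := by
  simp only [or, eval]; omega

@[simp] theorem imp_ne_zero {a b : Tm} :
    (imp a b).eval A v ≠ 0 ↔ (a.eval A v ≠ 0 → b.eval A v ≠ 0) := by
  simp only [imp, or, not, eval]; omega

@[simp] theorem iff_ne_zero {a b : Tm} :
    (iff a b).eval A v ≠ 0 ↔ (a.eval A v ≠ 0 ↔ b.eval A v ≠ 0) := by
  rw [iff, and_ne_zero, imp_ne_zero, imp_ne_zero]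
  exact ⟨fun h => ⟨h.1, h.2⟩, fun h => ⟨h.1, h.2⟩⟩

@[simp] theorem le_ne_zero {a b : Tm} : (le a b).eval A v ≠ 0 ↔ a.eval A v ≤ b.eval A v := by
  simp only [le, not, eval]; omega

@[simp] theorem lt_ne_zero {a b : Tm} : (lt a b).eval A v ≠ 0 ↔ a.eval A v < b.eval A v := by
  simp only [lt, eval]; omega

@[simp] theorem eq_ne_zero {a b : Tm} : (eq a b).eval A v ≠ 0 ↔ a.eval A v = b.eval A v := by
  rw [eq, and_ne_zero, le_ne_zero, le_ne_zero, le_antisymm_iff]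

@[simp] theorem ex_ne_zero {x y : ℕ} {t : Tm} :
    (ex x y t).eval A v ≠ 0 ↔ ∃ i < v y, t.eval A (update v x i) ≠ 0 := by
  simp [ex, eval, Finset.sum_eq_zero_iff]

@[simp] theorem all_ne_zero {x y : ℕ} {t : Tm} :
    (all x y t).eval A v ≠ 0 ↔ ∀ i < v y, t.eval A (update v x i) ≠ 0 := by
  rw [all, not_ne_zero]
  simp only [eval, Finset.sum_eq_zero_iff, Finset.mem_range]
  refine forall₂_congr fun i _ => ?_
  rw [← not_iff_not, ← ne_eq, not_ne_zero, not_not]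

theorem ex_fin_ne_zero {n : ℕ} (h : v 0 = n) {x : ℕ} {t : Tm} :
    (ex x 0 t).eval A v ≠ 0 ↔ ∃ i : Fin n, t.eval A (update v x i) ≠ 0 := by
  rw [ex_ne_zero, h]
  exact ⟨fun ⟨i, hi, hit⟩ => ⟨⟨i, hi⟩, hit⟩, fun ⟨i, hit⟩ => ⟨i, i.2, hit⟩⟩

theorem all_fin_ne_zero {n : ℕ} (h : v 0 = n) {x : ℕ} {t : Tm} :
    (all x 0 t).eval A v ≠ 0 ↔ ∀ i : Fin n, t.eval A (update v x i) ≠ 0 := by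
  rw [all_ne_zero, h]
  exact ⟨fun H i => H i i.2, fun H i hi => H ⟨i, hi⟩⟩

/-- The numbers counted are those below every solution; there are as many as the least solution
says, or `m` if there is no solution. -/
theorem sum_first_spec (P : ℕ → Prop) [DecidablePred P] (m : ℕ) (k : ℕ)
    (hk : k = ∑ x ∈ Finset.range m, if ∀ z < m, x < z ∨ ¬ P z then 1 else 0) :
    k < m ∧ P k ∨ k = m ∧ ∀ z < m, ¬ P z := by
  rw [← Finset.sum_filter, Finset.sum_const, smul_eq_mul, mul_one] at hk
  by_cases h : ∃ z < m, P z
  · have hfind := Nat.find_spec h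
    set z := Nat.find h
    have : (Finset.range m).filter (fun x => ∀ z < m, x < z ∨ ¬ P z) = Finset.range z := by
      ext x
      simp only [Finset.mem_filter, Finset.mem_range]
      constructor
      · exact fun hx => (hx.2 z hfind.1).resolve_right (not_not.mpr hfind.2)
      · refine fun hx => ⟨hx.trans hfind.1, fun y hy => ?_⟩
        by_contra! hc
        exact Nat.find_min h (hc.1.trans_lt hx) ⟨hy, hc.2⟩
    rw [this, Finset.card_range] at hk
    exact .inl (hk ▸ hfind)
  · push Not at h
    rw [Finset.filter_true_of_mem fun x _ z hz => .inr (h z hz), Finset.card_range] at hk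
    exact .inr ⟨hk, h⟩

theorem eval_least_spec {x z y : ℕ} {P : ℕ → Tm} {R : ℕ → Prop} (hxz : x ≠ z) (hxy : y ≠ x)
    (hP : ∀ i < v y, ∀ j < v y,
      (P z).eval A (update (update v x i) z j) ≠ 0 ↔ R j) :
    (least x z y P).eval A v < v y ∧ R ((least x z y P).eval A v) ∨
      (least x z y P).eval A v = v y ∧ ∀ j < v y, ¬ R j := by
  classical
  refine sum_first_spec R (v y) _ ?_
  rw [least, eval]
  refine Finset.sum_congr rfl fun i hi => ?_
  rw [all, eval_not]
  refine if_congr ?_ rfl rfl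
  simp only [eval, Finset.sum_eq_zero_iff, Finset.mem_range, update_of_ne hxy]
  refine forall₂_congr fun j hj => ?_
  rw [eval_not]
  have h1 := hP i (Finset.mem_range.mp hi) j hj
  have : ((var x).lt (var z) |>.or (P z).not).eval A (update (update v x i) z j) ≠ 0 ↔
      i < j ∨ ¬ R j := by
    rw [or_ne_zero, lt_ne_zero, not_ne_zero, ← h1, not_not]
    simp [eval, update_of_ne hxz]
  rw [← this]
  split_ifs with h <;> simp [h]

/-- The machine has no multiplication, so the product with `n` is a sum over the reserved register
`90`; the conditions `≠ 90` below stem from this. -/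
theorem eval_cell_var {x y : ℕ} (hx : x ≠ 90) :
    (cell (var x) (var y)).eval A v = v 0 * v x + v y := by
  simp [cell, eval, update_of_ne hx]

/-! ### The formulas of the algorithm -/

def adjT (x y : ℕ) : Tm := load 0 (cell (var x) (var y))
def distT (x y : ℕ) : Tm := load 3 (cell (var x) (var y))
def labT (x : ℕ) : Tm := load 4 (var x)
def memT (e x : ℕ) : Tm := load 6 (cell (var e) (var x))

/-- The vertex `w` lies on a geodesic from `u` to `x`. -/
def geoT (u w x : ℕ) : Tm :=
  and (eq (add (distT u w) (distT w x)) (distT u x)) (lt (distT u x) (var 0))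

/-- The vertex `w` lies on a geodesic between two elements of a set. -/
def coverT (mem : ℕ → Tm) (w : ℕ) : Tm :=
  ex 20 0 (ex 21 0 (and (mem 20) (and (mem 21) (geoT 20 w 21))))

/-- The vertex `x` is an element of the set with the number `t` of representatives. -/
def bitT (t x : ℕ) : Tm :=
  ex 23 2 (ex 24 2 (and (lt (var 24) (load 7 (var x)))
    (eq (var t) (add (sum 25 23 (add (load 7 (var x)) (load 7 (var x))))
      (add (load 7 (var x)) (var 24))))))

/-- The vertex `x` belongs to the new block. -/
def inT (x : ℕ) : Tm := eq (labT x) (var 10)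

/-- The sets number `h` and `t` together cover the new block. -/
def coverBlockT (h t : ℕ) : Tm :=
  all 22 0 (imp (inT 22) (coverT (fun x => or (memT h x) (bitT t x)) 22))

/-- Equivalence of vertices as ends of geodesics to vertices outside a set. -/
def equivT (mem : ℕ → Tm) (u u' : ℕ) : Tm :=
  all 26 0 (all 27 0 (or (mem 26) (or (mem 27) (iff (geoT u 26 27) (geoT u' 26 27)))))

def simulatesT (g h : ℕ) : Tm :=
  all 28 0 (imp (memT g 28) (ex 29 0 (and (memT h 29) (equivT inT 28 29))))

def coverOuterT (g h : ℕ) : Tm :=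
  all 22 0 (or (inT 22) (imp (coverT (memT g) 22) (coverT (memT h) 22)))

/-- Unions are stored by adding entries, which may then exceed one; the double negation normalises
them. -/
def cardT (h : ℕ) : Tm := sum 30 0 (not (not (memT h 30)))

/-- The set number `g` of the new family is as good as the set number `h`. -/
def dominatesT (g h t : ℕ) : Tm :=
  and (eq (load 5 (var g)) (var 10)) (and (coverBlockT g t)
    (and (simulatesT h g) (and (coverOuterT h g) (le (cardT g) (cardT h)))))

/-- The candidate is not dominated. -/
def keepT : Tm :=
  ex 31 2 (and (coverBlockT 1 31) (all 32 1 (not (dominatesT 32 1 31))))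

def mergedT (u w x : ℕ) : Tm := or (eq (labT x) (labT u)) (eq (labT x) (labT w))

def boundaryT (u w x : ℕ) : Tm :=
  and (not (mergedT u w x)) (ex 22 0 (and (mergedT u w 22) (adjT x 22)))

def mergeableT (u w : ℕ) : Tm :=
  and (or (not (eq (labT u) (labT w))) (lt (labT u) (var 0)))
    (all 20 0 (all 21 0 (imp (boundaryT u w 20) (imp (boundaryT u w 21)
      (and (lt (labT 20) (var 0)) (or (eq (var 20) (var 21)) (adjT 20 21)))))))

/-- The vertex `x` is the first vertex of its equivalence class outside the new block. -/
def representativeT (x : ℕ) : Tm :=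
  and (not (inT x)) (all 28 0 (imp (lt (var 28) (var x))
    (or (inT 28) (not (equivT (fun x => not (inT x)) 28 x)))))

def geodeticT (e : ℕ) : Tm := all 22 0 (coverT (memT e) 22)

def optimalT (e : ℕ) : Tm :=
  and (geodeticT e) (all 35 1 (imp (geodeticT 35) (le (cardT e) (cardT 35))))

end Tm

namespace Cmd

open Tm

/-! ### The algorithm

Register `0` holds the order `n`, register `1` the number of stored sets, register `2` the number
of sets of representatives, register `3` loop limits, register `10` the label of the new block.
Array `3` holds the distances, array `4` the labels of the vertices, array `5` the labels of the
stored sets, array `6` their indicator vectors, array `7` powers of two. -/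

/-- The value `n` stands for "not reached"; the sum produces `0` on the diagonal and `n` elsewhere.
-/
def initDist : Cmd :=
  forTo 4 0 <| forTo 5 0 <| store 3 (cell (var 4) (var 5)) (sum 6 0 (not (eq (var 4) (var 5))))

/-- One round of breadth-first search from all vertices at once; register `6` holds the distance
being assigned. -/
def distRound : Cmd :=
  forTo 4 0 <| forTo 5 0 <|
    ite (and (eq (distT 4 5) (var 0))
      (ex 7 0 (and (eq (add (distT 4 7) (const 1)) (var 6)) (adjT 7 5))))
    (store 3 (cell (var 4) (var 5)) (var 6)) skip

/-- The initial family of the single vertex `k` consists of `∅`, stored as number `k`, and `{k}`,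
stored as number `n + k`. -/
def initHeap : Cmd :=
  forTo 4 0 <| seq (store 4 (var 4) (var 4)) <| seq (store 5 (var 4) (var 4)) <|
    seq (store 5 (add (var 0) (var 4)) (var 4)) <|
    store 6 (cell (add (var 0) (var 4)) (var 4)) (const 1)

def relabelBlock : Cmd :=
  forTo 4 0 <| ite (or (eq (labT 4) (var 11)) (eq (labT 4) (var 12)))
    (store 4 (var 4) (var 10)) skip

/-- Register `2` doubles at each representative, and array `7` receives its value before doubling;
so each representative gets its own bit, and other vertices get `0`. -/
def findRepresentatives : Cmd :=
  seq (assign 2 (const 1)) <| forTo 4 0 <|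
    seq (store 7 (var 4) (sum 5 2 (representativeT 4))) <|
    assign 2 (add (var 2) (load 7 (var 4)))

/-- The union is written to the first free slot; it is kept by advancing the counter, and otherwise
overwritten by the next candidate. -/
def tryCandidate : Cmd :=
  seq (forTo 4 0 <| store 6 (cell (var 1) (var 4)) (or (memT 16 4) (memT 17 4))) <|
  seq (store 5 (var 1) (var 10)) <|
  ite keepT (assign 1 (add (var 1) (const 1))) skip

def mergeFamilies : Cmd :=
  seq (assign 3 (var 1)) <| forTo 16 3 <| forTo 17 3 <|
    ite (and (eq (load 5 (var 16)) (var 11)) (eq (load 5 (var 17)) (var 12))) tryCandidate skip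

/-- In round number `st` the label of the new block is `n + st`, which is not yet in use. If the
search returns `n`, no pair is mergeable and nothing happens. -/
def mergeStep : Cmd :=
  seq (assign 10 (add (var 0) (var 15))) <|
  seq (assign 13 (least 40 41 0 fun x => ex 42 0 (mergeableT x 42))) <|
  ite (lt (var 13) (var 0))
    (seq (assign 14 (least 40 41 0 fun x => mergeableT 13 x)) <|
      seq (assign 11 (labT 13)) <| seq (assign 12 (labT 14)) <|
      seq relabelBlock <| seq findRepresentatives mergeFamilies)
    skip

def output : Cmd :=
  seq (assign 16 (least 40 41 1 optimalT)) <|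
  forTo 4 0 <| store 1 (var 4) (not (not (memT 16 4)))

/-- `2 * n` rounds suffice because `blockMeasure` starts at no more than that. -/
def minGeodetic : Cmd :=
  seq initDist <| seq (forTo 6 0 distRound) <| seq initHeap <| seq (assign 1 (add (var 0) (var 0))) <|
  seq (assign 3 (add (var 0) (var 0))) <| seq (forTo 15 3 mergeStep) output

theorem fits_minGeodetic : minGeodetic.fits 100 := by decide +kernel

end Cmd

end RAM

/-! ### The meaning of the formulas in a state that holds the graph -/

namespace RAM

open Function SimpleGraph

variable {n : ℕ} {G : SimpleGraph (Fin n)} {A : ℕ → ℕ → ℕ} {v : ℕ → ℕ}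

open Classical in
/-- The arrays `0` and `3` hold the adjacency matrix and the distance matrix of `G`. -/
structure HoldsGraph (G : SimpleGraph (Fin n)) (A : ℕ → ℕ → ℕ) : Prop where
  adj : ∀ i j : Fin n, A 0 (n * i + j) ≠ 0 ↔ G.Adj i j
  dist : ∀ i j : Fin n, A 3 (n * i + j) = if G.Reachable i j then G.dist i j else n

/-- The set number `e`. -/
def storedSet (n : ℕ) (A : ℕ → ℕ → ℕ) (e : ℕ) : Finset (Fin n) :=
  Finset.univ.filter fun x => A 6 (n * e + x) ≠ 0

/-- The set of representatives number `t`, of `p` sets. -/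
def bitSet (n : ℕ) (A : ℕ → ℕ → ℕ) (p t : ℕ) : Set (Fin n) :=
  {x | ∃ q < p, ∃ m < p, m < A 7 x ∧ t = q * (A 7 x + A 7 x) + (A 7 x + m)}

/-- The block of vertices with label `m`. -/
def block (n : ℕ) (A : ℕ → ℕ → ℕ) (m : ℕ) : Set (Fin n) := {x | A 4 x = m}

@[simp] theorem mem_storedSet {e : ℕ} {x : Fin n} :
    x ∈ storedSet n A e ↔ A 6 (n * e + x) ≠ 0 := by simp [storedSet]

theorem dist_lt_of_reachable {i j : Fin n} (h : G.Reachable i j) : G.dist i j < n := by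
  obtain ⟨p, hp, hl⟩ := h.exists_path_of_dist
  rw [← hl]
  simpa using hp.length_lt

/-- The set `S'` can replace the set `S` when the outside is represented by the set `T`. -/
def Dominates (G : SimpleGraph (Fin n)) (Q : Set (Fin n)) (T S S' : Finset (Fin n)) : Prop :=
  (∀ i ∈ Q, G.Covers (S' ∪ T) i) ∧ Simulates (G.InnerEquiv Q) S S' ∧
    (∀ i ∉ Q, G.Covers S i → G.Covers S' i) ∧ S'.card ≤ S.card

namespace Tm

theorem adjT_ne_zero (hG : HoldsGraph G A) (h0 : v 0 = n) {x y : ℕ} {i j : Fin n} (hx : v x = i)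
    (hy : v y = j) (hx' : x ≠ 90) : (adjT x y).eval A v ≠ 0 ↔ G.Adj i j := by
  rw [← hG.adj, adjT, eval, eval_cell_var hx', h0, hx, hy]

theorem eval_distT (h0 : v 0 = n) {x y : ℕ} (hx' : x ≠ 90) :
    (distT x y).eval A v = A 3 (n * v x + v y) := by
  rw [distT, eval, eval_cell_var hx', h0]

/-- The entry `n` marks unreachable pairs. Testing that the total distance is below `n` makes the
ends connected, and the equation then forces both pieces below `n` as well. -/
theorem geoT_ne_zero (hG : HoldsGraph G A) (h0 : v 0 = n) {x y z : ℕ} {i j k : Fin n}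
    (hx : v x = i) (hy : v y = j) (hz : v z = k) (hx' : x ≠ 90) (hy' : y ≠ 90) :
    (geoT x y z).eval A v ≠ 0 ↔ j ∈ G.geodesicInterval i k := by
  rw [geoT, and_ne_zero, eq_ne_zero, lt_ne_zero, mem_geodesicInterval_iff]
  simp only [eval, eval_distT h0 hx', eval_distT h0 hy', hx, hy, hz, hG.dist, h0]
  by_cases hik : G.Reachable i k
  · have h1 := dist_lt_of_reachable hik
    rw [if_pos hik]
    by_cases hij : G.Reachable i j
    · simp [hij, hij.symm.trans hik, h1]
    · rw [if_neg hij]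
      simp only [hij, false_and, iff_false, not_and]
      omega
  · rw [if_neg hik]
    simp only [lt_self_iff_false, and_false, false_iff, not_and]
    exact fun h h' => absurd (h.trans h') hik

theorem coverT_ne_zero (hG : HoldsGraph G A) (h0 : v 0 = n) {mem : ℕ → Tm} {x : ℕ} {i : Fin n}
    (hx : v x = i) (hx' : x ≠ 90 ∧ x ≠ 20 ∧ x ≠ 21) {M : Finset (Fin n)}
    (h1 : ∀ j k : Fin n, (mem 20).eval A (update (update v 20 j) 21 k) ≠ 0 ↔ j ∈ M)
    (h2 : ∀ j k : Fin n, (mem 21).eval A (update (update v 20 j) 21 k) ≠ 0 ↔ k ∈ M) :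
    (coverT mem x).eval A v ≠ 0 ↔ G.Covers M i := by
  rw [coverT, ex_fin_ne_zero h0, Covers]
  refine exists_congr fun j => ?_
  rw [ex_fin_ne_zero (by simpa using h0), ← exists_and_left]
  refine exists_congr fun k => ?_
  rw [and_ne_zero, and_ne_zero, h1, h2, geoT_ne_zero hG (by simpa using h0) (i := j) (j := i)
    (k := k) (by simp) (by simp [hx'.2, hx]) (by simp) (by simp) hx'.1]

theorem memT_ne_zero (h0 : v 0 = n) {e x : ℕ} (he : e ≠ 90) {i : Fin n} (hx : v x = i) :
    (memT e x).eval A v ≠ 0 ↔ i ∈ storedSet n A (v e) := by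
  rw [mem_storedSet, memT, eval, eval_cell_var he, h0, hx]

theorem bitT_ne_zero {t x : ℕ} (ht : t < 20 ∨ 25 < t) (hx : x < 23 ∨ 25 < x) {i : Fin n}
    (hxi : v x = i) : (bitT t x).eval A v ≠ 0 ↔ i ∈ bitSet n A (v 2) (v t) := by
  have h1 : x ≠ 23 := by omega
  have h2 : x ≠ 24 := by omega
  have h3 : x ≠ 25 := by omega
  have h4 : t ≠ 23 := by omega
  have h5 : t ≠ 24 := by omega
  rw [bitT, ex_ne_zero]
  refine exists_congr fun q => and_congr_right fun hq => ?_
  rw [ex_ne_zero]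
  refine exists_congr fun m => and_congr (by simp) ?_
  rw [and_ne_zero, lt_ne_zero, eq_ne_zero]
  simp [eval, h1, h2, h3, h4, h5, hxi]

theorem inT_ne_zero {x : ℕ} {i : Fin n} (hx : v x = i) :
    (inT x).eval A v ≠ 0 ↔ i ∈ block n A (v 10) := by
  rw [inT, eq_ne_zero, labT, eval, eval, eval, hx]; rfl

open Classical in
theorem coverBlockT_ne_zero (hG : HoldsGraph G A) (h0 : v 0 = n) {h t : ℕ}
    (hh : h < 20 ∨ 25 < h ∧ h ≠ 90) (ht : t < 20 ∨ 25 < t) :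
    (coverBlockT h t).eval A v ≠ 0 ↔ ∀ i ∈ block n A (v 10),
      G.Covers (storedSet n A (v h) ∪ (bitSet n A (v 2) (v t)).toFinset) i := by
  have h1 : h ≠ 20 ∧ h ≠ 21 ∧ h ≠ 22 ∧ h ≠ 90 := by omega
  have h2 : t ≠ 20 ∧ t ≠ 21 ∧ t ≠ 22 := by omega
  rw [coverBlockT, all_fin_ne_zero h0]
  refine forall_congr' fun i => ?_
  rw [imp_ne_zero, inT_ne_zero (i := i) (by simp)]
  refine imp_congr (by simp) ?_
  refine coverT_ne_zero hG (by simpa using h0) (by simp) (by simp) (fun j k => ?_) fun j k => ?_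
  · rw [or_ne_zero, memT_ne_zero (i := j) (by simpa using h0) h1.2.2.2 (by simp),
      bitT_ne_zero (i := j) ht (by simp) (by simp)]
    simp [h1, h2]
  · rw [or_ne_zero, memT_ne_zero (i := k) (by simpa using h0) h1.2.2.2 (by simp),
      bitT_ne_zero (i := k) ht (by simp) (by simp)]
    simp [h1, h2]

theorem equivT_ne_zero (hG : HoldsGraph G A) (h0 : v 0 = n) {mem : ℕ → Tm} {x y : ℕ} {i j : Fin n}
    (hxi : v x = i) (hyj : v y = j) (hx : x < 26 ∨ 27 < x ∧ x ≠ 90)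
    (hy : y < 26 ∨ 27 < y ∧ y ≠ 90) {Q : Set (Fin n)}
    (h1 : ∀ k : Fin n, (mem 26).eval A (update v 26 k) ≠ 0 ↔ k ∈ Q)
    (h2 : ∀ k l : Fin n, (mem 27).eval A (update (update v 26 k) 27 l) ≠ 0 ↔ l ∈ Q)
    (h3 : ∀ k l : Fin n, (mem 26).eval A (update (update v 26 k) 27 l) =
      (mem 26).eval A (update v 26 k)) :
    (equivT mem x y).eval A v ≠ 0 ↔ G.InnerEquiv Q i j := by
  have h4 : x ≠ 26 ∧ x ≠ 27 ∧ x ≠ 90 := by omega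
  have h5 : y ≠ 26 ∧ y ≠ 27 ∧ y ≠ 90 := by omega
  rw [equivT, all_fin_ne_zero h0]
  refine forall_congr' fun k => ?_
  rw [all_fin_ne_zero (by simpa using h0), ← forall_comm]
  refine forall_congr' fun l => ?_
  rw [or_ne_zero, or_ne_zero, h3, h1, h2, iff_ne_zero,
    geoT_ne_zero hG (by simpa using h0) (i := i) (j := k) (k := l) (by simp [h4, hxi]) (by simp)
      (by simp) h4.2.2 (by simp),
    geoT_ne_zero hG (by simpa using h0) (i := j) (j := k) (k := l) (by simp [h5, hyj]) (by simp)
      (by simp) h5.2.2 (by simp)]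
  tauto

theorem simulatesT_ne_zero (hG : HoldsGraph G A) (h0 : v 0 = n) {g h : ℕ}
    (hg : g < 20 ∨ 30 < g ∧ g ≠ 90) (hh : h < 20 ∨ 30 < h ∧ h ≠ 90) :
    (simulatesT g h).eval A v ≠ 0 ↔
      Simulates (G.InnerEquiv (block n A (v 10))) (storedSet n A (v g)) (storedSet n A (v h)) := by
  have h1 : g ≠ 28 ∧ g ≠ 90 := by omega
  have h2 : h ≠ 28 ∧ h ≠ 29 ∧ h ≠ 90 := by omega
  rw [simulatesT, all_fin_ne_zero h0, Simulates]
  refine forall_congr' fun i => ?_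
  rw [imp_ne_zero, memT_ne_zero (i := i) (by simpa using h0) h1.2 (by simp),
    ex_fin_ne_zero (by simpa using h0)]
  refine imp_congr (by simp [h1]) (exists_congr fun j => ?_)
  rw [and_ne_zero, memT_ne_zero (i := j) (by simpa using h0) h2.2.2 (by simp)]
  refine and_congr (by simp [h2]) ?_
  refine equivT_ne_zero hG (by simpa using h0) (by simp) (by simp) (by simp) (by simp)
    (fun k => ?_) (fun k l => ?_) fun k l => ?_
  · rw [inT_ne_zero (i := k) (by simp)]; simp
  · rw [inT_ne_zero (i := l) (by simp)]; simp
  · simp [inT, labT, eval, eq, le, not, and]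

theorem coverOuterT_ne_zero (hG : HoldsGraph G A) (h0 : v 0 = n) {g h : ℕ}
    (hg : g < 20 ∨ 30 < g ∧ g ≠ 90) (hh : h < 20 ∨ 30 < h ∧ h ≠ 90) :
    (coverOuterT g h).eval A v ≠ 0 ↔ ∀ i ∉ block n A (v 10),
      G.Covers (storedSet n A (v g)) i → G.Covers (storedSet n A (v h)) i := by
  have h1 : g ≠ 20 ∧ g ≠ 21 ∧ g ≠ 22 ∧ g ≠ 90 := by omega
  have h2 : h ≠ 20 ∧ h ≠ 21 ∧ h ≠ 22 ∧ h ≠ 90 := by omega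
  have key : ∀ (i : Fin n) (g : ℕ), g ≠ 20 ∧ g ≠ 21 ∧ g ≠ 22 ∧ g ≠ 90 →
      ((coverT (memT g) 22).eval A (update v 22 i) ≠ 0 ↔
        G.Covers (storedSet n A (v g)) i) := by
    intro i g hg
    refine coverT_ne_zero hG (by simpa using h0) (by simp) (by simp) (fun j k => ?_) fun j k => ?_
    · rw [memT_ne_zero (i := j) (by simpa using h0) hg.2.2.2 (by simp)]; simp [hg]
    · rw [memT_ne_zero (i := k) (by simpa using h0) hg.2.2.2 (by simp)]; simp [hg]
  rw [coverOuterT, all_fin_ne_zero h0]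
  refine forall_congr' fun i => ?_
  rw [or_ne_zero, imp_ne_zero, inT_ne_zero (i := i) (by simp), key i g h1, key i h h2,
    update_of_ne (by simp)]
  tauto

theorem eval_cardT (h0 : v 0 = n) {h : ℕ} (hh : h ≠ 30 ∧ h ≠ 90) :
    (cardT h).eval A v = (storedSet n A (v h)).card := by
  rw [cardT, eval, h0, storedSet, Finset.card_filter, Finset.sum_range]
  refine Finset.sum_congr rfl fun i _ => ?_
  have h1 := memT_ne_zero (A := A) (v := update v 30 i) (by simpa using h0) hh.2 (i := i)
    (x := 30) (by simp)
  rw [update_of_ne hh.1, mem_storedSet] at h1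
  rw [← if_congr h1 rfl rfl, eval_not, eval_not]
  split_ifs <;> simp_all

open Classical in
theorem keepT_ne_zero (hG : HoldsGraph G A) (h0 : v 0 = n) :
    keepT.eval A v ≠ 0 ↔ ∃ t < v 2,
      (∀ i ∈ block n A (v 10), G.Covers (storedSet n A (v 1) ∪ (bitSet n A (v 2) t).toFinset) i) ∧
      ∀ g < v 1, A 5 g = v 10 → ¬ Dominates G (block n A (v 10)) (bitSet n A (v 2) t).toFinset
        (storedSet n A (v 1)) (storedSet n A g) := by
  rw [keepT, ex_ne_zero]
  refine exists_congr fun t => and_congr_right fun ht => ?_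
  rw [and_ne_zero, coverBlockT_ne_zero hG (by simpa using h0) (by simp) (by simp), all_ne_zero]
  refine and_congr (by simp) (forall_congr' fun g => imp_congr (by simp) ?_)
  rw [not_ne_zero, ← not_not (a := _ = 0), ← ne_eq, dominatesT, and_ne_zero, and_ne_zero,
    and_ne_zero, and_ne_zero, eq_ne_zero, le_ne_zero,
    coverBlockT_ne_zero hG (by simpa using h0) (by simp) (by simp),
    simulatesT_ne_zero hG (by simpa using h0) (by simp) (by simp),
    coverOuterT_ne_zero hG (by simpa using h0) (by simp) (by simp),
    eval_cardT (n := n) (by simpa using h0) (by simp),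
    eval_cardT (n := n) (by simpa using h0) (by simp), Dominates]
  simp [eval]

theorem mergeableT_ne_zero (hG : HoldsGraph G A) (h0 : v 0 = n) {x y : ℕ} {i j : Fin n}
    (hxi : v x = i) (hyj : v y = j) (hx : x < 20 ∨ 22 < x) (hy : y < 20 ∨ 22 < y) :
    (mergeableT x y).eval A v ≠ 0 ↔ G.Mergeable n (fun k : Fin n => A 4 k) i j := by
  have h1 : x ≠ 20 ∧ x ≠ 21 ∧ x ≠ 22 := by omega
  have h2 : y ≠ 20 ∧ y ≠ 21 ∧ y ≠ 22 := by omega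
  have hm : ∀ (w : ℕ → ℕ) (z : ℕ) (k : Fin n), w x = i → w y = j → w z = k →
      ((mergedT x y z).eval A w ≠ 0 ↔ k ∈ mergedBlock (fun k : Fin n => A 4 k) i j) := by
    intro w z k hx hy hz
    rw [mergedT, or_ne_zero, eq_ne_zero, eq_ne_zero]
    simp [labT, eval, hx, hy, hz, mergedBlock]
  have hb : ∀ (w : ℕ → ℕ) (z : ℕ) (k : Fin n), w 0 = n → w x = i → w y = j → w z = k → z ≠ 22 →
      z ≠ 90 → ((boundaryT x y z).eval A w ≠ 0 ↔
        k ∈ G.outerBoundary (mergedBlock (fun k : Fin n => A 4 k) i j)) := by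
    intro w z k hw hx hy hz hz' hz''
    rw [boundaryT, and_ne_zero, not_ne_zero, ← not_not (a := _ = 0), ← ne_eq, hm w z k hx hy hz,
      ex_fin_ne_zero hw]
    refine and_congr_right fun _ => exists_congr fun l => ?_
    rw [and_ne_zero, hm _ 22 l (by simp [h1, hx]) (by simp [h2, hy]) (by simp),
      adjT_ne_zero hG (i := k) (j := l) (by simpa using hw) (by simp [hz', hz]) (by simp) hz'']
  rw [mergeableT, and_ne_zero, Mergeable]
  refine and_congr ?_ ?_
  · rw [or_ne_zero, not_ne_zero, ← not_not (a := _ = 0), ← ne_eq, eq_ne_zero, lt_ne_zero]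
    simp [labT, eval, hxi, hyj, h0]
  · rw [all_fin_ne_zero h0]
    have key : ∀ k : Fin n, (all 21 0 (imp (boundaryT x y 20) (imp (boundaryT x y 21)
        (and (lt (labT 20) (var 0)) (or (eq (var 20) (var 21)) (adjT 20 21)))))).eval A
        (update v 20 k) ≠ 0 ↔ ∀ l : Fin n,
          k ∈ G.outerBoundary (mergedBlock (fun k : Fin n => A 4 k) i j) →
          l ∈ G.outerBoundary (mergedBlock (fun k : Fin n => A 4 k) i j) →
          A 4 k < n ∧ (k = l ∨ G.Adj k l) := by
      intro k
      rw [all_fin_ne_zero (by simpa using h0)]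
      refine forall_congr' fun l => ?_
      rw [imp_ne_zero, imp_ne_zero, and_ne_zero, lt_ne_zero, or_ne_zero, eq_ne_zero,
        adjT_ne_zero hG (i := k) (j := l) (by simpa using h0) (by simp) (by simp) (by simp),
        hb _ 20 k (by simpa using h0) (by simp [h1, hxi]) (by simp [h2, hyj]) (by simp)
          (by simp) (by simp),
        hb _ 21 l (by simpa using h0) (by simp [h1, hxi]) (by simp [h2, hyj]) (by simp)
          (by simp) (by simp)]
      simp [labT, eval, h0, Fin.ext_iff]
    rw [forall_congr' key]
    -- The formula is stated for pairs; its diagonal `k = l` yields the condition on the labels.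
    constructor
    · exact fun H => ⟨fun k hk l hl hkl => (H k l hk hl).2.resolve_left hkl,
        fun k hk => (H k k hk hk).1⟩
    · exact fun H k l hk hl => ⟨H.2 k hk, or_iff_not_imp_left.mpr fun hkl => H.1 hk hl hkl⟩

theorem representativeT_ne_zero (hG : HoldsGraph G A) (h0 : v 0 = n) {x : ℕ} {i : Fin n}
    (hxi : v x = i) (hx : x < 20) :
    (representativeT x).eval A v ≠ 0 ↔ i ∉ block n A (v 10) ∧ ∀ j < i, j ∉ block n A (v 10) →
      ¬ G.OuterEquiv (block n A (v 10)) j i := by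
  have h1 : x ≠ 28 := by omega
  rw [representativeT, and_ne_zero, not_ne_zero, ← not_not (a := _ = 0), ← ne_eq,
    inT_ne_zero hxi, all_fin_ne_zero h0]
  refine and_congr_right fun _ => forall_congr' fun j => ?_
  rw [imp_ne_zero, lt_ne_zero, or_ne_zero, inT_ne_zero (i := j) (by simp), not_ne_zero,
    ← not_not (a := _ = 0), ← ne_eq, equivT_ne_zero hG (i := j) (j := i) (by simpa using h0)
    (by simp) (by simp [h1, hxi]) (by simp) (by omega) (Q := (block n A (v 10))ᶜ)
    (fun k => ?_) (fun k l => ?_) fun k l => ?_]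
  · simp [eval, hxi, h1, OuterEquiv]; tauto
  · rw [not_ne_zero, ← not_not (a := _ = 0), ← ne_eq, inT_ne_zero (i := k) (by simp)]; simp
  · rw [not_ne_zero, ← not_not (a := _ = 0), ← ne_eq, inT_ne_zero (i := l) (by simp)]; simp
  · simp [inT, labT, eval, eq, le, not, and]

theorem geodeticT_ne_zero (hG : HoldsGraph G A) (h0 : v 0 = n) {e : ℕ} (he : e < 20 ∨ 22 < e)
    (he' : e ≠ 90) : (geodeticT e).eval A v ≠ 0 ↔ G.IsGeodeticSet (storedSet n A (v e)) := by
  have h1 : e ≠ 20 ∧ e ≠ 21 ∧ e ≠ 22 := by omega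
  rw [geodeticT, all_fin_ne_zero h0]
  refine forall_congr' fun i => ?_
  refine (coverT_ne_zero hG (M := storedSet n A (v e)) (i := i) (by simpa using h0) (by simp)
    (by simp) (fun j k => ?_) fun j k => ?_).trans Iff.rfl
  · rw [memT_ne_zero (i := j) (by simpa using h0) he' (by simp)]; simp [h1]
  · rw [memT_ne_zero (i := k) (by simpa using h0) he' (by simp)]; simp [h1]

theorem optimalT_ne_zero (hG : HoldsGraph G A) (h0 : v 0 = n) {e : ℕ} (he : 35 < e)
    (he' : e ≠ 90) : (optimalT e).eval A v ≠ 0 ↔ G.IsGeodeticSet (storedSet n A (v e)) ∧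
      ∀ g < v 1, G.IsGeodeticSet (storedSet n A g) →
        (storedSet n A (v e)).card ≤ (storedSet n A g).card := by
  have h1 : e ≠ 35 := by omega
  rw [optimalT, and_ne_zero, geodeticT_ne_zero hG h0 (by omega) he', all_ne_zero]
  refine and_congr_right fun _ => forall₂_congr fun g _ => ?_
  rw [imp_ne_zero, le_ne_zero, geodeticT_ne_zero hG (by simpa using h0) (by simp) (by simp),
    eval_cardT (n := n) (by simpa using h0) (by omega),
    eval_cardT (n := n) (by simpa using h0) (by simp)]
  simp [h1]

end Tm

end RAM

/-! ### Representatives, bit vectors and the number of undominated sets -/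

namespace RAM

open Function SimpleGraph

variable {n : ℕ} {G : SimpleGraph (Fin n)}

/-- Bits can be tested with additions alone: `q` collects the bits above position `r`, and `m` those
below. -/
theorem exists_mul_add_iff_testBit (t r : ℕ) :
    (∃ q m, m < 2 ^ r ∧ t = q * (2 ^ r + 2 ^ r) + (2 ^ r + m)) ↔ t.testBit r := by
  rw [Nat.testBit_eq_decide_div_mod_eq, decide_eq_true_eq]
  have hpos : 0 < 2 ^ r := by positivity
  generalize 2 ^ r = p at *
  constructor
  · rintro ⟨q, m, hm, rfl⟩
    have : q * (p + p) + (p + m) = m + p * (2 * q + 1) := by ring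
    rw [this, Nat.add_mul_div_left _ _ hpos, Nat.div_eq_of_lt hm]
    omega
  · intro h
    refine ⟨t / p / 2, t % p, Nat.mod_lt _ hpos, ?_⟩
    have h1 := Nat.div_add_mod t p
    have h2 : t / p = 2 * (t / p / 2) + 1 := by omega
    conv_lhs => rw [← h1, h2]
    ring

/-- The number of elements of `R` before `x`. -/
def rank (R : Finset (Fin n)) (x : Fin n) : ℕ := (R.filter (· < x)).card

theorem rank_lt_rank {R : Finset (Fin n)} {x y : Fin n} (hx : x ∈ R) (hxy : x < y) :
    rank R x < rank R y := by
  refine Finset.card_lt_card ⟨fun z hz => ?_, fun h => ?_⟩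
  · rw [Finset.mem_filter] at hz ⊢
    exact ⟨hz.1, hz.2.trans hxy⟩
  · exact lt_irrefl x (Finset.mem_filter.mp (h (Finset.mem_filter.mpr ⟨hx, hxy⟩))).2

theorem rank_lt_card {R : Finset (Fin n)} {x : Fin n} (hx : x ∈ R) : rank R x < R.card :=
  Finset.card_lt_card ⟨Finset.filter_subset _ _, fun h =>
    lt_irrefl x (Finset.mem_filter.mp (h hx)).2⟩

theorem rank_injOn {R : Finset (Fin n)} {x y : Fin n} (hx : x ∈ R) (hy : y ∈ R)
    (h : rank R x = rank R y) : x = y := by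
  rcases lt_trichotomy x y with hxy | hxy | hxy
  · exact absurd h (rank_lt_rank hx hxy).ne
  · exact hxy
  · exact absurd h (rank_lt_rank hy hxy).ne'

theorem exists_bitSet_eq {A : ℕ → ℕ → ℕ} {R X : Finset (Fin n)} (hX : X ⊆ R)
    (hA : ∀ x : Fin n, A 7 x = if x ∈ R then 2 ^ rank R x else 0) :
    ∃ t < 2 ^ R.card, bitSet n A (2 ^ R.card) t = (X : Set (Fin n)) := by
  classical
  refine ⟨Nat.ofBits fun i : Fin R.card => decide (∃ x ∈ X, rank R x = i),
    Nat.ofBits_lt_two_pow _, Set.ext fun x => ?_⟩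
  have ht := Nat.ofBits_lt_two_pow fun i : Fin R.card => decide (∃ x ∈ X, rank R x = i)
  have hbit : ∀ i : Fin R.card, _ := fun i =>
    Nat.testBit_ofBits_lt (fun i : Fin R.card => decide (∃ x ∈ X, rank R x = i)) i i.2
  generalize Nat.ofBits (fun i : Fin R.card => decide (∃ x ∈ X, rank R x = i)) = t at *
  by_cases hx : x ∈ R
  · have h1 : x ∈ bitSet n A (2 ^ R.card) t ↔ t.testBit (rank R x) := by
      rw [← exists_mul_add_iff_testBit]
      have hA' : A 7 x = 2 ^ rank R x := by rw [hA, if_pos hx]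
      simp only [bitSet, Set.mem_ofPred_eq, hA']
      constructor
      · rintro ⟨q, -, m, -, h⟩
        exact ⟨q, m, h⟩
      · rintro ⟨q, m, hm, h⟩
        have hpos : 0 < 2 ^ rank R x := by positivity
        -- Neither `q` nor `m` exceeds `t`, so the bounded search of the formula misses nothing.
        refine ⟨q, ?_, m, ?_, hm, h⟩
        · nlinarith
        · have := Nat.zero_le (q * (2 ^ rank R x + 2 ^ rank R x)); omega
    rw [h1, hbit ⟨rank R x, rank_lt_card hx⟩, decide_eq_true_eq, Finset.mem_coe]
    constructor
    · rintro ⟨y, hy, hyx⟩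
      rwa [← rank_injOn (hX hy) hx hyx]
    · exact fun h => ⟨x, h, rfl⟩
  · constructor
    · rintro ⟨q, -, m, -, h, -⟩
      rw [hA, if_neg hx] at h
      omega
    · exact fun h => absurd (hX h) hx

/-- At most `τ` vertices in a clique and at most `τ` ways to see a clique. -/
def ProfileBound (G : SimpleGraph (Fin n)) (τ : ℕ) : Prop :=
  ∀ K : Set (Fin n), G.IsClique K → (Set.range (G.profile K)).ncard ≤ τ ∧ K.ncard ≤ τ

open Classical in
/-- The first vertices of the classes of equivalent vertices outside `Q`. -/
noncomputable def representatives (G : SimpleGraph (Fin n)) (Q : Set (Fin n)) : Finset (Fin n) :=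
  Finset.univ.filter fun i => i ∉ Q ∧ ∀ j < i, j ∉ Q → ¬ G.OuterEquiv Q j i

/-- Vertices with equal profiles are equivalent, so distinct representatives have distinct profiles.
-/
theorem card_representatives_le {τ : ℕ} (hτ : ProfileBound G τ) {Q : Set (Fin n)}
    (hK : G.IsClique (G.outerBoundary Q)) : (representatives G Q).card ≤ τ := by
  classical
  refine le_trans ?_ (hτ _ hK).1
  rw [Set.ncard_eq_toFinset_card (Set.range _) (Set.toFinite _)]
  refine Finset.card_le_card_of_injOn (G.profile (G.outerBoundary Q)) (fun x _ => by simp) ?_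
  intro x hx y hy hxy
  simp only [representatives, Finset.coe_filter, Finset.mem_univ, true_and] at hx hy
  rcases lt_trichotomy x y with h | h | h
  · exact absurd (outerEquiv_of_profile_eq hK hx.1 hy.1 hxy) (hy.2 x h hx.1)
  · exact h
  · exact absurd (outerEquiv_of_profile_eq hK hy.1 hx.1 hxy.symm) (hx.2 y h hy.1)

theorem exists_representative {Q : Set (Fin n)} {v : Fin n} (hv : v ∉ Q) :
    ∃ x ∈ representatives G Q, G.OuterEquiv Q v x := by
  classical
  obtain ⟨x, hx, hmin⟩ := Set.exists_min_image {x | x ∉ Q ∧ G.OuterEquiv Q v x} id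
    (Set.toFinite _) ⟨v, hv, InnerEquiv.refl _ _⟩
  refine ⟨x, ?_, hx.2⟩
  simp only [representatives, Finset.mem_filter, Finset.mem_univ, true_and]
  refine ⟨hx.1, fun j hj hjQ h => ?_⟩
  have : G.OuterEquiv Q v j := fun w hw u hu => (hx.2 w hw u hu).trans (h w hw u hu).symm
  exact absurd (hmin j ⟨hjQ, this⟩) (not_le.mpr hj)

/-- The sets of representatives represent all sets outside `Q`. -/
theorem exists_bitSet_simulates {A : ℕ → ℕ → ℕ} {Q : Set (Fin n)}
    (hA : ∀ x : Fin n, A 7 x =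
      if x ∈ representatives G Q then 2 ^ rank (representatives G Q) x else 0)
    {X : Finset (Fin n)} (hX : ∀ v ∈ X, v ∉ Q) :
    ∃ t < 2 ^ (representatives G Q).card, ∃ T : Finset (Fin n),
      bitSet n A (2 ^ (representatives G Q).card) t = T ∧ (∀ v ∈ T, v ∉ Q) ∧
      Simulates (G.OuterEquiv Q) X T ∧ Simulates (G.OuterEquiv Q) T X := by
  classical
  let T := (representatives G Q).filter fun x => ∃ v ∈ X, G.OuterEquiv Q v x
  obtain ⟨t, ht, htT⟩ := exists_bitSet_eq (X := T) (Finset.filter_subset _ _) hA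
  refine ⟨t, ht, T, htT, fun v hv => ?_, fun v hv => ?_, fun x hx => ?_⟩
  · have := (Finset.mem_filter.mp hv).1
    simp only [representatives, Finset.mem_filter] at this
    exact this.2.1
  · obtain ⟨x, hx, hvx⟩ := exists_representative (G := G) (hX v hv)
    exact ⟨x, Finset.mem_filter.mpr ⟨hx, v, hv, hvx⟩, hvx⟩
  · obtain ⟨v, hv, h⟩ := (Finset.mem_filter.mp hx).2
    exact ⟨v, hv, InnerEquiv.symm h⟩

/-- A sequence of pairwise undominated sets is short. -/
theorem card_le_of_undominated {τ : ℕ} (hτ : ProfileBound G τ) {Q : Set (Fin n)}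
    (hK : G.IsClique (G.outerBoundary Q)) {p m : ℕ} (S : ℕ → Finset (Fin n))
    (T : ℕ → Finset (Fin n)) (hS : ∀ h < m, ∀ v ∈ S h, v ∈ Q)
    (hdom : ∀ h < m, ∃ t < p, (∀ i ∈ Q, G.Covers (S h ∪ T t) i) ∧
      ∀ g < h, ¬ Dominates G Q (T t) (S h) (S g)) :
    m ≤ p * (2 ^ τ * (2 ^ τ * (n + 1))) := by
  classical
  choose! t htp hcov hnd using hdom
  let K := G.outerBoundary Q
  -- The type of a set: its guess, its profiles, the outside vertices it covers, its size. Of two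
  -- sets with equal type the earlier would dominate the later, so types are distinct; the four
  -- factors of the bound count the components.
  let F : ℕ → ℕ × Finset (Set (Fin n)) × Set (Fin n) × ℕ := fun h =>
    (t h, (S h).image (G.profile K), {w | w ∉ Q ∧ G.Covers (S h) w}, (S h).card)
  let P : Finset (Set (Fin n)) := Finset.univ.image (G.profile K)
  let D := Finset.range p ×ˢ P.powerset ×ˢ (Set.powerset K).toFinset ×ˢ Finset.range (n + 1)
  have hP : P.card ≤ τ := by
    have := (hτ K hK).1
    rwa [Set.ncard_eq_toFinset_card', Set.toFinset_range] at this
  have hC : (Set.powerset K).toFinset.card ≤ 2 ^ τ := by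
    rw [← Set.ncard_eq_toFinset_card', Set.ncard_powerset K (Set.toFinite _)]
    exact Nat.pow_le_pow_right (by omega) (hτ K hK).2
  have hD : D.card ≤ p * (2 ^ τ * (2 ^ τ * (n + 1))) := by
    simp only [D, Finset.card_product, Finset.card_range, Finset.card_powerset]
    have := Nat.pow_le_pow_right (n := 2) (by omega) hP
    gcongr
  refine le_trans ?_ hD
  rw [← Finset.card_range m]
  refine Finset.card_le_card_of_injOn F (fun h hh => ?_) ?_
  · have hh : h < m := by simpa using hh
    simp only [F, D, Finset.coe_product, Set.mem_prod, Finset.mem_coe, Finset.mem_range,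
      Finset.mem_powerset, Set.mem_toFinset, Set.mem_powerset_iff]
    refine ⟨htp h hh, Finset.image_subset_image (Finset.subset_univ _), ?_, ?_⟩
    · rintro w ⟨hw, u, hu, v, hv, huv⟩
      exact mem_outerBoundary_of_mem_geodesicInterval hK (hS h hh u hu) (hS h hh v hv) hw huv
    · have := Finset.card_le_univ (S h)
      rw [Fintype.card_fin] at this
      omega
  · have key : ∀ g h, g < h → h < m → F g ≠ F h := by
      intro g h hgh hh hF
      simp only [F, Prod.mk.injEq] at hF
      obtain ⟨h1, h2, h3, h4⟩ := hF
      refine hnd h hh g hgh ⟨h1 ▸ hcov g (hgh.trans hh), fun u hu => ?_, fun w hw hc => ?_,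
        h4.le⟩
      · have : G.profile K u ∈ (S g).image (G.profile K) := h2 ▸ Finset.mem_image_of_mem _ hu
        obtain ⟨u', hu', huu'⟩ := Finset.mem_image.mp this
        exact ⟨u', hu', innerEquiv_of_profile_eq hK (hS h hh u hu)
          (hS g (hgh.trans hh) u' hu') huu'.symm⟩
      · have : w ∈ {w | w ∉ Q ∧ G.Covers (S g) w} := h3 ▸ (⟨hw, hc⟩ : w ∈ {w | _ ∧ _})
        exact this.2
    intro g hg h hh hF
    have hg : g < m := by simpa using hg
    have hh : h < m := by simpa using hh
    rcases lt_trichotomy g h with hgh | hgh | hgh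
    · exact absurd hF (key g h hgh hh)
    · exact hgh
    · exact absurd hF.symm (key h g hgh hg)

end RAM

/-! ### Correctness of the distance computation -/

namespace RAM

open Function (update update_self update_of_ne)
open SimpleGraph

variable {n : ℕ} {G : SimpleGraph (Fin n)}

@[simp] theorem State.setVar_var (s : State) (x m : ℕ) : (s.setVar x m).var = update s.var x m :=
  rfl

@[simp] theorem State.setVar_arr (s : State) (x m : ℕ) : (s.setVar x m).arr = s.arr := rfl

@[simp] theorem State.setArr_var (s : State) (k a m : ℕ) : (s.setArr k a m).var = s.var := rfl

@[simp] theorem State.setArr_arr (s : State) (k a m : ℕ) :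
    (s.setArr k a m).arr = update s.arr k (update (s.arr k) a m) := rfl

/-- The states differ at most in the registers `X` and the arrays `K`. -/
structure Frame (X K : List ℕ) (s s' : State) : Prop where
  var : ∀ z ∉ X, s'.var z = s.var z
  arr : ∀ k ∉ K, s'.arr k = s.arr k

namespace Frame

variable {X K X' K' : List ℕ} {s s' s'' : State}

theorem refl (X K : List ℕ) (s : State) : Frame X K s s := ⟨fun _ _ => rfl, fun _ _ => rfl⟩

theorem setVar (h : Frame X K s s') {x m : ℕ} (hx : x ∈ X) : Frame X K s (s'.setVar x m) :=
  ⟨fun z hz => by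
    rw [State.setVar_var, update_of_ne (by rintro rfl; exact hz hx), h.var z hz], h.arr⟩

theorem setArr (h : Frame X K s s') {k a m : ℕ} (hk : k ∈ K) : Frame X K s (s'.setArr k a m) :=
  ⟨h.var, fun z hz => by
    rw [State.setArr_arr, update_of_ne (by rintro rfl; exact hz hk), h.arr z hz]⟩

theorem mono (h : Frame X K s s') (hX : X ⊆ X') (hK : K ⊆ K') : Frame X' K' s s' :=
  ⟨fun z hz => h.var z fun h => hz (hX h), fun z hz => h.arr z fun h => hz (hK h)⟩

theorem trans (h : Frame X K s s') (h' : Frame X K s' s'') : Frame X K s s'' :=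
  ⟨fun z hz => (h'.var z hz).trans (h.var z hz), fun z hz => (h'.arr z hz).trans (h.arr z hz)⟩

end Frame

theorem cell_inj {e e' : ℕ} {x x' : Fin n} : n * e + x = n * e' + x' ↔ e = e' ∧ x = x' := by
  constructor
  · intro h
    have hn : 0 < n := x.pos
    have h1 := congrArg (· % n) h
    have h2 := congrArg (· / n) h
    simp only [Nat.mul_add_mod, Nat.mod_eq_of_lt x.2, Nat.mod_eq_of_lt x'.2,
      Nat.mul_add_div hn, Nat.div_eq_of_lt x.2, Nat.div_eq_of_lt x'.2, add_zero] at h1 h2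
    exact ⟨h2, Fin.ext h1⟩
  · rintro ⟨rfl, rfl⟩; rfl

theorem HoldsGraph.congr {A A' : ℕ → ℕ → ℕ} (h : HoldsGraph G A) (h0 : A' 0 = A 0)
    (h3 : A' 3 = A 3) : HoldsGraph G A' :=
  ⟨fun i j => by rw [h0, h.adj], fun i j => by rw [h3, h.dist]⟩

namespace Cmd

open Tm

variable {B : ℕ} {s : State} {Q : State → Prop}

theorem wp_forTo_fin {x : ℕ} {c : Cmd} (hn : s.var 0 = n) (I : ℕ → State → Prop) (h0 : I 0 s)
    (hstep : ∀ (i : Fin n) s', I i s' → Wp B c (s'.setVar x i) (I (i + 1)))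
    (h : ∀ s', I n s' → Q s') : Wp B (forTo x 0 c) s Q :=
  wp_forTo I h0 (fun i hi s' => hstep ⟨i, hn ▸ hi⟩ s') (hn.symm ▸ h)

theorem wp_initDist (h0 : s.var 0 = n) : Wp B initDist s fun s' => Frame [4, 5] [3] s s' ∧
    ∀ a b : Fin n, s'.arr 3 (n * a + b) = if a = b then 0 else n := by
  refine wp_forTo_fin h0 (fun i s' => Frame [4, 5] [3] s s' ∧ ∀ a b : Fin n, a.val < i →
    s'.arr 3 (n * a + b) = if a = b then 0 else n) ⟨Frame.refl _ _ _, by simp⟩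
    (fun i s₁ ⟨hf, h⟩ => ?_) fun s' ⟨hf, h⟩ => ⟨hf, fun a b => h a b a.2⟩
  have h0' : s₁.var 0 = n := by rw [hf.var 0 (by simp), h0]
  refine wp_forTo_fin (by simpa using h0') (fun j s' => Frame [4, 5] [3] s s' ∧ s'.var 4 = i ∧
    ∀ a b : Fin n, a.val < i ∨ a = i ∧ b.val < j →
      s'.arr 3 (n * a + b) = if a = b then 0 else n)
    ⟨hf.setVar (by simp), by simp, fun a b hab => h a b (by simpa using hab)⟩
    (fun j s₂ hI => ?_) fun s' hI => ⟨hI.1, fun a b ha => hI.2.2 a b ?_⟩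
  · obtain ⟨hf, h4, h⟩ := hI
    have h0' : s₂.var 0 = n := by rw [hf.var 0 (by simp), h0]
    refine wp_store ⟨(hf.setVar (by simp)).setArr (by simp), by simpa using h4, fun a b hab => ?_⟩
    rw [eval_cell_var (by simp)]
    have hval : (sum 6 0 (not (eq (var 4) (var 5)))).eval (s₂.setVar 5 j).arr (s₂.setVar 5 j).var =
        if i = j then 0 else n := by
      have : ∀ k, (not (eq (var 4) (var 5))).eval (s₂.setVar 5 j).arr
          (update (s₂.setVar 5 j).var 6 k) = if i = j then 0 else 1 := by
        intro k
        rw [eval_not]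
        have := eq_ne_zero (A := s₂.arr) (v := update (s₂.setVar 5 j).var 6 k) (a := var 4)
          (b := var 5)
        simp only [eval, State.setVar_var, update_of_ne (show (4 : ℕ) ≠ 6 by simp),
          update_of_ne (show (4 : ℕ) ≠ 5 by simp), update_of_ne (show (5 : ℕ) ≠ 6 by simp),
          update_self, h4, Fin.val_inj] at this
        change (if (eq (var 4) (var 5)).eval s₂.arr (update (update s₂.var 5 j) 6 k) = 0
          then 1 else 0) = _
        by_cases hij : i = j
        · rw [if_neg (this.mpr hij), if_pos hij]
        · rw [if_pos (not_not.mp (mt this.mp hij)), if_neg hij]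
      rw [eval, Finset.sum_congr rfl fun k _ => this k]
      simp [h0']
    rw [hval]
    simp only [State.setArr_arr, State.setVar_arr, State.setVar_var, update_self,
      update_of_ne (show (0 : ℕ) ≠ 5 by simp), update_of_ne (show (4 : ℕ) ≠ 5 by simp), h0', h4]
    by_cases heq : a = i ∧ b = j
    · rw [heq.1, heq.2, update_self]
    · rw [update_of_ne (fun h => heq ((cell_inj.mp h).imp Fin.ext id))]
      refine h a b ?_
      rcases hab with hab | ⟨rfl, hab⟩
      · exact .inl hab
      · refine .inr ⟨rfl, ?_⟩
        have : b.val ≠ j.val := fun h => heq ⟨rfl, Fin.ext h⟩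
        omega
  · rcases Nat.lt_succ_iff_lt_or_eq.mp ha with h | h
    · exact .inl h
    · exact .inr ⟨Fin.ext h, b.2⟩

open Classical in
/-- The distances up to `r`; all others are replaced by `n`. -/
noncomputable def distUpTo (G : SimpleGraph (Fin n)) (r : ℕ) (a b : Fin n) : ℕ :=
  if G.Reachable a b ∧ G.dist a b ≤ r then G.dist a b else n

/-- Round `r` only looks for entries `r - 1`. These are the same before and after the update of a
cell, so updating in place is harmless; the mark `n` is never mistaken for one, as `r < n`. -/
theorem distUpTo_add_one_eq_iff {r m : ℕ} (hr : r < n) (hm : r ≤ m + 1) (a b : Fin n) :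
    distUpTo G m a b + 1 = r ↔ G.Reachable a b ∧ G.dist a b + 1 = r := by
  unfold distUpTo
  split_ifs with h
  · simp [h.1]
  · constructor
    · intro h; omega
    · exact fun h' => absurd ⟨h'.1, by omega⟩ h

theorem distUpTo_eq_iff {m : ℕ} (a b : Fin n) :
    distUpTo G m a b = n ↔ ¬ (G.Reachable a b ∧ G.dist a b ≤ m) := by
  unfold distUpTo
  split_ifs with h
  · have := dist_lt_of_reachable h.1
    simp [h]; omega
  · simp [h]

theorem dist_eq_iff_exists {r : ℕ} (a b : Fin n) (hr : 0 < r) :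
    (¬ (G.Reachable a b ∧ G.dist a b ≤ r - 1) ∧ ∃ c, (G.Reachable a c ∧ G.dist a c + 1 = r) ∧
      G.Adj c b) ↔ G.Reachable a b ∧ G.dist a b = r := by
  constructor
  · rintro ⟨h, c, ⟨h1, h2⟩, hcb⟩
    have h3 := h1.dist_triangle hcb.reachable
    rw [dist_eq_one_iff_adj.mpr hcb] at h3
    have h4 := h1.trans hcb.reachable
    exact ⟨h4, by by_contra hne; exact h ⟨h4, by omega⟩⟩
  · rintro ⟨h, hd⟩
    obtain ⟨p, hp⟩ := h.exists_walk_length_eq_dist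
    have hnil : ¬ p.Nil := by
      intro hnil
      have := Walk.length_eq_zero_iff.mpr hnil
      omega
    have hadj := p.adj_penultimate hnil
    have h1 : G.Reachable a p.penultimate := h.trans hadj.symm.reachable
    refine ⟨fun h => by omega, p.penultimate, ⟨h1, ?_⟩, hadj⟩
    have h2 := dist_le p.dropLast
    have h3 := h1.dist_triangle hadj.reachable
    rw [dist_eq_one_iff_adj.mpr hadj] at h3
    have h4 : p.dropLast.length + 1 = p.length := p.length_dropLast_add_one hnil
    omega

theorem wp_distRound (h0 : s.var 0 = n) (hadj : ∀ i j : Fin n, s.arr 0 (n * i + j) ≠ 0 ↔ G.Adj i j)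
    {r : ℕ} (hr : r < n) (h6 : s.var 6 = r)
    (hs : ∀ a b : Fin n, s.arr 3 (n * a + b) = distUpTo G (r - 1) a b) :
    Wp B distRound s fun s' => Frame [4, 5] [3] s s' ∧
      ∀ a b : Fin n, s'.arr 3 (n * a + b) = distUpTo G r a b := by
  refine wp_forTo_fin h0 (fun i s' => Frame [4, 5] [3] s s' ∧ ∀ a b : Fin n,
    s'.arr 3 (n * a + b) = distUpTo G (if a.val < i then r else r - 1) a b)
    ⟨Frame.refl _ _ _, by simpa using hs⟩
    (fun i s₁ ⟨hf, h⟩ => ?_) fun s' ⟨hf, h⟩ => ⟨hf, fun a b => by simpa using h a b⟩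
  have h0' : s₁.var 0 = n := by rw [hf.var 0 (by simp), h0]
  refine wp_forTo_fin (by simpa using h0') (fun j s' => Frame [4, 5] [3] s s' ∧ s'.var 4 = i ∧
    ∀ a b : Fin n, s'.arr 3 (n * a + b) =
      distUpTo G (if a.val < i ∨ a = i ∧ b.val < j then r else r - 1) a b)
    ⟨hf.setVar (by simp), by simp, fun a b => by simpa using h a b⟩
    (fun j s₂ hI => ?_) fun s' hI => ⟨hI.1, fun a b => ?_⟩
  · obtain ⟨hf, h4, h⟩ := hI
    have h0' : s₂.var 0 = n := by rw [hf.var 0 (by simp), h0]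
    have h6' : s₂.var 6 = r := by rw [hf.var 6 (by simp), h6]
    have hcond : (and (eq (distT 4 5) (var 0))
        (ex 7 0 (and (eq (add (distT 4 7) (const 1)) (var 6)) (adjT 7 5)))).eval
        (s₂.setVar 5 j).arr (s₂.setVar 5 j).var ≠ 0 ↔
        ¬ (G.Reachable i j ∧ G.dist i j ≤ r - 1) ∧
          ∃ c, (G.Reachable i c ∧ G.dist i c + 1 = r) ∧ G.Adj c j := by
      rw [and_ne_zero, eq_ne_zero, eval_distT (n := n) (by simpa using h0') (by simp),
        ex_fin_ne_zero (n := n) (by simpa using h0')]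
      refine and_congr ?_ (exists_congr fun c => ?_)
      · simp only [eval, State.setVar_var, State.setVar_arr, update_self,
          update_of_ne (show (0 : ℕ) ≠ 5 by simp), update_of_ne (show (4 : ℕ) ≠ 5 by simp),
          h0', h4]
        rw [h i j, distUpTo_eq_iff]
        simp
      · rw [and_ne_zero, eq_ne_zero]
        refine and_congr ?_ ?_
        · change eval _ (distT 4 7) _ + 1 = _ ↔ _
          rw [eval_distT (n := n) (by simpa using h0') (by simp)]
          simp only [eval, State.setVar_var, State.setVar_arr, update_self,
            update_of_ne (show (6 : ℕ) ≠ 5 by simp), update_of_ne (show (4 : ℕ) ≠ 5 by simp),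
            update_of_ne (show (6 : ℕ) ≠ 7 by simp), update_of_ne (show (4 : ℕ) ≠ 7 by simp),
            h6', h4]
          rw [h i c]
          exact distUpTo_add_one_eq_iff hr (by split_ifs <;> omega) i c
        · rw [adjT, eval, eval_cell_var (by simp)]
          simp only [State.setVar_var, State.setVar_arr, update_self, hf.arr 0 (by simp),
            update_of_ne (show (0 : ℕ) ≠ 5 by simp), update_of_ne (show (0 : ℕ) ≠ 7 by simp),
            update_of_ne (show (5 : ℕ) ≠ 7 by simp), h0']
          exact hadj c j
    have hstay : ¬ (G.Reachable i j ∧ G.dist i j = r ∧ 0 < r) → ∀ a b : Fin n,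
        s₂.arr 3 (n * a + b) =
        distUpTo G (if a.val < i ∨ a = i ∧ b.val < j + 1 then r else r - 1) a b := by
      intro hno a b
      rw [h a b]
      by_cases hab : a = i ∧ b = j
      · obtain ⟨rfl, rfl⟩ := hab
        simp only [lt_self_iff_false, and_false, or_self, if_false, Nat.lt_succ_self, and_self,
          or_true, if_true]
        have heq : (G.Reachable a b ∧ G.dist a b ≤ r - 1) ↔ (G.Reachable a b ∧ G.dist a b ≤ r) := by
          refine and_congr_right fun hr => ⟨fun h => by omega, fun h => ?_⟩
          by_contra hlt
          exact hno ⟨hr, by omega, by omega⟩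
        unfold distUpTo
        split_ifs with h1 h2 h2
        exacts [rfl, absurd (heq.mp h1) h2, absurd (heq.mpr h2) h1, rfl]
      · have : (a.val < i ∨ a = i ∧ b.val < j) ↔ (a.val < i ∨ a = i ∧ b.val < j + 1) := by
          refine or_congr_right (and_congr_right fun hai => ?_)
          have : b.val ≠ j.val := fun h => hab ⟨hai, Fin.ext h⟩
          omega
        rw [if_congr this rfl rfl]
    refine wp_ite (fun hc => wp_store ⟨(hf.setVar (by simp)).setArr (by simp), by simpa using h4,
      fun a b => ?_⟩) fun hc => wp_skip ⟨hf.setVar (by simp), by simpa using h4, ?_⟩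
    · rw [hcond] at hc
      have hrpos : 0 < r := by obtain ⟨-, c, ⟨-, h⟩, -⟩ := hc; omega
      have hc' := (dist_eq_iff_exists i j hrpos).mp hc
      rw [eval_cell_var (by simp)]
      simp only [eval, State.setArr_arr, State.setVar_arr, State.setVar_var, update_self,
        update_of_ne (show (0 : ℕ) ≠ 5 by simp), update_of_ne (show (4 : ℕ) ≠ 5 by simp),
        update_of_ne (show (6 : ℕ) ≠ 5 by simp), h0', h4, h6']
      by_cases hab : a = i ∧ b = j
      · obtain ⟨rfl, rfl⟩ := hab
        simp [distUpTo, hc'.1, hc'.2]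
      · rw [update_of_ne (fun h => hab ((cell_inj.mp h).imp Fin.ext id)), h a b]
        have : (a.val < i ∨ a = i ∧ b.val < j) ↔ (a.val < i ∨ a = i ∧ b.val < j + 1) := by
          refine or_congr_right (and_congr_right fun hai => ?_)
          have : b.val ≠ j.val := fun h => hab ⟨hai, Fin.ext h⟩
          omega
        rw [if_congr this rfl rfl]
    · rw [← not_not (a := _ = 0), ← ne_eq, hcond] at hc
      refine hstay fun h => hc ?_
      exact (dist_eq_iff_exists i j h.2.2).mpr ⟨h.1, h.2.1⟩
  · rw [hI.2.2 a b]
    have : (a.val < i ∨ a = i ∧ b.val < n) ↔ a.val < i + 1 := by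
      rw [Fin.ext_iff]
      have := b.2
      omega
    rw [if_congr this rfl rfl]

theorem wp_distances (h0 : s.var 0 = n)
    (hadj : ∀ i j : Fin n, s.arr 0 (n * i + j) ≠ 0 ↔ G.Adj i j) :
    Wp B (seq initDist (forTo 6 0 distRound)) s fun s' =>
      Frame [4, 5, 6] [3] s s' ∧ HoldsGraph G s'.arr := by
  refine wp_seq ((wp_initDist h0).mono fun s₁ ⟨hf, h⟩ => ?_)
  have hf := hf.mono (X' := [4, 5, 6]) (K' := [3]) (by simp) (by simp)
  -- Truncated subtraction makes the cases `r = 0` and `r = 1` coincide: round `0` changes nothing.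
  -- At the end `n - 1` bounds all finite distances.
  refine wp_forTo_fin (by rw [hf.var 0 (by simp), h0]) (fun r s' => Frame [4, 5, 6] [3] s s' ∧
    ∀ a b : Fin n, s'.arr 3 (n * a + b) = distUpTo G (r - 1) a b) ⟨hf, fun a b => ?_⟩
    (fun r s₂ hI => ?_) fun s' hI => ⟨hI.1, ⟨?_, fun a b => ?_⟩⟩
  · rw [h a b, distUpTo]
    by_cases hab : a = b
    · subst hab; simp
    · rw [if_neg hab, if_neg]
      rintro ⟨hr, hd⟩
      have := hr.pos_dist_of_ne hab
      omega
  · obtain ⟨hf₂, h₂⟩ := hI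
    refine (wp_distRound (G := G) (n := n) (r := r) ?_ ?_ r.2 (by simp) ?_).mono
      fun s' ⟨hf', h'⟩ => ⟨?_, fun a b => ?_⟩
    · simpa using (hf₂.var 0 (by simp)).trans h0
    · intro i j
      rw [State.setVar_arr, hf₂.arr 0 (by simp), hadj]
    · simpa using h₂
    · exact (hf₂.setVar (by simp)).trans (hf'.mono (by simp) (by simp))
    · simpa using h' a b
  · intro i j
    rw [hI.1.arr 0 (by simp), hadj]
  · rw [hI.2 a b, distUpTo]
    by_cases hr : G.Reachable a b
    · have := dist_lt_of_reachable hr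
      rw [if_pos ⟨hr, by omega⟩, if_pos hr]
    · rw [if_neg fun h => hr h.1, if_neg hr]

end Cmd

end RAM

/-! ### Correctness of initialisation, relabelling and the choice of representatives -/

namespace RAM

open Function (update update_self update_of_ne)
open SimpleGraph

variable {n : ℕ} {G : SimpleGraph (Fin n)} {A A' : ℕ → ℕ → ℕ}

theorem storedSet_congr {e e' : ℕ} (h : ∀ x : Fin n, A' 6 (n * e' + x) = A 6 (n * e + x)) :
    storedSet n A' e' = storedSet n A e := by
  ext x
  simp [h x]

theorem bitSet_congr (h : A' 7 = A 7) (p t : ℕ) : bitSet n A' p t = bitSet n A p t := by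
  simp only [bitSet, h]

theorem block_congr (h : A' 4 = A 4) (m : ℕ) : block n A' m = block n A m := by
  simp only [block, h]

theorem mem_representatives {Q : Set (Fin n)} {i : Fin n} : i ∈ representatives G Q ↔
    i ∉ Q ∧ ∀ j < i, j ∉ Q → ¬ G.OuterEquiv Q j i := by
  simp [representatives]

theorem card_filter_lt_add_one {R : Finset (Fin n)} {i : ℕ} (hi : i < n) :
    (R.filter fun y : Fin n => y.val < i + 1).card =
      (R.filter fun y : Fin n => y.val < i).card + if (⟨i, hi⟩ : Fin n) ∈ R then 1 else 0 := by
  have : R.filter (fun y => y.val < i + 1) =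
      R.filter (fun y => y.val < i) ∪ R.filter (· = ⟨i, hi⟩) := by
    rw [← Finset.filter_or]
    refine Finset.filter_congr fun y _ => ?_
    rw [Fin.ext_iff, Nat.lt_succ_iff_lt_or_eq]
  rw [this, Finset.card_union_of_disjoint, Finset.filter_eq']
  · split_ifs <;> simp
  · rw [Finset.disjoint_filter]
    rintro y - h rfl
    exact lt_irrefl _ h

namespace Cmd

open Tm

variable {B : ℕ} {s : State} {Q : State → Prop}

theorem wp_initHeap (h0 : s.var 0 = n) (h6 : ∀ a, s.arr 6 a = 0) :
    Wp B initHeap s fun s' => Frame [4] [4, 5, 6] s s' ∧ ∀ k : Fin n, s'.arr 4 k = k ∧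
      s'.arr 5 k = k ∧ s'.arr 5 (n + k) = k ∧ storedSet n s'.arr k = ∅ ∧
      storedSet n s'.arr (n + k) = {k} := by
  refine wp_forTo_fin h0 (fun i s' => Frame [4] [4, 5, 6] s s' ∧
    (∀ k : Fin n, k.val < i → s'.arr 4 k = k ∧ s'.arr 5 k = k ∧ s'.arr 5 (n + k) = k) ∧
    (∀ e, ∀ x : Fin n, s'.arr 6 (n * e + x) = if e = n + x ∧ x.val < i then 1 else 0))
    ⟨Frame.refl _ _ _, by simp, by simp [h6]⟩ (fun i s₁ hI => ?_) fun s' hI => ⟨hI.1, fun k => ?_⟩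
  · obtain ⟨hf, h, hs⟩ := hI
    have h0' : s₁.var 0 = n := by rw [hf.var 0 (by simp), h0]
    refine wp_seq (wp_store (wp_seq (wp_store (wp_seq (wp_store (wp_store
      ⟨((((hf.setVar (by simp)).setArr (by simp)).setArr (by simp)).setArr (by simp)).setArr
        (by simp), fun k hk => ?_, fun e x => ?_⟩))))))
    · simp only [cell, eval, State.setArr_arr, State.setVar_arr, State.setArr_var,
        State.setVar_var, update_self, update_of_ne (show (0 : ℕ) ≠ 4 by simp),
        update_of_ne (show (4 : ℕ) ≠ 6 by simp), update_of_ne (show (4 : ℕ) ≠ 5 by simp),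
        update_of_ne (show (5 : ℕ) ≠ 6 by simp), update_of_ne (show (5 : ℕ) ≠ 4 by simp), h0']
      by_cases hki : k = i
      · subst hki
        have : k.val ≠ n + k := by have := k.2; omega
        rw [update_self, update_of_ne this, update_self, update_self]
        simp
      · have h1 : k.val ≠ i := fun h => hki (Fin.ext h)
        have h2 : k.val ≠ n + i := by have := k.2; omega
        have h3 : n + k.val ≠ i := by have := i.2; omega
        have h4 : n + k.val ≠ n + i := by omega
        rw [update_of_ne h1, update_of_ne h2, update_of_ne h1, update_of_ne h4, update_of_ne h3]
        exact h k (by omega)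
    · simp only [cell, eval, State.setArr_arr, State.setVar_arr, State.setArr_var,
        State.setVar_var, update_self, update_of_ne (show (0 : ℕ) ≠ 4 by simp),
        update_of_ne (show (0 : ℕ) ≠ 90 by simp), update_of_ne (show (4 : ℕ) ≠ 90 by simp),
        update_of_ne (show (6 : ℕ) ≠ 4 by simp), update_of_ne (show (6 : ℕ) ≠ 5 by simp), h0',
        Finset.sum_const, Finset.card_range, smul_eq_mul]
      by_cases hx : e = n + i ∧ x = i
      · rw [hx.1, hx.2, update_self]
        simp
      · rw [update_of_ne (fun h => hx (cell_inj.mp h)), hs e x]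
        refine if_congr (and_congr_right fun he => ?_) rfl rfl
        have : x.val ≠ i := fun h => hx ⟨by omega, Fin.ext h⟩
        omega
  · obtain ⟨-, h, hs⟩ := hI
    refine ⟨(h k k.2).1, (h k k.2).2.1, (h k k.2).2.2, ?_, ?_⟩
    · ext x
      have := k.2
      rw [mem_storedSet, hs]
      simp; omega
    · ext x
      rw [mem_storedSet, hs]
      simp [Fin.ext_iff, eq_comm]

theorem wp_relabelBlock (h0 : s.var 0 = n) {i j : Fin n} (h11 : s.var 11 = s.arr 4 i)
    (h12 : s.var 12 = s.arr 4 j) :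
    Wp B relabelBlock s fun s' => Frame [4] [4] s s' ∧ ∀ k : Fin n,
      s'.arr 4 k = SimpleGraph.relabel (fun k : Fin n => s.arr 4 k) i j (s.var 10) k := by
  refine wp_forTo_fin h0 (fun m s' => Frame [4] [4] s s' ∧ ∀ k : Fin n, s'.arr 4 k =
    if k.val < m then SimpleGraph.relabel (fun k : Fin n => s.arr 4 k) i j (s.var 10) k
    else s.arr 4 k) ⟨Frame.refl _ _ _, by simp⟩ (fun m s₁ hI => ?_)
    fun s' hI => ⟨hI.1, fun k => by rw [hI.2 k, if_pos k.2]⟩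
  obtain ⟨hf, h⟩ := hI
  have hc : (or (eq (labT 4) (var 11)) (eq (labT 4) (var 12))).eval (s₁.setVar 4 m).arr
      (s₁.setVar 4 m).var ≠ 0 ↔ s.arr 4 m = s.arr 4 i ∨ s.arr 4 m = s.arr 4 j := by
    rw [or_ne_zero, eq_ne_zero, eq_ne_zero]
    simp only [labT, eval, State.setVar_arr, State.setVar_var, update_self,
      update_of_ne (show (11 : ℕ) ≠ 4 by simp), update_of_ne (show (12 : ℕ) ≠ 4 by simp),
      hf.var 11 (by simp), hf.var 12 (by simp), h11, h12, h m, lt_irrefl, if_false]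
  refine wp_ite (fun h' => wp_store ⟨(hf.setVar (by simp)).setArr (by simp), fun k => ?_⟩)
    fun h' => wp_skip ⟨hf.setVar (by simp), fun k => ?_⟩
  · rw [hc] at h'
    simp only [eval, State.setArr_arr, State.setVar_arr, State.setVar_var, update_self,
      update_of_ne (show (10 : ℕ) ≠ 4 by simp), hf.var 10 (by simp)]
    by_cases hkm : k = m
    · subst hkm
      rw [update_self, if_pos (by omega)]
      exact (if_pos (show k ∈ mergedBlock (fun k : Fin n => s.arr 4 k) i j from h')).symm
    · have : k.val ≠ m := fun h => hkm (Fin.ext h)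
      rw [update_of_ne this, h k]
      exact if_congr (by omega) rfl rfl
  · rw [← not_not (a := _ = 0), ← ne_eq, hc] at h'
    rw [State.setVar_arr, h k]
    by_cases hkm : k = m
    · subst hkm
      rw [if_neg (by omega), if_pos (by omega)]
      exact (if_neg (show k ∉ mergedBlock (fun k : Fin n => s.arr 4 k) i j from h')).symm
    · have : k.val ≠ m := fun h => hkm (Fin.ext h)
      exact if_congr (by omega) rfl rfl

theorem wp_findRepresentatives (h0 : s.var 0 = n) (hG : HoldsGraph G s.arr)
    (hB : 2 ^ (representatives G (block n s.arr (s.var 10))).card ≤ B) :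
    Wp B findRepresentatives s fun s' => Frame [2, 4] [7] s s' ∧
      s'.var 2 = 2 ^ (representatives G (block n s.arr (s.var 10))).card ∧
      ∀ x : Fin n, s'.arr 7 x = if x ∈ representatives G (block n s.arr (s.var 10)) then
        2 ^ rank (representatives G (block n s.arr (s.var 10))) x else 0 := by
  set R := representatives G (block n s.arr (s.var 10)) with hR
  have hB1 : 1 ≤ B := Nat.one_le_two_pow.trans hB
  refine wp_seq (wp_assign (fun _ => by simpa [eval] using hB1) ?_)
  refine wp_forTo_fin (by simpa [eval] using h0) (fun i s' => Frame [2, 4] [7] s s' ∧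
      s'.var 2 = 2 ^ (R.filter fun y : Fin n => y.val < i).card ∧
      ∀ x : Fin n, x.val < i → s'.arr 7 x = if x ∈ R then 2 ^ rank R x else 0)
    ⟨(Frame.refl _ _ _).setVar (by simp), by simp [eval], by simp⟩ (fun i s₁ hI => ?_)
    fun s' hI => ⟨hI.1, ?_, fun x => hI.2.2 x x.2⟩
  · obtain ⟨hf, h2, h7⟩ := hI
    have h0' : s₁.var 0 = n := by rw [hf.var 0 (by simp), h0]
    have hval : (sum 5 2 (representativeT 4)).eval (s₁.setVar 4 i).arr (s₁.setVar 4 i).var =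
        if i ∈ R then 2 ^ rank R i else 0 := by
      have hG' : HoldsGraph G s₁.arr := hG.congr (hf.arr 0 (by simp)) (hf.arr 3 (by simp))
      have key : ∀ k, (representativeT 4).eval s₁.arr (update (update s₁.var 4 i) 5 k) ≠ 0 ↔
          i ∈ R := by
        intro k
        rw [representativeT_ne_zero (i := i) hG' (by simpa using h0') (by simp) (by simp)]
        rw [hR, mem_representatives]
        simp only [update_of_ne (show (10 : ℕ) ≠ 5 by simp),
          update_of_ne (show (10 : ℕ) ≠ 4 by simp), hf.var 10 (by simp),
          block_congr (hf.arr 4 (by simp))]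
      have key' : ∀ k, (representativeT 4).eval s₁.arr (update (update s₁.var 4 i) 5 k) =
          if i ∈ R then 1 else 0 := by
        intro k
        have h1 := key k
        have h2 : (representativeT 4).eval s₁.arr (update (update s₁.var 4 i) 5 k) ≤ 1 := by
          rw [representativeT, Tm.and, eval_not]
          split_ifs <;> simp
        split_ifs with h
        · have := h1.mpr h; omega
        · by_contra hne; exact h (h1.mp hne)
      change ∑ k ∈ Finset.range (update s₁.var 4 i.val 2), (representativeT 4).eval s₁.arr
        (update (update s₁.var 4 i) 5 k) = _
      rw [Finset.sum_congr rfl fun k _ => key' k]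
      simp only [ update_of_ne (show (2 : ℕ) ≠ 4 by simp), h2,
        Finset.sum_const, Finset.card_range, smul_eq_mul]
      rw [mul_ite, mul_one, mul_zero]
      rfl
    have hpow : 2 ^ (R.filter fun y : Fin n => y.val < i).card + (if i ∈ R then 2 ^ rank R i else 0) =
        2 ^ (R.filter fun y : Fin n => y.val < i + 1).card := by
      rw [card_filter_lt_add_one i.2]
      split_ifs
      · rw [pow_succ, mul_two]; rfl
      · simp
    have hval' : (add (var 2) (load 7 (var 4))).eval
        ((s₁.setVar 4 i).setArr 7 i (if i ∈ R then 2 ^ rank R i else 0)).arr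
        ((s₁.setVar 4 i).setArr 7 i (if i ∈ R then 2 ^ rank R i else 0)).var =
        2 ^ (R.filter fun y : Fin n => y.val < i + 1).card := by
      rw [← hpow]
      simp [eval, h2]
    have h4 : (var 4).eval (s₁.setVar 4 i).arr (s₁.setVar 4 i).var = i := by simp [eval]
    refine wp_seq (wp_store ?_)
    rw [hval, h4]
    refine wp_assign (fun _ => ?_) ⟨((hf.setVar (by simp)).setArr (by simp)).setVar (by simp),
      ?_, fun x hx => ?_⟩
    · rw [hval']
      exact (Nat.pow_le_pow_right (by simp) (Finset.card_filter_le _ _)).trans hB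
    · rw [hval', State.setVar_var, update_self]
    · rw [State.setVar_arr, State.setArr_arr, update_self]
      by_cases hxi : x = i
      · rw [hxi, update_self]
      · have : x.val ≠ i := fun h => hxi (Fin.ext h)
        rw [update_of_ne this]
        exact h7 x (by omega)
  · rw [hI.2.1, Finset.filter_true_of_mem fun y _ => y.2]

end Cmd

end RAM

/-! ### Merging the families of two blocks -/

namespace RAM

open Function (update update_self update_of_ne)
open SimpleGraph

variable {n : ℕ} {G : SimpleGraph (Fin n)}

theorem Dominates.self {Q : Set (Fin n)} {S T : Finset (Fin n)}
    (h : ∀ i ∈ Q, G.Covers (S ∪ T) i) : Dominates G Q T S S :=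
  ⟨h, fun u hu => ⟨u, hu, InnerEquiv.refl _ _⟩, fun _ _ h => h, le_rfl⟩

open Classical in
/-- The set of representatives with the number `t`. -/
noncomputable def guess (n : ℕ) (s : State) (t : ℕ) : Finset (Fin n) :=
  (bitSet n s.arr (s.var 2) t).toFinset

/-- While the families of two blocks are merged, starting in the state `s₀`: the stored sets from
`s₀.var 1` on are subsets of the new block, none of them is dominated by an earlier one, and they
dominate the unions of the pairs of sets that are done. -/
structure Merging (G : SimpleGraph (Fin n)) (s₀ : State) (done : ℕ → ℕ → Prop) (s : State) :
    Prop where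
  frame : Frame [1, 4, 16, 17] [5, 6] s₀ s
  le : s₀.var 1 ≤ s.var 1
  owner_of_lt : ∀ g < s₀.var 1, s.arr 5 g = s₀.arr 5 g
  stored_of_lt : ∀ g < s₀.var 1, storedSet n s.arr g = storedSet n s₀.arr g
  owner : ∀ g, s₀.var 1 ≤ g → g < s.var 1 → s.arr 5 g = s₀.var 10
  subset : ∀ g, s₀.var 1 ≤ g → g < s.var 1 → ∀ x ∈ storedSet n s.arr g,
    x ∈ block n s₀.arr (s₀.var 10)
  undominated : ∀ g, s₀.var 1 ≤ g → g < s.var 1 → ∃ t < s₀.var 2,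
    (∀ i ∈ block n s₀.arr (s₀.var 10), G.Covers (storedSet n s.arr g ∪ guess n s₀ t) i) ∧
    ∀ g', s₀.var 1 ≤ g' → g' < g → ¬ Dominates G (block n s₀.arr (s₀.var 10)) (guess n s₀ t)
      (storedSet n s.arr g) (storedSet n s.arr g')
  dominated : ∀ e f, done e f → ∀ t < s₀.var 2,
    (∀ i ∈ block n s₀.arr (s₀.var 10),
      G.Covers (storedSet n s₀.arr e ∪ storedSet n s₀.arr f ∪ guess n s₀ t) i) →
    ∃ g, s₀.var 1 ≤ g ∧ g < s.var 1 ∧ Dominates G (block n s₀.arr (s₀.var 10)) (guess n s₀ t)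
      (storedSet n s₀.arr e ∪ storedSet n s₀.arr f) (storedSet n s.arr g)

namespace Merging

variable {s₀ s s' : State} {done done' : ℕ → ℕ → Prop}

theorem init (G : SimpleGraph (Fin n)) (s₀ : State) : Merging G s₀ (fun _ _ => False) s₀ :=
  ⟨Frame.refl _ _ _, le_rfl, fun _ _ => rfl, fun _ _ => rfl, fun g h h' => absurd h' (by omega),
    fun g h h' => absurd h' (by omega), fun g h h' => absurd h' (by omega), fun _ _ h => h.elim⟩

theorem mono (h : Merging G s₀ done s) (hd : ∀ e f, done' e f → done e f) :
    Merging G s₀ done' s :=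
  { h with dominated := fun e f hef => h.dominated e f (hd e f hef) }

theorem congr (h : Merging G s₀ done s) (hf : Frame [1, 4, 16, 17] [5, 6] s₀ s')
    (h1 : s'.var 1 = s.var 1) (h5 : ∀ g < s.var 1, s'.arr 5 g = s.arr 5 g)
    (h6 : ∀ g < s.var 1, storedSet n s'.arr g = storedSet n s.arr g) :
    Merging G s₀ done s' where
  frame := hf
  le := h1 ▸ h.le
  owner_of_lt g hg := (h5 g (hg.trans_le h.le)).trans (h.owner_of_lt g hg)
  stored_of_lt g hg := (h6 g (hg.trans_le h.le)).trans (h.stored_of_lt g hg)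
  owner g hg hg' := by rw [h1] at hg'; rw [h5 g hg', h.owner g hg hg']
  subset g hg hg' := by rw [h1] at hg'; rw [h6 g hg']; exact h.subset g hg hg'
  undominated g hg hg' := by
    rw [h1] at hg'
    obtain ⟨t, ht, hc, hd⟩ := h.undominated g hg hg'
    refine ⟨t, ht, by rwa [h6 g hg'], fun g' hg₀ hlt => ?_⟩
    rw [h6 g hg', h6 g' (hlt.trans hg')]
    exact hd g' hg₀ hlt
  dominated e f hef t ht hc := by
    obtain ⟨g, hg, hg', hd⟩ := h.dominated e f hef t ht hc
    exact ⟨g, hg, by rwa [h1], by rwa [h6 g hg']⟩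

theorem setVar (h : Merging G s₀ done s) {x m : ℕ} (hx : x ∈ [4, 16, 17]) :
    Merging G s₀ done (s.setVar x m) := by
  refine h.congr (h.frame.setVar (by simp_all)) ?_ (fun _ _ => rfl) (fun _ _ => rfl)
  rw [State.setVar_var, update_of_ne]
  rintro rfl
  simp at hx

/-- Discarding a candidate. -/
theorem discard (h : Merging G s₀ done s) {e f : ℕ}
    (hdom : ∀ t < s₀.var 2, (∀ i ∈ block n s₀.arr (s₀.var 10),
      G.Covers (storedSet n s₀.arr e ∪ storedSet n s₀.arr f ∪ guess n s₀ t) i) →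
      ∃ g < s.var 1, s₀.var 1 ≤ g ∧ Dominates G (block n s₀.arr (s₀.var 10)) (guess n s₀ t)
        (storedSet n s₀.arr e ∪ storedSet n s₀.arr f) (storedSet n s.arr g)) :
    Merging G s₀ (fun e' f' => done e' f' ∨ e' = e ∧ f' = f) s :=
  { h with
    dominated := by
      rintro e' f' (hd | ⟨rfl, rfl⟩) t ht hc
      · exact h.dominated e' f' hd t ht hc
      · obtain ⟨g, hg, hg', hd⟩ := hdom t ht hc
        exact ⟨g, hg', hg, hd⟩ }

/-- Keeping a candidate. -/
theorem keep (h : Merging G s₀ done s) {e f : ℕ} (he : e < s₀.var 1) (hf : f < s₀.var 1)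
    (hfr : Frame [1, 4, 16, 17] [5, 6] s₀ s') (h1 : s'.var 1 = s.var 1 + 1)
    (h5 : ∀ g < s.var 1, s'.arr 5 g = s.arr 5 g)
    (h6 : ∀ g < s.var 1, storedSet n s'.arr g = storedSet n s.arr g)
    (h5' : s'.arr 5 (s.var 1) = s₀.var 10)
    (h6' : storedSet n s'.arr (s.var 1) = storedSet n s₀.arr e ∪ storedSet n s₀.arr f)
    (hsub : ∀ x ∈ storedSet n s₀.arr e ∪ storedSet n s₀.arr f, x ∈ block n s₀.arr (s₀.var 10))
    (hund : ∃ t < s₀.var 2, (∀ i ∈ block n s₀.arr (s₀.var 10),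
      G.Covers (storedSet n s₀.arr e ∪ storedSet n s₀.arr f ∪ guess n s₀ t) i) ∧
      ∀ g < s.var 1, s₀.var 1 ≤ g → ¬ Dominates G (block n s₀.arr (s₀.var 10)) (guess n s₀ t)
        (storedSet n s₀.arr e ∪ storedSet n s₀.arr f) (storedSet n s.arr g)) :
    Merging G s₀ (fun e' f' => done e' f' ∨ e' = e ∧ f' = f) s' where
  frame := hfr
  le := by have := h.le; omega
  owner_of_lt g hg := (h5 g (hg.trans_le h.le)).trans (h.owner_of_lt g hg)
  stored_of_lt g hg := (h6 g (hg.trans_le h.le)).trans (h.stored_of_lt g hg)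
  owner g hg hg' := by
    rw [h1] at hg'
    rcases Nat.lt_succ_iff_lt_or_eq.mp hg' with hlt | rfl
    · rw [h5 g hlt, h.owner g hg hlt]
    · exact h5'
  subset g hg hg' := by
    rw [h1] at hg'
    rcases Nat.lt_succ_iff_lt_or_eq.mp hg' with hlt | rfl
    · rw [h6 g hlt]; exact h.subset g hg hlt
    · rwa [h6']
  undominated g hg hg' := by
    rw [h1] at hg'
    rcases Nat.lt_succ_iff_lt_or_eq.mp hg' with hlt | rfl
    · obtain ⟨t, ht, hc, hd⟩ := h.undominated g hg hlt
      refine ⟨t, ht, by rwa [h6 g hlt], fun g' hg₀ hlt' => ?_⟩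
      rw [h6 g hlt, h6 g' (hlt'.trans hlt)]
      exact hd g' hg₀ hlt'
    · obtain ⟨t, ht, hc, hd⟩ := hund
      refine ⟨t, ht, by rwa [h6'], fun g' hg₀ hlt' => ?_⟩
      rw [h6', h6 g' hlt']
      exact hd g' hlt' hg₀
  dominated := by
    rintro e' f' (hd | ⟨rfl, rfl⟩) t ht hc
    · obtain ⟨g, hg, hg', hd⟩ := h.dominated e' f' hd t ht hc
      exact ⟨g, hg, by omega, by rwa [h6 g hg']⟩
    · exact ⟨s.var 1, h.le, by omega, by rw [h6']; exact Dominates.self hc⟩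

/-- The sets added since `s₀` form an undominated sequence, to which `card_le_of_undominated`
applies. -/
theorem var_one_le (h : Merging G s₀ done s) {τ : ℕ} (hτ : ProfileBound G τ)
    (hK : G.IsClique (G.outerBoundary (block n s₀.arr (s₀.var 10)))) :
    s.var 1 ≤ s₀.var 1 + s₀.var 2 * (2 ^ τ * (2 ^ τ * (n + 1))) := by
  have h1 := card_le_of_undominated hτ hK (p := s₀.var 2) (m := s.var 1 - s₀.var 1)
    (fun g => storedSet n s.arr (s₀.var 1 + g)) (guess n s₀)
    (fun g hg => h.subset _ (by omega) (by omega)) (fun g hg => ?_)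
  · have := h.le
    omega
  · obtain ⟨t, ht, hc, hd⟩ := h.undominated (s₀.var 1 + g) (by omega) (by omega)
    exact ⟨t, ht, hc, fun g' hg' => hd _ (by omega) (by omega)⟩

end Merging

namespace Cmd

open Tm

variable {B : ℕ} {s : State} {Q : State → Prop}

theorem wp_storeUnion (h0 : s.var 0 = n) (h16 : s.var 16 < s.var 1) (h17 : s.var 17 < s.var 1) :
    Wp B (forTo 4 0 <| store 6 (cell (var 1) (var 4)) (or (memT 16 4) (memT 17 4))) s fun s' =>
      Frame [4] [6] s s' ∧ storedSet n s'.arr (s.var 1) =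
        storedSet n s.arr (s.var 16) ∪ storedSet n s.arr (s.var 17) ∧
      ∀ g < s.var 1, storedSet n s'.arr g = storedSet n s.arr g := by
  refine wp_forTo_fin h0 (fun i s' => Frame [4] [6] s s' ∧
    (∀ x : Fin n, x.val < i → (s'.arr 6 (n * s.var 1 + x) ≠ 0 ↔
      x ∈ storedSet n s.arr (s.var 16) ∪ storedSet n s.arr (s.var 17))) ∧
    ∀ g < s.var 1, storedSet n s'.arr g = storedSet n s.arr g)
    ⟨Frame.refl _ _ _, by simp, fun _ _ => rfl⟩ (fun i s₁ hI => ?_)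
    fun s' hI => ⟨hI.1, Finset.ext fun x => by rw [mem_storedSet, hI.2.1 x x.2], hI.2.2⟩
  obtain ⟨hf, h, hs⟩ := hI
  have h0' : (s₁.setVar 4 i).var 0 = n := by simpa [hf.var 0 (by simp)] using h0
  have hval : (or (memT 16 4) (memT 17 4)).eval (s₁.setVar 4 i).arr (s₁.setVar 4 i).var ≠ 0 ↔
      i ∈ storedSet n s.arr (s.var 16) ∪ storedSet n s.arr (s.var 17) := by
    rw [or_ne_zero, memT_ne_zero h0' (by simp) (i := i) (by simp),
      memT_ne_zero h0' (by simp) (i := i) (by simp), Finset.mem_union, State.setVar_arr,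
      State.setVar_var, update_of_ne (by simp), update_of_ne (by simp), hf.var 16 (by simp),
      hf.var 17 (by simp), hs _ h16, hs _ h17]
  refine wp_store ?_
  rw [eval_cell_var (by simp)]
  have h1 : (s₁.setVar 4 i).var 1 = s.var 1 := by simp [hf.var 1 (by simp)]
  have h4 : (s₁.setVar 4 i).var 4 = i := by simp
  rw [h0', h1, h4]
  refine ⟨(hf.setVar (by simp)).setArr (by simp), fun x hx => ?_, fun g hg => ?_⟩
  · rw [State.setArr_arr, update_self]
    by_cases hxi : x = i
    · rw [hxi, update_self, hval]
    · have : x.val ≠ i := fun h => hxi (Fin.ext h)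
      rw [update_of_ne fun h => hxi (cell_inj.mp h).2]
      exact h x (by omega)
  · rw [← hs g hg]
    refine storedSet_congr fun x => ?_
    rw [State.setArr_arr, update_self, update_of_ne fun h => hg.ne (cell_inj.mp h).1,
      State.setVar_arr]

theorem wp_tryCandidate {τ : ℕ} (hτ : ProfileBound G τ) {s₀ : State} (h0 : s₀.var 0 = n)
    (hG : HoldsGraph G s₀.arr)
    (hK : G.IsClique (G.outerBoundary (block n s₀.arr (s₀.var 10))))
    (hB : s₀.var 1 + s₀.var 2 * (2 ^ τ * (2 ^ τ * (n + 1))) ≤ B)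
    (hown : ∀ g < s₀.var 1, s₀.arr 5 g ≠ s₀.var 10)
    {done : ℕ → ℕ → Prop} (h : Merging G s₀ done s) {e f : ℕ} (h16 : s.var 16 = e)
    (h17 : s.var 17 = f) (he : e < s₀.var 1) (hf : f < s₀.var 1)
    (hsub : ∀ x ∈ storedSet n s₀.arr e ∪ storedSet n s₀.arr f, x ∈ block n s₀.arr (s₀.var 10)) :
    Wp B tryCandidate s fun s' => s'.var 16 = e ∧ s'.var 17 = f ∧
      Merging G s₀ (fun e' f' => done e' f' ∨ e' = e ∧ f' = f) s' := by
  have hle := h.le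
  refine wp_seq ((wp_storeUnion (n := n) (by rw [h.frame.var 0 (by simp), h0]) (by omega)
    (by omega)).mono fun s₁ ⟨hf₁, hnew, hold⟩ => ?_)
  rw [h16, h17, h.stored_of_lt e he, h.stored_of_lt f hf] at hnew
  refine wp_seq (wp_store ?_)
  have h1 : (var 1).eval s₁.arr s₁.var = s.var 1 := hf₁.var 1 (by simp)
  have h10 : (var 10).eval s₁.arr s₁.var = s₀.var 10 := by
    change s₁.var 10 = _
    rw [hf₁.var 10 (by simp), h.frame.var 10 (by simp)]
  rw [h1, h10]
  set s₂ := s₁.setArr 5 (s.var 1) (s₀.var 10) with hs₂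
  have hf₂ : Frame [1, 4, 16, 17] [5, 6] s₀ s₂ :=
    (h.frame.trans (hf₁.mono (by simp) (by simp))).setArr (by simp)
  have hvar : s₂.var = s₁.var := rfl
  have h5 : ∀ g < s.var 1, s₂.arr 5 g = s.arr 5 g := by
    intro g hg
    rw [hs₂, State.setArr_arr, update_self, update_of_ne hg.ne, hf₁.arr 5 (by simp)]
  have h5' : s₂.arr 5 (s.var 1) = s₀.var 10 := by
    rw [hs₂, State.setArr_arr, update_self, update_self]
  have h6 : ∀ g, storedSet n s₂.arr g = storedSet n s₁.arr g := fun g =>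
    storedSet_congr fun x => by rw [hs₂, State.setArr_arr, update_of_ne (by simp)]
  have hM : Merging G s₀ done s₂ := h.congr hf₂ h1 h5 fun g hg => (h6 g).trans (hold g hg)
  have hone : s₂.var 1 = s.var 1 := h1
  have hkeep : keepT.eval s₂.arr s₂.var ≠ 0 ↔ ∃ t < s₀.var 2, (∀ i ∈ block n s₀.arr (s₀.var 10),
      G.Covers (storedSet n s₀.arr e ∪ storedSet n s₀.arr f ∪ guess n s₀ t) i) ∧
      ∀ g < s.var 1, s₀.var 1 ≤ g → ¬ Dominates G (block n s₀.arr (s₀.var 10)) (guess n s₀ t)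
        (storedSet n s₀.arr e ∪ storedSet n s₀.arr f) (storedSet n s.arr g) := by
    rw [keepT_ne_zero (n := n) (G := G) (hG.congr (hf₂.arr 0 (by simp)) (hf₂.arr 3 (by simp)))
      (by rw [hf₂.var 0 (by simp), h0])]
    have hguess : ∀ t, guess n s₂ t = guess n s₀ t := fun t => by
      ext x
      simp [guess, bitSet_congr (hf₂.arr 7 (by simp)), hf₂.var 2 (by simp)]
    change (∃ t < s₂.var 2, (∀ i ∈ block n s₂.arr (s₂.var 10),
      G.Covers (storedSet n s₂.arr (s₂.var 1) ∪ guess n s₂ t) i) ∧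
      ∀ g < s₂.var 1, s₂.arr 5 g = s₂.var 10 → ¬ Dominates G (block n s₂.arr (s₂.var 10))
        (guess n s₂ t) (storedSet n s₂.arr (s₂.var 1)) (storedSet n s₂.arr g)) ↔ _
    simp only [hguess, hf₂.var 2 (by simp), hf₂.var 10 (by simp), hone, h6, hnew,
      block_congr (hf₂.arr 4 (by simp))]
    refine exists_congr fun t => and_congr_right fun _ => and_congr Iff.rfl ?_
    refine forall₂_congr fun g hg => ?_
    rw [hold g hg, h5 g hg]
    -- The new label is fresh, so the owner test in the formula selects exactly the sets stored
    -- since `s₀`.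
    refine imp_congr_left ⟨fun h' => ?_, fun h' => h.owner g h' hg⟩
    by_contra hlt
    rw [h.owner_of_lt g (by omega)] at h'
    exact hown g (by omega) h'
  have h16' : s₂.var 16 = e := by rw [hvar, hf₁.var 16 (by simp), h16]
  have h17' : s₂.var 17 = f := by rw [hvar, hf₁.var 17 (by simp), h17]
  refine wp_ite (fun hc => ?_) fun hc => wp_skip ⟨h16', h17', hM.discard fun t ht hcov => ?_⟩
  · rw [hkeep] at hc
    have hval : (add (var 1) (const 1)).eval s₂.arr s₂.var = s.var 1 + 1 :=
      congrArg (· + 1) hone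
    have hM' := h.keep he hf (hf₂.setVar (x := 1) (m := s.var 1 + 1) (by simp)) (by simp) h5
      (fun g hg => (h6 g).trans (hold g hg)) h5' ((h6 _).trans hnew) hsub hc
    refine wp_assign (fun _ => ?_) ?_
    · rw [hval]
      exact (by simpa using hM'.var_one_le hτ hK : s.var 1 + 1 ≤ _).trans hB
    · rw [hval]
      exact ⟨by simpa using h16', by simpa using h17', hM'⟩
  · rw [← not_not (a := _ = 0), ← ne_eq, hkeep] at hc
    by_contra hno
    refine hc ⟨t, ht, hcov, fun g hg hg₀ hd => hno ⟨g, hone ▸ hg, hg₀, ?_⟩⟩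
    rwa [h6, hold g hg]

theorem wp_mergeFamilies {τ : ℕ} (hτ : ProfileBound G τ) (h0 : s.var 0 = n)
    (hG : HoldsGraph G s.arr)
    (hK : G.IsClique (G.outerBoundary (block n s.arr (s.var 10))))
    (hB : s.var 1 + s.var 2 * (2 ^ τ * (2 ^ τ * (n + 1))) ≤ B)
    (hown : ∀ g < s.var 1, s.arr 5 g ≠ s.var 10)
    (hsub : ∀ g < s.var 1, s.arr 5 g = s.var 11 ∨ s.arr 5 g = s.var 12 →
      ∀ x ∈ storedSet n s.arr g, x ∈ block n s.arr (s.var 10)) :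
    Wp B mergeFamilies s fun s' => ∃ s₀ : State, s₀.arr = s.arr ∧ (∀ z ≠ 3, s₀.var z = s.var z) ∧
      Merging G s₀ (fun e f => e < s.var 1 ∧ f < s.var 1 ∧ s.arr 5 e = s.var 11 ∧
        s.arr 5 f = s.var 12) s' := by
  refine wp_seq (wp_assign (fun _ => by simp only [eval]; omega) ?_)
  change Wp B _ (s.setVar 3 (s.var 1)) _
  set s₀ := s.setVar 3 (s.var 1) with hs₀
  have hv : ∀ z ≠ 3, s₀.var z = s.var z := fun z hz => by rw [hs₀, State.setVar_var, update_of_ne hz]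
  have h3 : s₀.var 3 = s₀.var 1 := by simp [hs₀]
  have harr : s₀.arr = s.arr := rfl
  have hv1 := hv 1 (by simp)
  refine wp_forTo (fun i => Merging G s₀ fun e f => e < i ∧ f < s₀.var 1 ∧
    s.arr 5 e = s.var 11 ∧ s.arr 5 f = s.var 12)
    ((Merging.init G s₀).mono fun e f h => by omega) (fun e he s₁ h₁ => ?_)
    fun s' h' => ⟨s₀, rfl, hv, h'.mono fun e f h => by rwa [h3, hv1]⟩
  have h₁' := h₁.setVar (x := 16) (m := e) (by simp)
  have h3' : (s₁.setVar 16 e).var 3 = s₀.var 1 := by rw [h₁'.frame.var 3 (by simp), h3]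
  -- The pairs that are done precede `(e, j)` lexicographically. The limit is the count from the
  -- start, so new sets are not combined in turn.
  refine wp_forTo (fun j s' => s'.var 16 = e ∧ Merging G s₀ (fun e' f' => (e' < e ∨ e' = e ∧ f' < j)
    ∧ f' < s₀.var 1 ∧ s.arr 5 e' = s.var 11 ∧ s.arr 5 f' = s.var 12) s')
    ⟨by simp, h₁'.mono fun e' f' h => ⟨by omega, h.2⟩⟩ (fun f hf s₂ h₂ => ?_)
    fun s' h' => h'.2.mono fun e' f' h => ⟨by omega, h.2⟩
  rw [h3] at he
  rw [h3'] at hf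
  obtain ⟨h16, h₂⟩ := h₂
  have h₃ := h₂.setVar (x := 17) (m := f) (by simp)
  have hc : (and (eq (load 5 (var 16)) (var 11)) (eq (load 5 (var 17)) (var 12))).eval
      (s₂.setVar 17 f).arr (s₂.setVar 17 f).var ≠ 0 ↔
      s.arr 5 e = s.var 11 ∧ s.arr 5 f = s.var 12 := by
    rw [and_ne_zero, eq_ne_zero, eq_ne_zero]
    simp only [eval, h₃.frame.var 11 (by simp), h₃.frame.var 12 (by simp), hv 11 (by simp),
      hv 12 (by simp)]
    have : (s₂.setVar 17 f).var 16 = e := by simpa using h16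
    rw [this, h₃.owner_of_lt e he, State.setVar_var, update_self, h₃.owner_of_lt f hf, harr]
  refine wp_ite (fun hc' => ?_) fun hc' => wp_skip ⟨by simpa using h16, h₃.mono fun e' f' h => ?_⟩
  · rw [hc] at hc'
    refine (wp_tryCandidate (n := n) (G := G) (e := e) (f := f) (s₀ := s₀) hτ
      (by rw [hv 0 (by simp), h0]) hG
      ?_ ?_ ?_ h₃ (by simpa using h16) (by simp) he hf ?_).mono fun s' h' =>
      ⟨h'.1, h'.2.2.mono fun e' f' h => ?_⟩
    · rwa [hv 10 (by simp)]
    · rwa [hv 1 (by simp), hv 2 (by simp)]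
    · rwa [hv 10 (by simp), hv 1 (by simp)]
    · rw [hv 10 (by simp), harr]
      intro x hx
      rw [hv1] at he hf
      rcases Finset.mem_union.mp hx with hx | hx
      · exact hsub e he (.inl hc'.1) x hx
      · exact hsub f hf (.inr hc'.2) x hx
    · by_cases hef : e' = e ∧ f' = f
      · exact .inr hef
      · exact .inl ⟨by omega, h.2⟩
  · rw [← not_not (a := _ = 0), ← ne_eq, hc] at hc'
    refine ⟨?_, h.2⟩
    by_cases hef : e' = e ∧ f' = f
    · exact absurd (by rw [← hef.1, ← hef.2]; exact h.2.2) hc'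
    · omega

end Cmd

end RAM

/-! ### The invariant of the main loop -/

namespace SimpleGraph

theorem Represents.mono {V : Type*} {G : SimpleGraph V} [DecidableEq V] {F F' : Set (Finset V)}
    {Q : Set V} (h : G.Represents F Q) (hF : F ⊆ F') : G.Represents F' Q :=
  fun S X hS hX hG => let ⟨S', hS', h'⟩ := h S X hS hX hG; ⟨S', hF hS', h'⟩

end SimpleGraph

namespace RAM

open Function (update update_self update_of_ne)
open SimpleGraph

variable {n : ℕ} {G : SimpleGraph (Fin n)}

/-- Given an outer part `X`, some union of a pair completes it. Replacing `X` by the representatives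
of its classes gives a guess for which this union still covers the block; a stored set dominates it
for that guess, and the exchange argument leads back to `X`. -/
theorem Merging.represents {s₀ s : State} {done : ℕ → ℕ → Prop} (h : Merging G s₀ done s)
    {Q : Set (Fin n)} (hQ : block n s₀.arr (s₀.var 10) = Q)
    (h2 : s₀.var 2 = 2 ^ (representatives G Q).card)
    (h7 : ∀ x : Fin n, s₀.arr 7 x =
      if x ∈ representatives G Q then 2 ^ rank (representatives G Q) x else 0)
    (hK : G.IsClique (G.outerBoundary Q))
    (hsub : ∀ e f, done e f → ∀ x ∈ storedSet n s₀.arr e ∪ storedSet n s₀.arr f, x ∈ Q)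
    (hF : G.Represents
      {S | ∃ e f, done e f ∧ S = storedSet n s₀.arr e ∪ storedSet n s₀.arr f} Q) :
    G.Represents {S | ∃ g, s₀.var 1 ≤ g ∧ g < s.var 1 ∧ S = storedSet n s.arr g} Q := by
  subst hQ
  intro S X hS hX hSX
  obtain ⟨_, ⟨e, f, hef, rfl⟩, hcard, hgeo⟩ := hF S X hS hX hSX
  obtain ⟨t, ht, T, hbit, hT, hXT, hTX⟩ := exists_bitSet_simulates h7 hX
  have hguess : guess n s₀ t = T := by
    ext x
    simp [guess, h2, hbit]
  obtain ⟨g, hg, hg', hd⟩ := h.dominated e f hef t (h2 ▸ ht) fun i hi => by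
    rw [hguess]
    exact covers_union_of_simulates_outer hK (hsub e f hef) hX hXT hi (hgeo i)
  rw [hguess] at hd
  obtain ⟨hcov, hsim, hout, hle⟩ := hd
  exact ⟨_, ⟨g, hg, hg', rfl⟩, hle.trans hcard, isGeodeticSet_union_of_simulates hK
    (h.subset g hg hg') hX hT hTX hsim hout hcov hgeo⟩

/-- The invariant of the main loop. -/
structure LoopInvariant (G : SimpleGraph (Fin n)) (M st : ℕ) (s : State) : Prop where
  order : s.var 0 = n
  holds : HoldsGraph G s.arr
  labeling : G.IsBlockLabeling n fun k : Fin n => s.arr 4 k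
  label_lt : ∀ k : Fin n, s.arr 4 k < n + st
  owner_lt : ∀ e < s.var 1, s.arr 5 e < n + st
  subset : ∀ k : Fin n, ∀ e < s.var 1, s.arr 5 e = s.arr 4 k → ∀ x ∈ storedSet n s.arr e,
    x ∈ block n s.arr (s.arr 4 k)
  represents : ∀ k : Fin n, G.Represents
    {S | ∃ e < s.var 1, s.arr 5 e = s.arr 4 k ∧ S = storedSet n s.arr e}
    (block n s.arr (s.arr 4 k))
  heap_le : s.var 1 ≤ 2 * n + st * M
  progress : (∀ x y : Fin n, s.arr 4 x = s.arr 4 y ∧ n ≤ s.arr 4 x) ∨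
    blockMeasure n (fun k : Fin n => s.arr 4 k) + st ≤ 2 * n

namespace LoopInvariant

variable {M st : ℕ} {s s' : State}

theorem init (h0 : s.var 0 = n) (h1 : s.var 1 = 2 * n) (hG : HoldsGraph G s.arr)
    (h : ∀ k : Fin n, s.arr 4 k = k ∧ s.arr 5 k = k ∧ s.arr 5 (n + k) = k ∧
      storedSet n s.arr k = ∅ ∧ storedSet n s.arr (n + k) = {k}) : LoopInvariant G M 0 s := by
  have h4 : ∀ k : Fin n, s.arr 4 k = k := fun k => (h k).1
  have hblock : ∀ k : Fin n, block n s.arr (s.arr 4 k) = {k} := fun k => by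
    ext x
    simp [block, h4, Fin.ext_iff]
  have hcases : ∀ e < s.var 1, ∃ k : Fin n, s.arr 5 e = k ∧
      (storedSet n s.arr e = ∅ ∨ storedSet n s.arr e = {k}) := by
    intro e he
    by_cases hen : e < n
    · exact ⟨⟨e, hen⟩, (h ⟨e, hen⟩).2.1, .inl (h ⟨e, hen⟩).2.2.2.1⟩
    · obtain ⟨k, rfl⟩ := Nat.exists_eq_add_of_le (not_lt.mp hen)
      have hk : k < n := by omega
      exact ⟨⟨k, hk⟩, (h ⟨k, hk⟩).2.2.1, .inr (h ⟨k, hk⟩).2.2.2.2⟩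
  refine ⟨h0, hG, ⟨fun x y _ hxy => ?_, fun x hx => ?_, fun x hx => ?_⟩, fun k => ?_, fun e he => ?_,
    fun k e he hek x hx => ?_, fun k S X hS hX hSX => ?_, by omega, .inr ?_⟩
  · simpa [h4, Fin.ext_iff] using hxy
  · have := x.2; rw [h4] at hx; omega
  · have := x.2; rw [h4] at hx; omega
  · rw [h4]; exact k.2
  · obtain ⟨k, hk, -⟩ := hcases e he
    rw [hk]; exact k.2
  · obtain ⟨k', hk', hs⟩ := hcases e he
    have hkk : k' = k := Fin.ext (by rw [← hk', hek, h4])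
    rw [hblock, ← hkk]
    rcases hs with hs | hs
    · simp [hs] at hx
    · rwa [hs, Finset.mem_singleton] at hx
  · rw [hblock] at hS
    have hk := k.2
    by_cases hkS : k ∈ S
    · have : S = {k} := Finset.eq_singleton_iff_unique_mem.mpr ⟨hkS, hS⟩
      exact ⟨S, ⟨n + k, by omega, by rw [(h k).2.2.1, h4], by rw [(h k).2.2.2.2, this]⟩, le_rfl, hSX⟩
    · have : S = ∅ := Finset.eq_empty_of_forall_notMem fun x hx => hkS (hS x hx ▸ hx)
      exact ⟨S, ⟨k, by omega, by rw [(h k).2.1, h4], by rw [(h k).2.2.2.1, this]⟩, le_rfl, hSX⟩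
  · have h1 := Finset.card_filter_le (Finset.univ : Finset (Fin n)) fun x => s.arr 4 x < n
    have h2 := Finset.card_image_le (s := (Finset.univ : Finset (Fin n))) (f := fun k => s.arr 4 k)
    rw [Finset.card_univ, Fintype.card_fin] at h1 h2
    unfold blockMeasure
    beta_reduce
    omega

theorem not_mergeable_of_forall_eq {lab : Fin n → ℕ} (h : ∀ x y, lab x = lab y ∧ n ≤ lab x)
    (u v : Fin n) : ¬ G.Mergeable n lab u v := by
  rintro ⟨hne | hlt, -⟩
  · exact hne (h u v).1
  · have := (h u v).2
    omega

/-- When nothing is mergeable, `exists_mergeable` shows that the final single block has been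
reached, and `progress` holds by its first alternative. -/
theorem skip (h : LoopInvariant G M st s) (hG : G.HasSimplicialVertices)
    (hno : ∀ u v : Fin n, ¬ G.Mergeable n (fun k : Fin n => s.arr 4 k) u v)
    (hs' : s'.arr = s.arr) (h0 : s'.var 0 = n) (h1 : s'.var 1 = s.var 1) :
    LoopInvariant G M (st + 1) s' := by
  obtain ⟨-, h2, h3, h4, h5, h6, h7, h8, -⟩ := h
  refine ⟨h0, ?_, ?_, ?_, ?_, ?_, ?_, ?_, .inl ?_⟩
  · rwa [hs']
  · rwa [hs']
  · rw [hs']; exact fun k => (h4 k).trans (by omega)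
  · rw [hs', h1]; exact fun k hk => (h5 k hk).trans (by omega)
  · rwa [hs', h1]
  · rwa [hs', h1]
  · rw [h1]; exact h8.trans (by gcongr; omega)
  · rw [hs']
    by_contra hne
    obtain ⟨u, v, huv⟩ := h3.exists_mergeable hG hne
    exact hno u v huv

theorem represents_pairs (h : LoopInvariant G M st s) (u v : Fin n) : G.Represents
    {S | ∃ e f, (e < s.var 1 ∧ f < s.var 1 ∧ s.arr 5 e = s.arr 4 u ∧ s.arr 5 f = s.arr 4 v) ∧
      S = storedSet n s.arr e ∪ storedSet n s.arr f}
    (mergedBlock (fun k : Fin n => s.arr 4 k) u v) := by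
  by_cases huv : s.arr 4 u = s.arr 4 v
  · have hb : mergedBlock (fun k : Fin n => s.arr 4 k) u v = block n s.arr (s.arr 4 u) := by
      ext x
      simp [mergedBlock, block, huv]
    rw [hb]
    refine (h.represents u).mul_self.mono ?_
    rintro _ ⟨_, ⟨e, he, heu, rfl⟩, _, ⟨f, hf, hfv, rfl⟩, rfl⟩
    exact ⟨e, f, ⟨he, hf, heu, hfv.trans huv⟩, rfl⟩
  · refine ((h.represents u).mul (h.represents v) ?_ ?_).mono ?_
    · rintro _ ⟨e, he, heu, rfl⟩
      exact h.subset u e he heu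
    · rw [Set.disjoint_left]
      intro x hx hx'
      exact huv (hx.symm.trans hx')
    · rintro _ ⟨_, ⟨e, he, heu, rfl⟩, _, ⟨f, hf, hfv, rfl⟩, rfl⟩
      exact ⟨e, f, ⟨he, hf, heu, hfv⟩, rfl⟩

/-- Other blocks keep their labels and families. The sets of the two old families stay stored
without an owner, so the number of stored sets grows by at most `M` per round. -/
theorem merge (h : LoopInvariant G M st s) {u v : Fin n}
    (huv : G.Mergeable n (fun k : Fin n => s.arr 4 k) u v) (h0 : s'.var 0 = n)
    (hG : HoldsGraph G s'.arr)
    (h4 : ∀ k : Fin n, s'.arr 4 k =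
      SimpleGraph.relabel (fun k : Fin n => s.arr 4 k) u v (n + st) k)
    (hle : s.var 1 ≤ s'.var 1) (hle' : s'.var 1 ≤ s.var 1 + M)
    (hown : ∀ g < s.var 1, s'.arr 5 g = s.arr 5 g)
    (hset : ∀ g < s.var 1, storedSet n s'.arr g = storedSet n s.arr g)
    (hown' : ∀ g, s.var 1 ≤ g → g < s'.var 1 → s'.arr 5 g = n + st)
    (hset' : ∀ g, s.var 1 ≤ g → g < s'.var 1 → ∀ x ∈ storedSet n s'.arr g,
      x ∈ mergedBlock (fun k : Fin n => s.arr 4 k) u v)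
    (hrep : G.Represents {S | ∃ g, s.var 1 ≤ g ∧ g < s'.var 1 ∧ S = storedSet n s'.arr g}
      (mergedBlock (fun k : Fin n => s.arr 4 k) u v)) : LoopInvariant G M (st + 1) s' := by
  set lab := fun k : Fin n => s.arr 4 k with hlab
  have hm : ∀ x, lab x ≠ n + st := fun x => (h.label_lt x).ne
  have hlab' : (fun k : Fin n => s'.arr 4 k) = SimpleGraph.relabel lab u v (n + st) := funext h4
  have hin : ∀ k ∈ mergedBlock lab u v, s'.arr 4 k = n + st := fun k hk =>
    (h4 k).trans ((relabel_eq_iff hm k).mpr hk)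
  have hout : ∀ k ∉ mergedBlock lab u v, s'.arr 4 k = lab k := fun k hk =>
    (h4 k).trans (relabel_of_notMem hk)
  have hbin : ∀ k ∈ mergedBlock lab u v, block n s'.arr (s'.arr 4 k) = mergedBlock lab u v := by
    intro k hk
    ext x
    rw [hin k hk, ← relabel_eq_iff hm x, ← h4 x]
    rfl
  have hbout : ∀ k ∉ mergedBlock lab u v, block n s'.arr (s'.arr 4 k) = block n s.arr (lab k) := by
    intro k hk
    ext x
    rw [hout k hk]
    change s'.arr 4 x = lab k ↔ lab x = lab k
    by_cases hx : x ∈ mergedBlock lab u v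
    · rw [hin x hx]
      refine ⟨fun h => absurd h.symm (hm k), fun h => absurd ?_ hk⟩
      exact hx.imp (fun h' => h.symm.trans h') fun h' => h.symm.trans h'
    · rw [hout x hx]
  have hold : ∀ k ∉ mergedBlock lab u v, ∀ e < s'.var 1, s'.arr 5 e = s'.arr 4 k →
      e < s.var 1 ∧ s.arr 5 e = lab k := by
    intro k hk e he hek
    rw [hout k hk] at hek
    by_cases hlt : e < s.var 1
    · exact ⟨hlt, by rw [← hown e hlt, hek]⟩
    · exact absurd (hek.symm.trans (hown' e (by omega) he)) (hm k)
  have hnew : ∀ k ∈ mergedBlock lab u v, ∀ e < s'.var 1, s'.arr 5 e = s'.arr 4 k →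
      s.var 1 ≤ e := by
    intro k hk e he hek
    rw [hin k hk] at hek
    by_contra hlt
    have := h.owner_lt e (by omega)
    rw [hown e (by omega)] at hek
    omega
  refine ⟨h0, hG, ?_, fun k => ?_, fun e he => ?_, fun k e he hek => ?_, fun k => ?_, ?_, ?_⟩
  · rw [hlab']
    exact h.labeling.relabel huv hm (by omega)
  · by_cases hk : k ∈ mergedBlock lab u v
    · rw [hin k hk]; omega
    · rw [hout k hk]; have := h.label_lt k; simp only [hlab]; omega
  · by_cases hlt : e < s.var 1
    · rw [hown e hlt]; have := h.owner_lt e hlt; omega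
    · rw [hown' e (by omega) he]; omega
  · by_cases hk : k ∈ mergedBlock lab u v
    · rw [hbin k hk]
      exact hset' e (hnew k hk e he hek) he
    · obtain ⟨hlt, hek'⟩ := hold k hk e he hek
      rw [hbout k hk, hset e hlt]
      exact h.subset k e hlt hek'
  · by_cases hk : k ∈ mergedBlock lab u v
    · rw [hbin k hk]
      refine hrep.mono ?_
      rintro _ ⟨g, hg, hg', rfl⟩
      exact ⟨g, hg', by rw [hown' g hg hg', hin k hk], rfl⟩
    · rw [hbout k hk]
      refine (h.represents k).mono ?_
      rintro _ ⟨g, hg, hgk, rfl⟩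
      exact ⟨g, by omega, by rw [hown g hg, hout k hk, hgk], (hset g hg).symm⟩
  · have := h.heap_le
    rw [add_mul, one_mul]
    omega
  · rw [hlab']
    rcases h.progress with hd | hd
    · exact absurd huv (not_mergeable_of_forall_eq hd u v)
    · have := huv.blockMeasure_lt hm (by omega)
      rw [← hlab] at hd
      exact .inr (by omega)

/-- After `2 * n` rounds the second alternative of `progress` would make the positive `blockMeasure`
zero. So one block contains all vertices, and its family represents it with empty outer part. -/
theorem exists_optimal (h : LoopInvariant G M (2 * n) s) (hn : 0 < n) : ∃ e < s.var 1,
    G.IsMinimumGeodeticSet (storedSet n s.arr e) := by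
  classical
  have : Nonempty (Fin n) := ⟨⟨0, hn⟩⟩
  have hdone : ∀ x y : Fin n, s.arr 4 x = s.arr 4 y ∧ n ≤ s.arr 4 x := by
    refine h.progress.resolve_right fun h' => ?_
    have := blockMeasure_pos n fun k : Fin n => s.arr 4 k
    omega
  have hex : ∃ m, ∃ S : Finset (Fin n), G.IsGeodeticSet S ∧ S.card = m :=
    ⟨_, Finset.univ, fun w => ⟨w, by simp, w, by simp, .nil, by simp⟩, rfl⟩
  obtain ⟨S, hS, hcard⟩ := Nat.find_spec hex
  have hb : ∀ x, x ∈ block n s.arr (s.arr 4 (⟨0, hn⟩ : Fin n)) := fun x => (hdone x _).1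
  obtain ⟨_, ⟨e, he, -, rfl⟩, hle, hgeo⟩ := h.represents ⟨0, hn⟩ S ∅ (fun x _ => hb x) (by simp)
    (by rwa [Finset.union_empty])
  rw [Finset.union_empty] at hgeo
  exact ⟨e, he, hgeo, fun S' hS' =>
    hle.trans (hcard.trans_le (Nat.find_min' hex ⟨S', hS', rfl⟩))⟩

end LoopInvariant

end RAM

/-! ### Correctness and running time of the whole program -/

namespace RAM

open Function (update update_self update_of_ne)
open SimpleGraph

variable {n : ℕ} {G : SimpleGraph (Fin n)}

/-- A bound for the number of sets that are stored in one round of the main loop. -/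
def familyBound (n τ : ℕ) : ℕ := 2 ^ τ * (2 ^ τ * (2 ^ τ * (n + 1)))

/-- A bound for the numbers that occur as limits of loops. -/
def registerBound (n τ : ℕ) : ℕ := 2 * n + 2 * n * familyBound n τ

theorem two_pow_le_registerBound (hn : 0 < n) (τ : ℕ) : 2 ^ τ ≤ registerBound n τ := by
  have h1 : 2 ^ τ ≤ familyBound n τ :=
    Nat.le_mul_of_pos_right _ (by positivity)
  have h2 : familyBound n τ ≤ 2 * n * familyBound n τ := Nat.le_mul_of_pos_left _ (by positivity)
  unfold registerBound
  omega

theorem registerBound_add_one_le (hn : 0 < n) (τ : ℕ) :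
    registerBound n τ + 1 ≤ 2 ^ (3 * (τ + 1)) * n ^ 2 := by
  have h1 : 1 ≤ (2 ^ τ) ^ 3 := Nat.one_le_pow _ _ (by positivity)
  have h2 : 2 ^ (3 * (τ + 1)) = 8 * (2 ^ τ) ^ 3 := by
    rw [mul_comm, pow_mul, pow_succ 2 τ, mul_pow]; ring
  have h3 : familyBound n τ = (2 ^ τ) ^ 3 * (n + 1) := by unfold familyBound; ring
  unfold registerBound
  rw [h2, h3]
  generalize (2 ^ τ) ^ 3 = m at h1
  nlinarith [Nat.mul_le_mul h1 (Nat.mul_le_mul hn hn), Nat.mul_le_mul h1 hn,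
    Nat.mul_le_mul_left m (Nat.mul_le_mul_left n hn)]

namespace Cmd

open Tm

variable {B : ℕ} {s : State} {Q : State → Prop}

theorem wp_seq_assoc {c d e : Cmd} (h : Wp B (seq (seq c d) e) s Q) :
    Wp B (seq c (seq d e)) s Q :=
  ⟨⟨h.1.1.1, h.1.1.2, h.1.2⟩, h.2⟩

theorem wp_mergeStep {τ st : ℕ} (hn : 0 < n) (hG : G.HasSimplicialVertices)
    (hτ : ProfileBound G τ) (hst : st < 2 * n) (h : LoopInvariant G (familyBound n τ) st s)
    (h15 : s.var 15 = st) :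
    Wp (registerBound n τ) mergeStep s (LoopInvariant G (familyBound n τ) (st + 1)) := by
  set lab := fun k : Fin n => s.arr 4 k with hlab
  refine wp_seq (wp_assign (by simp) (wp_seq (wp_assign (by simp) ?_)))
  have h10 : (add (var 0) (var 15)).eval s.arr s.var = n + st := by
    simp only [eval, h.order, h15]
  rw [h10]
  set s₁ := s.setVar 10 (n + st) with hs₁
  have h₁0 : s₁.var 0 = n := by simpa [hs₁] using h.order
  have hG₁ : HoldsGraph G s₁.arr := h.holds
  have hspec := eval_least_spec (A := s₁.arr) (v := s₁.var) (x := 40) (z := 41) (y := 0)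
    (P := fun x => ex 42 0 (mergeableT x 42))
    (R := fun j => ∃ u v : Fin n, u.val = j ∧ G.Mergeable n lab u v) (by simp) (by simp)
    fun i _ j hj => by
      rw [h₁0] at hj
      rw [ex_fin_ne_zero (n := n) (by simpa using h₁0)]
      constructor
      · rintro ⟨v, hv⟩
        rw [mergeableT_ne_zero (i := ⟨j, hj⟩) (j := v) hG₁ (by simpa using h₁0) (by simp)
          (by simp) (by simp) (by simp)] at hv
        exact ⟨⟨j, hj⟩, v, rfl, hv⟩
      · rintro ⟨u, v, rfl, huv⟩
        refine ⟨v, ?_⟩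
        rw [mergeableT_ne_zero (i := u) (j := v) hG₁ (by simpa using h₁0) (by simp)
          (by simp) (by simp) (by simp)]
        exact huv
  rw [h₁0] at hspec
  generalize (least 40 41 0 fun x => ex 42 0 (mergeableT x 42)).eval s₁.arr s₁.var = m at hspec
  set s₂ := s₁.setVar 13 m with hs₂
  have hc : (lt (var 13) (var 0)).eval s₂.arr s₂.var ≠ 0 ↔ m < n := by
    rw [lt_ne_zero]
    simp [eval, hs₂, h₁0]
  have h₂0 : s₂.var 0 = n := by simp [hs₂, h₁0]
  refine wp_ite (fun hm => ?_) fun hm => wp_skip ?_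
  · rw [hc] at hm
    obtain ⟨-, u, v', rfl, huv'⟩ := hspec.resolve_right (by omega)
    refine wp_seq (wp_assign (by simp) ?_)
    have hspec := eval_least_spec (A := s₂.arr) (v := s₂.var) (x := 40) (z := 41) (y := 0)
      (P := fun x => mergeableT 13 x)
      (R := fun j => ∃ v : Fin n, v.val = j ∧ G.Mergeable n lab u v) (by simp) (by simp)
      fun i _ j hj => by
        rw [h₂0] at hj
        rw [mergeableT_ne_zero (i := u) (j := ⟨j, hj⟩) (show HoldsGraph G s₂.arr from hG₁) (by simpa using h₂0) (by simp [hs₂])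
          (by simp) (by simp) (by simp)]
        constructor
        · exact fun h => ⟨⟨j, hj⟩, rfl, h⟩
        · rintro ⟨v, rfl, huv⟩
          exact huv
    rw [h₂0] at hspec
    -- The first search guarantees the partner `v'` of `u`; the second one finds the least partner
    -- `v`.
    obtain ⟨-, v, hv, huv⟩ :=
      hspec.resolve_right fun h => h.2 v' v'.2 ⟨v', rfl, huv'⟩
    rw [← hv]
    refine wp_seq (wp_assign (by simp) (wp_seq (wp_assign (by simp) ?_)))
    have h11 : (labT 13).eval (s₂.setVar 14 v).arr (s₂.setVar 14 v).var = lab u := by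
      simp [labT, eval, hs₂, hs₁, hlab]
    rw [h11]
    have h12 : (labT 14).eval ((s₂.setVar 14 v).setVar 11 (lab u)).arr
        ((s₂.setVar 14 v).setVar 11 (lab u)).var = lab v := by
      simp [labT, eval, hs₂, hs₁, hlab]
    rw [h12]
    set s₃ := ((s₂.setVar 14 v).setVar 11 (lab u)).setVar 12 (lab v) with hs₃
    have harr₃ : s₃.arr = s.arr := rfl
    have h₃0 : s₃.var 0 = n := by simp [hs₃, h₂0]
    have h₃1 : s₃.var 1 = s.var 1 := by simp [hs₃, hs₂, hs₁]
    have h₃10 : s₃.var 10 = n + st := by simp [hs₃, hs₂, hs₁]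
    have h₃11 : s₃.var 11 = lab u := by simp [hs₃]
    have h₃12 : s₃.var 12 = lab v := by simp [hs₃]
    refine wp_seq ((wp_relabelBlock h₃0 (i := u) (j := v) h₃11 h₃12).mono
      fun s₄ ⟨hf₄, h₄4⟩ => ?_)
    rw [h₃10, harr₃] at h₄4
    have hmx : ∀ x, lab x ≠ n + st := fun x => (h.label_lt x).ne
    have h₄10 : s₄.var 10 = n + st := by rw [hf₄.var 10 (by simp), h₃10]
    have hblock : block n s₄.arr (s₄.var 10) = mergedBlock lab u v := by
      ext x
      rw [h₄10, ← relabel_eq_iff hmx x, ← h₄4 x]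
      rfl
    have hK := huv.2.1
    have hcard := card_representatives_le hτ hK
    have h₄0 : s₄.var 0 = n := by rw [hf₄.var 0 (by simp), h₃0]
    have hG₄ : HoldsGraph G s₄.arr := h.holds.congr (hf₄.arr 0 (by simp)) (hf₄.arr 3 (by simp))
    refine wp_seq ((wp_findRepresentatives h₄0 hG₄ ?_).mono fun s₅ ⟨hf₅, h₅2, h₅7⟩ => ?_)
    · rw [hblock]
      exact (Nat.pow_le_pow_right (by simp) hcard).trans (two_pow_le_registerBound hn τ)
    rw [hblock] at h₅2 h₅7
    have h₅0 : s₅.var 0 = n := by rw [hf₅.var 0 (by simp), h₄0]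
    have h₅1 : s₅.var 1 = s.var 1 := by
      rw [hf₅.var 1 (by simp), hf₄.var 1 (by simp), h₃1]
    have h₅10 : s₅.var 10 = n + st := by rw [hf₅.var 10 (by simp), h₄10]
    have h₅11 : s₅.var 11 = lab u := by
      rw [hf₅.var 11 (by simp), hf₄.var 11 (by simp), h₃11]
    have h₅12 : s₅.var 12 = lab v := by
      rw [hf₅.var 12 (by simp), hf₄.var 12 (by simp), h₃12]
    have h₅5 : s₅.arr 5 = s.arr 5 := by rw [hf₅.arr 5 (by simp), hf₄.arr 5 (by simp), harr₃]
    have h₅6 : ∀ g, storedSet n s₅.arr g = storedSet n s.arr g := fun g =>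
      storedSet_congr fun x => by rw [hf₅.arr 6 (by simp), hf₄.arr 6 (by simp), harr₃]
    have hG₅ : HoldsGraph G s₅.arr := hG₄.congr (hf₅.arr 0 (by simp)) (hf₅.arr 3 (by simp))
    have hblock₅ : block n s₅.arr (s₅.var 10) = mergedBlock lab u v := by
      rw [← hblock, h₅10, h₄10, block_congr (hf₅.arr 4 (by simp))]
    have hfam : s₅.var 2 * (2 ^ τ * (2 ^ τ * (n + 1))) ≤ familyBound n τ := by
      rw [h₅2]
      exact Nat.mul_le_mul_right _ (Nat.pow_le_pow_right (by simp) hcard)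
    have hsub : ∀ g < s.var 1, s.arr 5 g = lab u ∨ s.arr 5 g = lab v →
        ∀ x ∈ storedSet n s.arr g, x ∈ mergedBlock lab u v := by
      rintro g hg (hgu | hgv) x hx
      · exact .inl (h.subset u g hg hgu x hx)
      · exact .inr (h.subset v g hg hgv x hx)
    refine (wp_mergeFamilies (n := n) hτ h₅0 hG₅ (by rwa [hblock₅]) ?_ ?_ ?_).mono
      fun s' ⟨s₀, harr, hvar, hM⟩ => ?_
    -- At most `st` earlier rounds and the present one have stored sets, and `st + 1 ≤ 2 * n`; this
    -- is what `registerBound` allows for.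
    · have h1 := h.heap_le
      have h2 := Nat.mul_le_mul_right (familyBound n τ) (show st + 1 ≤ 2 * n from hst)
      rw [add_mul, one_mul] at h2
      unfold registerBound
      omega
    · rw [h₅1, h₅5, h₅10]
      exact fun g hg => (h.owner_lt g hg).ne
    · rw [h₅1, h₅5, h₅11, h₅12, hblock₅]
      simpa only [h₅6] using hsub
    · simp only [h₅1, h₅5, h₅11, h₅12] at hM
      have hv1 : s₀.var 1 = s.var 1 := by rw [hvar 1 (by simp), h₅1]
      have hv10 : s₀.var 10 = n + st := by rw [hvar 10 (by simp), h₅10]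
      have hblock₀ : block n s₀.arr (s₀.var 10) = mergedBlock lab u v := by
        rw [harr, hv10, ← h₅10, hblock₅]
      have hset₀ : ∀ g, storedSet n s₀.arr g = storedSet n s.arr g := fun g => by
        rw [harr, h₅6]
      have hle := hM.var_one_le hτ (by rwa [hblock₀])
      refine h.merge huv ?_ ?_ (fun k => ?_) (hv1 ▸ hM.le) ?_ (fun g hg => ?_) (fun g hg => ?_)
        (fun g hg hg' => ?_) (fun g hg hg' => ?_) ?_
      · rw [hM.frame.var 0 (by simp), hvar 0 (by simp), h₅0]
      · exact (harr ▸ hG₅ : HoldsGraph G s₀.arr).congr (hM.frame.arr 0 (by simp))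
          (hM.frame.arr 3 (by simp))
      · rw [hM.frame.arr 4 (by simp), harr, hf₅.arr 4 (by simp), h₄4]
      · rw [hv1, hvar 2 (by simp)] at hle
        omega
      · rw [hM.owner_of_lt g (hv1.symm ▸ hg), harr, h₅5]
      · rw [hM.stored_of_lt g (hv1.symm ▸ hg), hset₀]
      · rw [hM.owner g (hv1.symm ▸ hg) hg', hv10]
      · rw [← hblock₀]
        exact hM.subset g (hv1.symm ▸ hg) hg'
      · rw [← hv1]
        refine hM.represents hblock₀ ?_ ?_ hK ?_ ?_
        · rw [hvar 2 (by simp), h₅2]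
        · rw [harr]; exact h₅7
        · rintro e f ⟨he, hf, heu, hfv⟩ x hx
          rw [hset₀, hset₀] at hx
          rcases Finset.mem_union.mp hx with hx | hx
          · exact hsub e he (.inl heu) x hx
          · exact hsub f hf (.inr hfv) x hx
        · simpa only [hset₀] using h.represents_pairs u v
  · rw [← not_not (a := _ = 0), ← ne_eq, hc] at hm
    obtain ⟨-, hno⟩ := hspec.resolve_left fun h => hm h.1
    exact h.skip hG (fun u v huv => hno u u.2 ⟨u, v, rfl, huv⟩) rfl h₂0 (by simp [hs₂, hs₁])

open Classical in
theorem wp_output (h0 : s.var 0 = n) (hG : HoldsGraph G s.arr)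
    (h : ∃ e < s.var 1, G.IsMinimumGeodeticSet (storedSet n s.arr e)) :
    Wp B output s fun s' => ∃ S : Finset (Fin n), G.IsMinimumGeodeticSet S ∧
      ∀ i : Fin n, s'.arr 1 i = if i ∈ S then 1 else 0 := by
  have hspec := eval_least_spec (A := s.arr) (v := s.var) (x := 40) (z := 41) (y := 1)
    (P := optimalT)
    (R := fun j => G.IsGeodeticSet (storedSet n s.arr j) ∧ ∀ g < s.var 1,
      G.IsGeodeticSet (storedSet n s.arr g) →
        (storedSet n s.arr j).card ≤ (storedSet n s.arr g).card) (by simp) (by simp)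
    fun i _ j hj => by
      rw [optimalT_ne_zero (n := n) hG (by simpa using h0) (by simp) (by simp)]
      simp
  obtain ⟨e, he, hmin⟩ := h
  obtain ⟨-, h1, h2⟩ := hspec.resolve_right fun h => h.2 e he ⟨hmin.1, fun g _ => hmin.2 _⟩
  refine wp_seq (wp_assign (by simp) ?_)
  generalize (least 40 41 1 optimalT).eval s.arr s.var = m at h1 h2
  refine wp_forTo_fin (n := n) (by simpa using h0) (fun i s' => s'.var 0 = n ∧ s'.var 16 = m ∧
      s'.arr 6 = s.arr 6 ∧ ∀ x : Fin n, x.val < i → s'.arr 1 x =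
        if x ∈ storedSet n s.arr m then 1 else 0) ⟨by simpa using h0, by simp, rfl, by simp⟩
    (fun i s₁ hI => wp_store ?_) fun s' hI => ⟨storedSet n s.arr m,
      ⟨h1, fun S hS => (h2 e he hmin.1).trans (hmin.2 S hS)⟩, fun x => hI.2.2.2 x x.2⟩
  obtain ⟨h₁0, h₁16, h₁6, h₁1⟩ := hI
  have hmem : (memT 16 4).eval (s₁.setVar 4 i).arr (s₁.setVar 4 i).var ≠ 0 ↔
      i ∈ storedSet n s.arr m := by
    rw [memT_ne_zero (n := n) (i := i) (by simpa using h₁0) (by simp) (by simp)]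
    rw [storedSet_congr (A := s.arr) (e := m)]
    intro x
    rw [State.setVar_arr, h₁6, State.setVar_var, update_of_ne (by simp), h₁16]
  have hval : (Tm.not (Tm.not (memT 16 4))).eval (s₁.setVar 4 i).arr (s₁.setVar 4 i).var =
      if i ∈ storedSet n s.arr m then 1 else 0 := by
    rw [eval_not, eval_not, ← if_congr hmem rfl rfl]
    split_ifs <;> simp_all
  have h4 : (var 4).eval (s₁.setVar 4 i).arr (s₁.setVar 4 i).var = i := by simp [eval]
  rw [hval, h4]
  refine ⟨by simpa using h₁0, by simpa using h₁16, ?_, fun x hx => ?_⟩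
  · rw [State.setArr_arr, update_of_ne (by simp), State.setVar_arr, h₁6]
  · rw [State.setArr_arr, update_self]
    by_cases hxi : x = i
    · rw [hxi, update_self]
    · have : x.val ≠ i := fun h => hxi (Fin.ext h)
      rw [update_of_ne this]
      exact h₁1 x (by omega)

open Classical in
theorem wp_minGeodetic {τ : ℕ} (hn : 0 < n) (hG : G.HasSimplicialVertices)
    (hτ : ProfileBound G τ) : Wp (registerBound n τ) minGeodetic (graphInput G) fun s' =>
      ∃ S : Finset (Fin n), G.IsMinimumGeodeticSet S ∧
        ∀ i : Fin n, s'.arr 1 i = if i ∈ S then 1 else 0 := by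
  have hB : n + n ≤ registerBound n τ := by unfold registerBound; omega
  have h0 : (graphInput G).var 0 = n := by simp [graphInput]
  have hadj : ∀ i j : Fin n, (graphInput G).arr 0 (n * i + j) ≠ 0 ↔ G.Adj i j := by
    intro i j
    simp only [graphInput, true_and, ne_eq, ite_eq_right_iff, one_ne_zero, imp_false, not_not]
    constructor
    · rintro ⟨i', j', h, hadj⟩
      rw [mul_comm i'.val] at h
      obtain ⟨h1, rfl⟩ := cell_inj.mp h
      rwa [Fin.ext h1]
    · exact fun h => ⟨i, j, by rw [mul_comm], h⟩
  refine wp_seq_assoc (wp_seq ((wp_distances h0 hadj).mono fun s₁ ⟨hf₁, hG₁⟩ => ?_))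
  have h₁0 : s₁.var 0 = n := by rw [hf₁.var 0 (by simp), h0]
  refine wp_seq ((wp_initHeap h₁0 fun a => ?_).mono fun s₂ ⟨hf₂, h₂⟩ => ?_)
  · rw [hf₁.arr 6 (by simp)]; simp [graphInput]
  have h₂0 : s₂.var 0 = n := by rw [hf₂.var 0 (by simp), h₁0]
  have hG₂ : HoldsGraph G s₂.arr := hG₁.congr (hf₂.arr 0 (by simp)) (hf₂.arr 3 (by simp))
  have hval : (add (var 0) (var 0)).eval s₂.arr s₂.var = n + n := by simp only [eval, h₂0]
  refine wp_seq (wp_assign (fun _ => hval ▸ hB) ?_)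
  rw [hval]
  have hval : (add (var 0) (var 0)).eval (s₂.setVar 1 (n + n)).arr (s₂.setVar 1 (n + n)).var =
      n + n := by simp [eval, h₂0]
  refine wp_seq (wp_assign (fun _ => hval ▸ hB) ?_)
  rw [hval]
  refine wp_seq (wp_forTo (LoopInvariant G (familyBound n τ))
    (LoopInvariant.init (by simpa using h₂0) (by simp [two_mul]) hG₂ h₂) (fun st hst s₃ h₃ => ?_)
    fun s₃ h₃ => ?_)
  · rw [State.setVar_var, update_self, ← two_mul] at hst
    obtain ⟨a, b, c, d, e, f, g, h, i⟩ := h₃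
    exact wp_mergeStep hn hG hτ hst ⟨by simpa using a, b, c, d, e, f, g, h, i⟩ (by simp)
  · rw [State.setVar_var, update_self, ← two_mul] at h₃
    exact wp_output h₃.order h₃.holds (h₃.exists_optimal hn)

end Cmd

/-- The program and the constants are chosen before `τ`: the time is a fixed polynomial in
`registerBound n τ`, which is itself at most 2^{O(τ+1)} n². -/
theorem exists_computesMGS : ∃ (p : Prog) (C d : ℕ), ∀ (n : ℕ) (G : SimpleGraph (Fin n)) (τ : ℕ),
    0 < n → G.HasSimplicialVertices → ProfileBound G τ →
    ComputesMGS p G (2 ^ (C * (τ + 1)) * n ^ d) := by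
  obtain ⟨K, d, hK⟩ := Cmd.minGeodetic.exists_polynomial_timeBound
  refine ⟨Cmd.minGeodetic.comp 100, K + 3 * d, 2 * d, fun n G τ hn hG hτ => ?_⟩
  obtain ⟨hbd, S, hS, hout⟩ := Cmd.wp_minGeodetic hn hG hτ
  have h4 : ∀ z < 4, (graphInput G).var z ≤ registerBound n τ := by
    intro z _
    change (if z = 0 then n else 0) ≤ _
    unfold registerBound
    split_ifs <;> omega
  obtain ⟨s', T, he, hT, harr, -⟩ := Cmd.exec_comp (b := 100) (by simp) _ 100 _ (graphInput G)
    le_rfl Cmd.fits_minGeodetic rfl (fun _ _ => rfl) h4 hbd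
  refine ⟨s', T, he, hT.trans ((hK _).trans ?_), S, hS, fun i => by rw [harr]; convert hout i⟩
  calc K * (registerBound n τ + 1) ^ d
      ≤ 2 ^ (K * (τ + 1)) * (2 ^ (3 * (τ + 1)) * n ^ 2) ^ d := by
        gcongr
        · exact (Nat.le_mul_of_pos_right K τ.succ_pos).trans Nat.lt_two_pow_self.le
        · exact registerBound_add_one_le hn τ
    _ = 2 ^ ((K + 3 * d) * (τ + 1)) * n ^ (2 * d) := by
        rw [mul_pow, ← pow_mul, ← pow_mul, ← mul_assoc, ← pow_add]
        ring_nf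

theorem ComputesMGS.mono {p : Prog} {T T' : ℕ} (h : ComputesMGS p G T) (hT : T ≤ T') :
    ComputesMGS p G T' :=
  let ⟨s, t, he, ht, h'⟩ := h; ⟨s, t, he, ht.trans hT, h'⟩

/-- Turns the exponent `C * (τ + 1)` for `τ = 2 ^ m` into a power of two, as the double exponential
bounds require. -/
theorem mul_two_pow_add_one_le {C m : ℕ} (hm : 1 ≤ m) :
    C * (2 ^ m + 1) ≤ 2 ^ ((C + 2) * m) := by
  have h1 : C ≤ 2 ^ (C * m) := (Nat.le_mul_of_pos_right C hm).trans Nat.lt_two_pow_self.le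
  have h2 : 2 ^ m + 1 ≤ 2 ^ (2 * m) := by
    rw [mul_comm, pow_mul]
    have : 2 ≤ 2 ^ m := Nat.le_self_pow (by omega) 2
    nlinarith
  calc C * (2 ^ m + 1) ≤ 2 ^ (C * m) * 2 ^ (2 * m) := Nat.mul_le_mul h1 h2
    _ = _ := by rw [← pow_add, add_mul]

end RAM

/-! ### The three graph classes -/

theorem theorem4 :
    (∃ (p : RAM.Prog) (a c : ℕ), ∀ (n : ℕ) (G : SimpleGraph (Fin n)), 0 < n →
      G.IsChordalGraph → RAM.ComputesMGS p G (2 ^ 2 ^ (a * G.cliqueNum) * n ^ c)) ∧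
    (∃ (p : RAM.Prog) (a c : ℕ), ∀ (n : ℕ) (G : SimpleGraph (Fin n)), 0 < n →
      G.IsIntervalGraph → RAM.ComputesMGS p G (2 ^ (a * G.cliqueNum) * n ^ c)) ∧
    (∃ (p : RAM.Prog) (a c : ℕ), ∀ (k n : ℕ) (G : SimpleGraph (Fin n)),
      G.IsKTree k → RAM.ComputesMGS p G (2 ^ 2 ^ (a * (k + 1)) * n ^ c)) := by
  obtain ⟨p, C, d, h⟩ := RAM.exists_computesMGS
  -- Additive constants in the exponents are absorbed into multiples of ω, which needs ω ≥ 1.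
  have hω : ∀ (n : ℕ) (G : SimpleGraph (Fin n)), 0 < n → 1 ≤ G.cliqueNum := fun n G hn => by
    have := SimpleGraph.IsClique.ncard_le_cliqueNum (G := G) (K := {⟨0, hn⟩}) (by simp)
    simpa using this
  have hle : ∀ m : ℕ, m ≤ 2 ^ m := fun m => Nat.lt_two_pow_self.le
  refine ⟨⟨p, C + 2, d, fun n G hn hG => ?_⟩, ⟨p, 6 * C, d, fun n G hn hG => ?_⟩,
    p, C + 2, d, fun k n G hG => ?_⟩
  · refine (h n G (2 ^ G.cliqueNum) hn hG.hasSimplicialVertices fun K hK => ?_).mono ?_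
    · have := SimpleGraph.IsClique.ncard_le_cliqueNum hK
      exact ⟨(SimpleGraph.ncard_range_profile_le K).trans (Nat.pow_le_pow_right (by simp) this),
        this.trans (hle _)⟩
    · gcongr
      · simp
      · exact RAM.mul_two_pow_add_one_le (hω n G hn)
  · obtain ⟨l, r, hrep⟩ := hG.exists_rep
    refine (h n G (3 * G.cliqueNum + 2) hn hrep.hasSimplicialVertices fun K hK => ?_).mono ?_
    · have := SimpleGraph.IsClique.ncard_le_cliqueNum hK
      exact ⟨(hrep.ncard_range_profile_le hK).trans (by omega), by omega⟩
    · have := hω n G hn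
      -- With τ = 3ω + 2 the exponent is C(3ω + 3), which is at most 6Cω.
      refine Nat.mul_le_mul_right _ (Nat.pow_le_pow_right (by simp) ?_)
      rw [mul_comm 6, mul_assoc]
      exact Nat.mul_le_mul_left C (by omega)
  · refine (h n G (2 ^ (k + 1)) (Nat.succ_pos k |>.trans_le hG.1) hG.hasSimplicialVertices
      fun K hK => ?_).mono ?_
    · have := hG.ncard_le hK
      exact ⟨(SimpleGraph.ncard_range_profile_le K).trans (Nat.pow_le_pow_right (by simp) this),
        this.trans (hle _)⟩
    · gcongr
      · simp
      · exact RAM.mul_two_pow_add_one_le (by omega)
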